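/- Let $n\ge 2$, $j\ge 1$, $\lambda=\frac{n-1}{2}$, let $\mathcal S^n\subset\mathbb R^{n+1}$ be the unit sphere with surface measure $d\sigma$ of total mass $\Sigma_n=\frac{2\pi^{\lambda+1}}{\Gamma(\lambda+1)}$, and let $\langle f,g\rangle=\frac1{\Sigma_n}\int_{\mathcal S^n}\overline{f}\,g\,d\sigma$ with induced norm $\|\cdot\|$. Let $\mathcal H_l$ be the space of restrictions to $\mathcal S^n$ of complex harmonic homogeneous polynomials of degree $l$ on $\mathbb R^{n+1}$, and $\mathcal W_j=\bigoplus_{l=2^{j-1}}^{2^j-1}\mathcal H_l$. Let $C_l^\lambda$ be the Gegenbauer polynomials, $\sum_{l\ge0} C_l^\lambda(t)r^l=(1-2tr+r^2)^{-\lambda}$, and $$\varphi_j=2^{-nj/2}\sum_{l=0}^{2^{j-1}-1}\frac{l+\lambda}{\lambda}C_l^\lambda,\qquad \psi_j=2^{-nj/2}\sum_{l=2^{j-1}}^{2^j-1}\frac{l+\lambda}{\lambda}C_l^\lambda .$$ Use spherical coordinates $(\vartheta_1,\dots,\vartheta_{n-1},\phi)$, where $x_i=\sin\vartheta_1\cdots\sin\vartheta_{i-1}\cos\vartheta_i$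 for $i\le n-1$, $x_n=\sin\vartheta_1\cdots\sin\vartheta_{n-1}\cos\phi$ and $x_{n+1}=\sin\vartheta_1\cdots\sin\vartheta_{n-1}\sin\phi$. Let $\mathcal N_j=\{0,\dots,2^j\}^{n-1}\times\{0,\dots,2^{j+1}-1\}$ and, for $(s,t)\in\mathcal N_j$, let $x^j_{s,t}$ be the point with coordinates $\left(\frac{s_1\pi}{2^j},\dots,\frac{s_{n-1}\pi}{2^j},\frac{t\pi}{2^j}\right)$ and $w^{j}_{s,t}=\prod_{\nu=1}^{n-1}\chi^{(j)}_{s_\nu}$. Here $\chi^{(j)}_{s_\nu}=\chi_{s_\nu}$ is the quadrature weight with $M=2^j$, $\alpha=n-\nu$, $$\chi_u=\epsilon_u\,\frac{\pi\,\alpha!}{2^{\alpha-1}M}\sum_{\mu=0}^{\lfloor M/2\rfloor}\frac{\epsilon_{2\mu}(-1)^\mu\cos\frac{2\mu u\pi}{M}}{\Gamma(\frac\alpha2-\mu+1)\,\Gamma(\frac\alpha2+\mu+1)},\qquad \epsilon_0=\epsilon_M=\tfrac12,\ \ \epsilon_u=1\text{ otherwise},$$ with summands at poles of $\Gamma$ read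 as $0$. For integers $l=k_0\ge k_1\ge\dots\ge k_{n-1}\ge0$ and $k=(k_1,\dots,\pm k_{n-1})$ let $$Y_l^k=A_l^k\prod_{\nu=1}^{n-1}C_{k_{\nu-1}-k_\nu}^{\frac{n-\nu}2+k_\nu}(\cos\vartheta_\nu)\sin^{k_\nu}\vartheta_\nu\; e^{\pm ik_{n-1}\phi}$$ with $A_l^k>0$ chosen so that $\|Y_l^k\|=1$; let $I_j$ be the set of these indices $(l,k)$ with $l\le 2^{j-1}-1$, and let $a_l^k(f)=\langle Y_l^k,f\rangle$. Then the following hold for all $(s,t)\in\mathcal N_{j+1}$; write $\psi_{s,t}=\psi_j(\circ\cdot x^{j+1}_{s,t})$. 1. $\psi_{s,t}$ is real-valued. 2. $\langle\psi_{s,t},f\rangle=2^{-nj/2}f(x_{s,t}^{j+1})$ for all $f\in\mathcal W_j$. 3. $\langle\varphi_j(x^j_{s',t'}\cdot\circ),\psi_j(x^{j+1}_{s,t}\cdot\circ)\rangle=0$ for all $(s',t')\in\mathcal N_j$. 4. $$\|\psi_{s,t}\|^2=2^{-nj/2}\psi_j(1)=\frac1{2^{nj}\,n!}\left(\frac{(n+2^{j+1}-2)(n+2^j-2)!}{(2^j-1)!}-\frac{(n+2^j-2)(n+2^{j-1}-2)!}{(2^{j-1}-1)!}\right).$$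 5. $\displaystyle\frac{\|\psi_{s,t}\|}{\psi_j(x_{s,t}^{j+1}\cdot x_{s,t}^{j+1})}=\min\{\|f\|:f\in\mathcal W_j,\ f(x_{s,t}^{j+1})=1\}.$ 6. $\operatorname{span}\{\psi_{s,t}:(s,t)\in\mathcal N_{j+1}\}=\mathcal W_j$, and for every $f\in\mathcal W_j$ $$f=\frac{\sqrt2^{\,(n-2)j-2}\,\pi}{\Sigma_n}\sum_{(s,t)\in\mathcal N_{j+1}}w^{j+1}_{s,t}\,f(x^{j+1}_{s,t})\,\psi_{s,t}.$$ 7. For every $f\in\mathcal W_j$ the tight frame identity $$\frac{2^{(n-1)j-1}\,\pi}{\Sigma_n}\sum_{(s,t)\in\mathcal N_{j+1}}w^{j+1}_{s,t}\,|\langle f,\psi_{s,t}\rangle|^2=\|f\|^2$$ holds. If $n\le3$, all weights $w^{j+1}_{s,t}$ are nonnegative and the family $\left(\sqrt{w^{j+1}_{s,t}}\;\psi_{s,t}\right)_{(s,t)\in\mathcal N_{j+1}}$ is a tight frame in $\mathcal W_j$. 8. For every index $(l,k)$: if $(l,k)\in I_{j+1}\setminus I_j$, then $$a_l^k(\psi_{s,t})=2^{-nj/2}\,\overline{Y_l^k(x_{s,t}^{j+1})}=\sqrt2^{\,n}\,a_l^k\big(\varphi_{j+1}(\circ\cdot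 x_{s,t}^{j+1})\big),$$ and otherwise $a_l^k(\psi_{s,t})=0$. 9. $\int_{\mathcal S^n}\psi_j(x\cdot x^{j+1}_{s,t})\,d\sigma(x)=0$. -/

import Mathlib

open MeasureTheory
open scoped Nat

noncomputable section

namespace SphereWavelets

/-! ### The sphere, its surface measure and the normalized scalar product -/

/-- The `n`-dimensional unit sphere in `ℝ^(n+1)`. -/
abbrev Sph (n : ℕ) : Type :=
  Metric.sphere (0 : EuclideanSpace ℝ (Fin (n + 1))) 1

/-- The rotation-invariant surface measure `dσ` on the sphere. -/
def sigma (n : ℕ) : Measure (Sph n) :=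
  (volume : Measure (EuclideanSpace ℝ (Fin (n + 1)))).toSphere

/-- `λ = (n - 1) / 2`. -/
def lam (n : ℕ) : ℝ := ((n : ℝ) - 1) / 2

/-- `Σ_n = 2 π^(λ+1) / Γ(λ+1)`. -/
def sphereArea (n : ℕ) : ℝ :=
  2 * Real.pi ^ (lam n + 1) / Real.Gamma (lam n + 1)

/-- `Σ_n` is the total mass of `dσ`. -/
theorem sigma_real_univ (n : ℕ) : (sigma n).real Set.univ = sphereArea n := by
  unfold sigma sphereArea
  rw [Measure.toSphere_real_apply_univ, Measure.real, EuclideanSpace.volume_ball]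
  have h1 : (0 : ℝ) < ((n : ℝ) + 1) / 2 := by positivity
  have h2 : lam n + 1 = ((n : ℝ) + 1) / 2 := by unfold lam; ring
  have h3 : ((Fintype.card (Fin (n + 1)) : ℕ) : ℝ) / 2 + 1 = ((n : ℝ) + 1) / 2 + 1 := by simp
  have h4 : Real.sqrt Real.pi ^ (Fintype.card (Fin (n + 1))) = Real.pi ^ (((n : ℝ) + 1) / 2) := by
    rw [Real.sqrt_eq_rpow, ← Real.rpow_natCast, ← Real.rpow_mul Real.pi_pos.le]
    congr 1
    simp
    ring
  have hG : 0 < Real.Gamma (((n : ℝ) + 1) / 2) := Real.Gamma_pos_of_pos h1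
  rw [h3, h4, Real.Gamma_add_one h1.ne', h2]
  have h5 : (0 : ℝ) ≤ Real.pi ^ (((n : ℝ) + 1) / 2) /
      (((n : ℝ) + 1) / 2 * Real.Gamma (((n : ℝ) + 1) / 2)) := by positivity
  simp only [ENNReal.ofReal_one, one_pow, one_mul, ENNReal.toReal_ofReal h5,
    finrank_euclideanSpace, Fintype.card_fin]
  push_cast
  field_simp

/-- `⟨f, g⟩ = (1 / Σ_n) ∫ conj (f x) g x dσ(x)`. -/
def l2inner (n : ℕ) (f g : Sph n → ℂ) : ℂ :=
  (1 / (sphereArea n : ℂ)) * ∫ x, (starRingEnd ℂ) (f x) * g x ∂(sigma n)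

/-- The norm induced by `l2inner`. -/
def l2norm (n : ℕ) (f : Sph n → ℂ) : ℝ := Real.sqrt (l2inner n f f).re

/-! ### Hyperspherical harmonics and the wavelet spaces -/

/-- The Laplace operator on polynomials in `n + 1` variables. -/
def polyLaplacian (n : ℕ) :
    MvPolynomial (Fin (n + 1)) ℂ →ₗ[ℂ] MvPolynomial (Fin (n + 1)) ℂ :=
  ∑ i, (MvPolynomial.pderiv (R := ℂ) i).toLinearMap ∘ₗ (MvPolynomial.pderiv i).toLinearMap

/-- Restriction of a polynomial to the sphere. -/
def restrictToSphere (n : ℕ) : MvPolynomial (Fin (n + 1)) ℂ →ₗ[ℂ] (Sph n → ℂ) where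
  toFun Q := fun x => MvPolynomial.eval (fun i => ((x.1 i : ℝ) : ℂ)) Q
  map_add' P Q := by funext x; simp
  map_smul' c Q := by funext x; simp [MvPolynomial.smul_eval]

/-- `ℋ_l`: restrictions to the sphere of harmonic homogeneous polynomials of degree `l`. -/
def harmonicSpace (n l : ℕ) : Submodule ℂ (Sph n → ℂ) :=
  (MvPolynomial.homogeneousSubmodule (Fin (n + 1)) ℂ l ⊓
    LinearMap.ker (polyLaplacian n)).map (restrictToSphere n)

/-- The wavelet space `𝒲_j`, the sum of the `ℋ_l` over `2^(j-1) ≤ l ≤ 2^j - 1`. -/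
def waveletSpace (n j : ℕ) : Submodule ℂ (Sph n → ℂ) :=
  ⨆ l ∈ Finset.Ico (2 ^ (j - 1)) (2 ^ j), harmonicSpace n l

/-! ### Gegenbauer polynomials, scaling functions and wavelets -/

/-- The Gegenbauer polynomial `C_l^a(t)`: the `l`-th Taylor coefficient at `r = 0` of the
generating function `(1 - 2 t r + r^2)^(-a)`. -/
def gegenbauer (a : ℝ) (l : ℕ) (t : ℝ) : ℝ :=
  iteratedDeriv l (fun r : ℝ => (1 - 2 * t * r + r ^ 2) ^ (-a)) 0 / (l ! : ℝ)

/-- The kernel of the scaling function,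
`φ_j = 2^(-nj/2) ∑_{l=0}^{2^(j-1)-1} ((l+λ)/λ) C_l^λ`. -/
def phiKernel (n j : ℕ) (t : ℝ) : ℝ :=
  1 / Real.sqrt 2 ^ (n * j) *
    ∑ l ∈ Finset.range (2 ^ (j - 1)), ((l : ℝ) + lam n) / lam n * gegenbauer (lam n) l t

/-- The kernel of the wavelet,
`ψ_j = 2^(-nj/2) ∑_{l=2^(j-1)}^{2^j-1} ((l+λ)/λ) C_l^λ`. -/
def psiKernel (n j : ℕ) (t : ℝ) : ℝ :=
  1 / Real.sqrt 2 ^ (n * j) *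
    ∑ l ∈ (Finset.Ico (2 ^ (j - 1)) (2 ^ j) : Finset ℕ),
      ((l : ℝ) + lam n) / lam n * gegenbauer (lam n) l t

/-- `φ_j(∘ · y)`. -/
def phi (n j : ℕ) (y : Sph n) : Sph n → ℂ :=
  fun x => (phiKernel n j (inner ℝ x.1 y.1) : ℂ)

/-- `ψ_j(∘ · y)`. -/
def psi (n j : ℕ) (y : Sph n) : Sph n → ℂ :=
  fun x => (psiKernel n j (inner ℝ x.1 y.1) : ℂ)

/-! ### The equiangular grid -/

/-- The `i`-th Cartesian coordinate (counted from `0`) of the point of `ℝ^(n+1)` with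
spherical coordinates `(ϑ, φ)`. -/
def sphericalCoord (n : ℕ) (th : Fin (n - 1) → ℝ) (ph : ℝ) (i : Fin (n + 1)) : ℝ :=
  (∏ v : Fin (n - 1), if v.val < i.val then Real.sin (th v) else 1) *
    (if h : i.val < n - 1 then Real.cos (th ⟨i.val, h⟩)
     else if i.val = n - 1 then Real.cos ph else Real.sin ph)

theorem sphericalCoord_sq_sum (n : ℕ) (hn : 2 ≤ n) (th : Fin (n - 1) → ℝ) (ph : ℝ) :
    ∑ i, sphericalCoord n th ph i ^ 2 = 1 := by
  obtain ⟨m, rfl⟩ : ∃ m, n = m + 1 := ⟨n - 1, by omega⟩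
  -- squared coordinates through an extension of the angles to all natural numbers
  let g : ℕ → ℝ := fun v => if h : v < m then th ⟨v, h⟩ else 0
  have hg : ∀ v : Fin m, g v.val = th v := fun v => by simp [g]
  have hprod : ∀ k ≤ m, (∏ v : Fin m, if v.val < k then Real.sin (th v) else 1) =
      ∏ v ∈ Finset.range k, Real.sin (g v) := by
    intro k hk
    have h1 : (∏ v : Fin m, if v.val < k then Real.sin (th v) else 1) =
        ∏ v : Fin m, (fun w : ℕ => if w < k then Real.sin (g w) else 1) v.val := by
      refine Finset.prod_congr rfl fun v _ => ?_
      simp [hg]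
    rw [h1, Fin.prod_univ_eq_prod_range (fun w : ℕ => if w < k then Real.sin (g w) else 1) m,
      ← Finset.prod_filter]
    congr 1
    ext w
    simp
    omega
  have key : ∀ k, ∑ i ∈ Finset.range k, ((∏ v ∈ Finset.range i, Real.sin (g v)) *
      Real.cos (g i)) ^ 2 = 1 - (∏ v ∈ Finset.range k, Real.sin (g v)) ^ 2 := by
    intro k
    induction k with
    | zero => simp
    | succ k ih =>
      rw [Finset.sum_range_succ, ih, Finset.prod_range_succ, mul_pow, mul_pow, Real.cos_sq']
      ring
  rw [Fin.sum_univ_castSucc, Fin.sum_univ_castSucc]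
  have e1 : ∑ i : Fin m, sphericalCoord (m + 1) th ph (i.castSucc.castSucc) ^ 2 =
      ∑ i ∈ Finset.range m, ((∏ v ∈ Finset.range i, Real.sin (g v)) *
        Real.cos (g i)) ^ 2 := by
    rw [← Fin.sum_univ_eq_sum_range]
    refine Finset.sum_congr rfl fun i _ => ?_
    have hi := hprod i.val i.isLt.le
    unfold sphericalCoord
    simp only [Fin.val_castSucc, Nat.add_sub_cancel, i.isLt, dif_pos, hg]
    exact congrArg (fun z => (z * Real.cos (th i)) ^ 2) hi
  have e2 : sphericalCoord (m + 1) th ph ((Fin.last m).castSucc) =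
      (∏ v ∈ Finset.range m, Real.sin (g v)) * Real.cos ph := by
    have hi := hprod m le_rfl
    unfold sphericalCoord
    simp only [Fin.val_castSucc, Fin.val_last, Nat.add_sub_cancel, lt_irrefl, dif_neg,
      not_false_eq_true, if_true]
    exact congrArg (fun z => z * Real.cos ph) hi
  have e3 : sphericalCoord (m + 1) th ph (Fin.last (m + 1)) =
      (∏ v ∈ Finset.range m, Real.sin (g v)) * Real.sin ph := by
    have hi := hprod m le_rfl
    have hi2 : (∏ v : Fin m, if v.val < m + 1 then Real.sin (th v) else 1) =
        ∏ v ∈ Finset.range m, Real.sin (g v) := by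
      rw [← hi]
      refine Finset.prod_congr rfl fun v _ => ?_
      rw [if_pos v.isLt, if_pos (by omega)]
    unfold sphericalCoord
    rw [dif_neg (by simp), if_neg (by simp)]
    exact congrArg (fun z => z * Real.sin ph) hi2
  rw [e1, key, e2, e3]
  linear_combination (∏ v ∈ Finset.range m, Real.sin (g v)) ^ 2 * Real.cos_sq_add_sin_sq ph

/-- The point of the sphere with spherical coordinates `(ϑ, φ)`. -/
def sphericalPoint (n : ℕ) (hn : 2 ≤ n) (th : Fin (n - 1) → ℝ) (ph : ℝ) : Sph n :=
  ⟨WithLp.toLp 2 (sphericalCoord n th ph), by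
    rw [mem_sphere_zero_iff_norm, EuclideanSpace.norm_eq]
    simp [sphericalCoord_sq_sum n hn th ph]⟩

/-- The index set `𝒩_j` of the grid: `s_ν = 0, …, 2^j` and `t = 0, …, 2^(j+1) - 1`. -/
abbrev GridIndex (n j : ℕ) : Type := (Fin (n - 1) → Fin (2 ^ j + 1)) × Fin (2 ^ (j + 1))

/-- The grid point `x_{s,t}^j` with spherical coordinates
`(s_1 π / 2^j, …, s_{n-1} π / 2^j, t π / 2^j)`. -/
def gridPoint (n : ℕ) (hn : 2 ≤ n) (j : ℕ) (p : GridIndex n j) : Sph n :=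
  sphericalPoint n hn (fun v => ((p.1 v).val : ℝ) * Real.pi / 2 ^ j)
    ((p.2.val : ℝ) * Real.pi / 2 ^ j)

/-- `ε_0 = ε_M = 1/2` and `ε_u = 1` otherwise. -/
def quadEps (M u : ℕ) : ℝ := if u = 0 ∨ u = M then 1 / 2 else 1

/-- The quadrature weight `χ_u = ε_u ω_u` with `M + 1` nodes for the weight function `sin^α`.
(At its poles `Real.Gamma` is `0`, so that the corresponding summands vanish, as they should.) -/
def quadWeight (α M u : ℕ) : ℝ :=
  quadEps M u * (Real.pi * (α ! : ℝ) / (2 ^ (α - 1) * (M : ℝ)) *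
    ∑ m ∈ Finset.range (M / 2 + 1),
      quadEps M (2 * m) * (-1) ^ m * Real.cos (2 * (m : ℝ) * (u : ℝ) * Real.pi / (M : ℝ)) /
        (Real.Gamma ((α : ℝ) / 2 - (m : ℝ) + 1) * Real.Gamma ((α : ℝ) / 2 + (m : ℝ) + 1)))

/-- The product `∏_{ν=1}^{n-1} χ_{s_ν}^{(j)}`, where `χ_{s_ν}^{(j)}` is computed for `M = 2^j`
and `α = n - ν` (here `v = ν - 1`). -/
def gridWeight (n j : ℕ) (p : GridIndex n j) : ℝ :=
  ∏ v : Fin (n - 1), quadWeight (n - (v.val + 1)) (2 ^ j) (p.1 v).val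

/-! ### The orthonormal basis of hyperspherical harmonics -/

/-- The angle `ϑ_ν` of a point of the sphere, `v = ν - 1`. -/
def polarAngle (n : ℕ) (x : Sph n) (v : Fin (n - 1)) : ℝ :=
  Real.arccos (x.1 ⟨v.val, by omega⟩ /
    Real.sqrt (∑ i : Fin (n + 1), if v.val ≤ i.val then x.1 i ^ 2 else 0))

/-- The angle `φ` of a point of the sphere. -/
def azimuth (n : ℕ) (x : Sph n) : ℝ :=
  Complex.arg ⟨x.1 ⟨n - 1, by omega⟩, x.1 (Fin.last n)⟩

/-- For `k = (k_1, …, k_{n-2}, ± k_{n-1})`, the sequence `l = k_0, k_1, …, k_{n-1}`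
of absolute values. -/
def absIndex {n : ℕ} (l : ℕ) (k : Fin (n - 1) → ℤ) : ℕ → ℕ
  | 0 => l
  | v + 1 => if h : v < n - 1 then (k ⟨v, h⟩).natAbs else 0

/-- `l = k_0 ≥ k_1 ≥ … ≥ k_{n-1} ≥ 0`, where `k = (k_1, …, k_{n-2}, ± k_{n-1})`. -/
def IsHarmonicIndex {n : ℕ} (l : ℕ) (k : Fin (n - 1) → ℤ) : Prop :=
  (∀ v < n - 1, absIndex l k (v + 1) ≤ absIndex l k v) ∧
    ∀ v : Fin (n - 1), v.val + 1 < n - 1 → 0 ≤ k v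

/-- The index set `I_j`. -/
def indexSet (n j : ℕ) : Set (ℕ × (Fin (n - 1) → ℤ)) :=
  {p | p.1 < 2 ^ (j - 1) ∧ IsHarmonicIndex p.1 p.2}

/-- The signed last entry `± k_{n-1}`. -/
def lastEntry {n : ℕ} (k : Fin (n - 1) → ℤ) : ℤ :=
  if h : n - 2 < n - 1 then k ⟨n - 2, h⟩ else 0

/-- The function
`∏_{ν=1}^{n-1} C_{k_{ν-1}-k_ν}^{(n-ν)/2+k_ν}(cos ϑ_ν) sin^{k_ν} ϑ_ν · exp(± i k_{n-1} φ)`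
(with `v = ν - 1`). -/
def harmonicUnnormalized (n l : ℕ) (k : Fin (n - 1) → ℤ) (x : Sph n) : ℂ :=
  ((∏ v : Fin (n - 1),
      gegenbauer (((n : ℝ) - ((v.val : ℝ) + 1)) / 2 + (absIndex l k (v.val + 1) : ℝ))
        (absIndex l k v.val - absIndex l k (v.val + 1)) (Real.cos (polarAngle n x v)) *
      Real.sin (polarAngle n x v) ^ absIndex l k (v.val + 1) : ℝ) : ℂ) *
    Complex.exp (Complex.I * (lastEntry k : ℂ) * (azimuth n x : ℂ))

/-- The hyperspherical harmonic `Y_l^k`, of `L²`-norm one. -/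
def harmonicY (n l : ℕ) (k : Fin (n - 1) → ℤ) (x : Sph n) : ℂ :=
  (1 / (l2norm n (harmonicUnnormalized n l k) : ℂ)) * harmonicUnnormalized n l k x

/-- The Fourier coefficient `a_l^k(f) = ⟨Y_l^k, f⟩`. -/
def fourierCoefficient (n l : ℕ) (k : Fin (n - 1) → ℤ) (f : Sph n → ℂ) : ℂ :=
  l2inner n (harmonicY n l k) f

/-! ### Tight frames -/

/-- A finite family of functions is a tight frame in the subspace `W`. -/
def IsTightFrame (n : ℕ) {ι : Type} [Fintype ι] (W : Submodule ℂ (Sph n → ℂ))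
    (g : ι → Sph n → ℂ) : Prop :=
  (∀ i, g i ∈ W) ∧
    ∃ A : ℝ, 0 < A ∧ ∀ f ∈ W, ∑ i, ‖l2inner n f (g i)‖ ^ 2 = A * l2norm n f ^ 2

end SphereWavelets

end

/-!
The idea is that everything follows from two facts about polynomials on the sphere: the kernels
`∑ (l + λ) / λ C_l^λ(x · y)` reproduce spherical harmonics, and the grid of level `J` carries a
quadrature formula that is exact up to degree `2 ^ J`.

*Reproducing kernels.* Integrals of homogeneous polynomials over the sphere are proportional to
integrals against the Gaussian weight `exp (-|x| ^ 2)` (`sphereInt_eq_gaussInt`), where integration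
by parts is the algebraic identity `E[x_i P] = E[∂_i P] / 2` (`gaussInt_X_mul`). It gives the
orthogonality of harmonic polynomials of different degrees (`gaussInt_harmonic_orthogonal`), and the
fact that a harmonic polynomial of degree `l` is orthogonal to `(x · y) ^ m` for `m < l`, while
`(x · y) ^ l` evaluates it at `y` up to a constant (`gaussInt_mul_linForm_pow_self`). As
`C_l^λ(x · y)` is a polynomial of degree `l` in `x · y`, only its leading coefficient, known from
the three-term recurrence, enters in `sphereInt_mul_zonalPoly`. That `C_l^λ(x · y)` itself comes
from a harmonic polynomial is an induction along the recurrence (`gegenHom_mul_harmonic`).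

*Quadrature.* The weights `χ_u` are the discrete cosine transform of the moments of `sin ^ α`, so
that discrete orthogonality makes the rule in one angle exact (`quadWeight_exact`). In spherical
coordinates a monomial is a product of functions of single angles. If some exponent is odd, then
sum and integral vanish by symmetry; otherwise the one-dimensional integrals are Beta integrals,
whose product telescopes to the integral over the sphere (`sphereInt_eq_grid_sum`).

*Consequences.* The product of a function in `𝒲_j` and a wavelet of level `j` has degree less than
`2 ^ (j + 1)`, so that the reproducing integral is a sum over the grid. This is `sampling_formula`,
and the span and the frame identity follow from it. The localization property compares a function
with the normalized wavelet by `0 ≤ ‖f - g‖ ^ 2`. The weights are nonnegative for `n ≤ 3` because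
only the exponents `α = 1, 2` occur, for which the moments are explicit. Finally, the
hyperspherical harmonics are restrictions of harmonic polynomials, built up one coordinate at a time
by the same `gegenHom_mul_harmonic` (`exists_harmonicY`), so that the reproducing property gives the
Fourier coefficients of the wavelets.
-/

namespace SphereWavelets

/-! ### Gegenbauer polynomials -/

section Gegenbauer

open Filter Topology

theorem gegenbauer_base_eventually_pos (t : ℝ) : ∀ᶠ r in 𝓝 (0 : ℝ), 0 < 1 - 2 * t * r + r ^ 2 := by
  have h : ContinuousAt (fun r : ℝ => 1 - 2 * t * r + r ^ 2) 0 := by fun_prop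
  exact h.eventually_const_lt (by norm_num)

theorem gegenbauer_contDiffAt (a t : ℝ) (m : ℕ) :
    ContDiffAt ℝ m (fun r : ℝ => (1 - 2 * t * r + r ^ 2) ^ (-a)) 0 := by
  refine ContDiffAt.rpow_const_of_ne (by fun_prop) (by norm_num)

/-- Leibniz' rule for a quadratic factor. For `m = 0` the last term vanishes, whatever `m - 1` is. -/
theorem iteratedDeriv_quadratic_mul (b c d : ℝ) {g : ℝ → ℝ} (m : ℕ)
    (hg : ContDiffAt ℝ (m + 1 : ℕ) g 0) :
    iteratedDeriv (m + 1) (fun r => (b + c * r + d * r ^ 2) * g r) 0 =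
      b * iteratedDeriv (m + 1) g 0 + (m + 1) * c * iteratedDeriv m g 0 +
        (m + 1) * m * d * iteratedDeriv (m - 1) g 0 := by
  have h0 : deriv (fun r : ℝ => b + c * r + d * r ^ 2) = fun r => c + 2 * d * r := by
    funext r
    have : HasDerivAt (fun r : ℝ => b + c * r + d * r ^ 2) (0 + c * 1 + d * (2 * r ^ 1 * 1)) r := by
      exact_mod_cast (((hasDerivAt_const r b).add ((hasDerivAt_id r).const_mul c)).add
        (((hasDerivAt_id r).pow 2).const_mul d))
    rw [this.deriv]; ring
  have h1 : deriv (fun r : ℝ => c + 2 * d * r) = fun r => 2 * d := by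
    funext r
    have : HasDerivAt (fun r : ℝ => c + 2 * d * r) (0 + 2 * d * 1) r :=
      (hasDerivAt_const r c).add ((hasDerivAt_id r).const_mul (2 * d))
    rw [this.deriv]; ring
  have hk : ∀ k, iteratedDeriv (k + 3) (fun r : ℝ => b + c * r + d * r ^ 2) 0 = 0 := by
    intro k
    rw [iteratedDeriv_succ', iteratedDeriv_succ', iteratedDeriv_succ', h0, h1]
    simp
  have hmul := iteratedDeriv_mul (n := m + 1) (x := (0 : ℝ))
    (f := fun r : ℝ => b + c * r + d * r ^ 2) (g := g) (by fun_prop) hg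
  rw [show (fun r => (b + c * r + d * r ^ 2) * g r) =
    (fun r : ℝ => b + c * r + d * r ^ 2) * g from rfl, hmul]
  rw [Finset.sum_range_succ', Finset.sum_range_succ']
  rcases m with _ | m
  · rw [iteratedDeriv_succ', h0]
    simp
    ring
  · rw [Finset.sum_range_succ', Finset.sum_eq_zero (fun k _ => by rw [hk]; ring)]
    rw [iteratedDeriv_succ', iteratedDeriv_succ', iteratedDeriv_succ', h0, h1]
    have e1 : ((m + 2).choose 2 : ℝ) = (m + 2) * (m + 1) / 2 := by
      rw [Nat.cast_choose_two]; push_cast; ring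
    simp [e1]
    ring

theorem gegenbauer_zero (a t : ℝ) : gegenbauer a 0 t = 1 := by
  simp [gegenbauer]

/-- The differential equation of the generating function, both sides in the form
`(quadratic polynomial) * function`. -/
theorem gegenbauer_deriv_eventually (a t : ℝ) :
    (fun r : ℝ => (1 + (-2 * t) * r + 1 * r ^ 2) *
      deriv (fun r : ℝ => (1 - 2 * t * r + r ^ 2) ^ (-a)) r) =ᶠ[𝓝 0]
    fun r => (2 * a * t + (-2 * a) * r + 0 * r ^ 2) * (1 - 2 * t * r + r ^ 2) ^ (-a) := by
  filter_upwards [gegenbauer_base_eventually_pos t] with r hr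
  have hq : HasDerivAt (fun r : ℝ => 1 - 2 * t * r + r ^ 2) (0 - 2 * t * 1 + 2 * r ^ 1 * 1) r := by
    exact_mod_cast ((hasDerivAt_const r (1:ℝ)).sub ((hasDerivAt_id r).const_mul (2 * t))).add
        ((hasDerivAt_id r).pow 2)
  rw [(hq.rpow_const (p := -a) (Or.inl hr.ne')).deriv, Real.rpow_sub_one hr.ne']
  field_simp
  ring

theorem gegenbauer_one (a t : ℝ) : gegenbauer a 1 t = 2 * a * t := by
  have h := (gegenbauer_deriv_eventually a t).eq_of_nhds
  simp at h
  simp [gegenbauer, iteratedDeriv_one, h]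

/-- The three-term recurrence, read off from the differential equation
`(1 - 2 t r + r ^ 2) f' = 2 a (t - r) f` of the generating function. -/
theorem gegenbauer_succ_succ (a t : ℝ) (m : ℕ) :
    ((m : ℝ) + 2) * gegenbauer a (m + 2) t =
      2 * (m + 1 + a) * t * gegenbauer a (m + 1) t - (m + 2 * a) * gegenbauer a m t := by
  set f : ℝ → ℝ := fun r : ℝ => (1 - 2 * t * r + r ^ 2) ^ (-a) with hf
  have hfs : ∀ k : ℕ, ContDiffAt ℝ k f 0 := gegenbauer_contDiffAt a t
  have hfs' : ∀ k : ℕ, ContDiffAt ℝ k (deriv f) 0 := fun k => by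
    have := hfs (k + 1)
    push_cast at this
    exact ContDiffAt.derivWithin this le_rfl
  have key : iteratedDeriv (m + 2) f 0 = 2 * (m + 1 + a) * t * iteratedDeriv (m + 1) f 0 -
      (m + 1) * (m + 2 * a) * iteratedDeriv m f 0 := by
    have h := gegenbauer_deriv_eventually a t
    have h1 := h.iteratedDeriv_eq (m + 1)
    rw [iteratedDeriv_quadratic_mul _ _ _ _ (hfs' _),
      iteratedDeriv_quadratic_mul _ _ _ _ (hfs _)] at h1
    simp only [← iteratedDeriv_succ'] at h1
    rcases m with _ | m
    · push_cast at h1 ⊢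
      simp at h1 ⊢
      linarith
    · rw [Nat.add_sub_cancel] at h1
      push_cast at h1 ⊢
      linarith
  unfold gegenbauer
  rw [← hf, key, Nat.factorial_succ, Nat.factorial_succ]
  push_cast
  field_simp
  ring

end Gegenbauer


/-! ### The homogenized three-term recurrence -/

/-- The homogenized Gegenbauer polynomial `ρ^(m/2) C_m^a(x / √ρ)` as an element of any commutative
`ℂ`-algebra, given by the three-term recurrence. It is polynomial in `x` and `ρ`. -/
noncomputable def gegenHom {A : Type*} [CommRing A] [Algebra ℂ A] (a : ℝ) (x ρ : A) : ℕ → A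
  | 0 => 1
  | 1 => algebraMap ℂ A (2 * a) * x
  | m + 2 => algebraMap ℂ A (1 / ((m : ℂ) + 2)) *
      (algebraMap ℂ A (2 * (m + 1 + a)) * (x * gegenHom a x ρ (m + 1)) -
        algebraMap ℂ A (m + 2 * a) * (ρ * gegenHom a x ρ m))

section GegenHom

variable {A B : Type*} [CommRing A] [Algebra ℂ A] [CommRing B] [Algebra ℂ B]

theorem gegenHom_map (T : A →ₐ[ℂ] B) (a : ℝ) (x ρ : A) (m : ℕ) :
    T (gegenHom a x ρ m) = gegenHom a (T x) (T ρ) m := by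
  induction m using Nat.twoStepInduction with
  | zero => simp [gegenHom]
  | one => simp only [gegenHom, map_mul, AlgHom.commutes]
  | more m h1 h2 => simp only [gegenHom, map_mul, map_sub, AlgHom.commutes, h1, h2]

/-- At real arguments `gegenHom` is the homogenization of the Gegenbauer polynomial; no division by
`r` is involved, so that `r = 0` is allowed. -/
theorem gegenHom_ofReal (a r t : ℝ) (m : ℕ) :
    gegenHom a ((r * t : ℝ) : ℂ) ((r ^ 2 : ℝ) : ℂ) m = ((r ^ m * gegenbauer a m t : ℝ) : ℂ) := by
  induction m using Nat.twoStepInduction with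
  | zero => simp [gegenHom, gegenbauer_zero]
  | one => simp [gegenHom, gegenbauer_one]; ring
  | more m h1 h2 =>
    have h := gegenbauer_succ_succ a t m
    have hm : (m : ℝ) + 2 ≠ 0 := by positivity
    have h' : gegenbauer a (m + 2) t = (2 * (m + 1 + a) * t * gegenbauer a (m + 1) t -
        (m + 2 * a) * gegenbauer a m t) / (m + 2) := by
      rw [← h]; field_simp
    have hm' : (m : ℂ) + 2 ≠ 0 := by exact_mod_cast hm
    simp only [gegenHom, h1, h2, h', Algebra.algebraMap_self, RingHom.id_apply]
    push_cast
    field_simp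
    ring

theorem gegenHom_natDegree (a : ℝ) (m : ℕ) :
    (gegenHom a (Polynomial.X : Polynomial ℂ) 1 m).natDegree ≤ m := by
  induction m using Nat.twoStepInduction with
  | zero => simp [gegenHom]
  | one =>
    simp only [gegenHom, Polynomial.algebraMap_eq]
    compute_degree
  | more m h1 h2 =>
    simp only [gegenHom, Polynomial.algebraMap_eq]
    refine Polynomial.natDegree_C_mul_le _ _ |>.trans ?_
    refine (Polynomial.natDegree_sub_le _ _).trans (max_le ?_ ?_)
    · refine (Polynomial.natDegree_C_mul_le _ _).trans ?_
      refine Polynomial.natDegree_mul_le.trans ?_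
      rw [Polynomial.natDegree_X]; omega
    · refine (Polynomial.natDegree_C_mul_le _ _).trans ?_
      rw [one_mul]; omega

theorem gegenHom_coeff (a : ℝ) (m : ℕ) :
    (gegenHom a (Polynomial.X : Polynomial ℂ) 1 m).coeff m =
      ∏ i ∈ Finset.range m, 2 * ((a : ℂ) + i) / (i + 1) := by
  induction m using Nat.twoStepInduction with
  | zero => simp [gegenHom]
  | one => simp [gegenHom, Polynomial.algebraMap_eq]
  | more m h1 h2 =>
    have hd : (gegenHom a (Polynomial.X : Polynomial ℂ) 1 m).coeff (m + 2) = 0 :=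
      Polynomial.coeff_eq_zero_of_natDegree_lt (by have := gegenHom_natDegree a m; omega)
    simp only [gegenHom, Polynomial.algebraMap_eq, Polynomial.coeff_C_mul, Polynomial.coeff_sub,
      one_mul, hd, Polynomial.coeff_X_mul, h2]
    rw [Finset.prod_range_succ _ (m + 1)]
    push_cast
    ring

end GegenHom

theorem gegenbauer_at_one (k m : ℕ) :
    gegenbauer (((k : ℝ) + 1) / 2) m 1 = ((m + k)! : ℝ) / ((m ! : ℝ) * (k ! : ℝ)) := by
  induction m using Nat.twoStepInduction with
  | zero =>
    have := Nat.factorial_ne_zero k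
    simp [gegenbauer_zero]; field_simp
  | one =>
    rw [gegenbauer_one, add_comm 1 k, Nat.factorial_succ]
    have := Nat.factorial_ne_zero k
    simp; field_simp
  | more m h1 h2 =>
    have h := gegenbauer_succ_succ (((k : ℝ) + 1) / 2) 1 m
    rw [h1, h2] at h
    have hm : (m : ℝ) + 2 ≠ 0 := by positivity
    apply mul_left_cancel₀ hm
    rw [h, show m + 1 + k = (m + k) + 1 by ring, show m + 2 + k = (m + k) + 1 + 1 by ring,
      Nat.factorial_succ (m + k + 1), Nat.factorial_succ (m + k), Nat.factorial_succ (m + 1),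
      Nat.factorial_succ m]
    have h3 := Nat.factorial_ne_zero k
    have h4 := Nat.factorial_ne_zero m
    push_cast
    field_simp
    ring

/-- The sum of the dimensions `(l + λ) / λ * C_l^λ(1)` telescopes. -/
theorem sum_gegenbauer_at_one (k M : ℕ) :
    ∑ l ∈ Finset.range (M + 1), ((l : ℝ) + ((k : ℝ) + 1) / 2) / (((k : ℝ) + 1) / 2) *
      gegenbauer (((k : ℝ) + 1) / 2) l 1 =
    ((k : ℝ) + 2 * M + 2) * ((k + M + 1)! : ℝ) / (((k + 2)! : ℝ) * (M ! : ℝ)) := by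
  induction M with
  | zero =>
    have := Nat.factorial_ne_zero k
    simp [gegenbauer_zero, Nat.factorial_succ]
    field_simp
    ring
  | succ M ih =>
    rw [Finset.sum_range_succ, ih, gegenbauer_at_one, show M + 1 + k = (k + M) + 1 by ring,
      show k + (M + 1) + 1 = k + M + 1 + 1 by ring, Nat.factorial_succ (k + M + 1),
      Nat.factorial_succ (k + M), Nat.factorial_succ (k + 1), Nat.factorial_succ k,
      Nat.factorial_succ M]
    have h3 := Nat.factorial_ne_zero k
    have h4 := Nat.factorial_ne_zero M
    have h5 : (k : ℝ) + 1 ≠ 0 := by positivity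
    push_cast
    field_simp
    ring

/-! ### The Laplacian of homogenized Gegenbauer polynomials -/

section PolyCalculus

open MvPolynomial

variable {n : ℕ}

theorem polyLaplacian_apply (P : MvPolynomial (Fin (n + 1)) ℂ) :
    polyLaplacian n P = ∑ i, pderiv i (pderiv i P) := by
  simp [polyLaplacian]

/-- The pairing `∇P · ∇Q` of two polynomials. -/
noncomputable def gradDot (P Q : MvPolynomial (Fin (n + 1)) ℂ) : MvPolynomial (Fin (n + 1)) ℂ :=
  ∑ i, pderiv i P * pderiv i Q

theorem gradDot_comm (P Q : MvPolynomial (Fin (n + 1)) ℂ) : gradDot P Q = gradDot Q P := by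
  simp only [gradDot, mul_comm]

theorem gradDot_mul (P Q R : MvPolynomial (Fin (n + 1)) ℂ) :
    gradDot P (Q * R) = Q * gradDot P R + R * gradDot P Q := by
  simp only [gradDot, Derivation.leibniz, smul_eq_mul, Finset.mul_sum, ← Finset.sum_add_distrib]
  exact Finset.sum_congr rfl fun i _ => by ring

theorem gradDot_sub (P Q R : MvPolynomial (Fin (n + 1)) ℂ) :
    gradDot P (Q - R) = gradDot P Q - gradDot P R := by
  simp only [gradDot, map_sub, mul_sub, Finset.sum_sub_distrib]

theorem gradDot_C_mul (P Q : MvPolynomial (Fin (n + 1)) ℂ) (c : ℂ) :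
    gradDot P (C c * Q) = C c * gradDot P Q := by
  rw [gradDot_mul]; simp [gradDot]

theorem gradDot_one (P : MvPolynomial (Fin (n + 1)) ℂ) : gradDot P 1 = 0 := by
  simp [gradDot]

theorem polyLaplacian_mul (P Q : MvPolynomial (Fin (n + 1)) ℂ) :
    polyLaplacian n (P * Q) =
      polyLaplacian n P * Q + 2 * gradDot P Q + P * polyLaplacian n Q := by
  simp only [polyLaplacian_apply, gradDot, Derivation.leibniz, smul_eq_mul, map_add,
    Finset.mul_sum, Finset.sum_mul, ← Finset.sum_add_distrib]
  exact Finset.sum_congr rfl fun i _ => by ring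

theorem polyLaplacian_C_mul (c : ℂ) (Q : MvPolynomial (Fin (n + 1)) ℂ) :
    polyLaplacian n (C c * Q) = C c * polyLaplacian n Q := by
  rw [← smul_eq_C_mul, map_smul, smul_eq_C_mul]

theorem gegenHom_succ_succ (a : ℝ) (x ρ : MvPolynomial (Fin (n + 1)) ℂ) (m : ℕ) :
    C ((m : ℂ) + 2) * gegenHom a x ρ (m + 2) =
      C (2 * ((m : ℂ) + 1 + a)) * (x * gegenHom a x ρ (m + 1)) -
        C ((m : ℂ) + 2 * a) * (ρ * gegenHom a x ρ m) := by
  have h : (m : ℂ) + 2 ≠ 0 := by exact_mod_cast (by positivity : (m : ℝ) + 2 ≠ 0)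
  rw [gegenHom, MvPolynomial.algebraMap_eq, ← mul_assoc, ← C_mul, mul_one_div_cancel h, C_1,
    one_mul]

/-- In the direction of the axis a homogenized Gegenbauer polynomial has a multiple of its
predecessor as derivative. -/
theorem gradDot_gegenHom (a : ℝ) {x ρ : MvPolynomial (Fin (n + 1)) ℂ} (hx : gradDot x x = 1)
    (hρ : gradDot x ρ = 2 * x) (m : ℕ) :
    gradDot x (gegenHom a x ρ (m + 1)) = C (2 * (a : ℂ) + m) * gegenHom a x ρ m := by
  induction m using Nat.twoStepInduction with
  | zero =>
    rw [gegenHom, gegenHom, MvPolynomial.algebraMap_eq, gradDot_C_mul, hx]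
    simp
  | one =>
    have h2 := gegenHom_succ_succ a x ρ 0
    apply mul_left_cancel₀ (a := (C ((0 : ℕ) + 2 : ℂ) : MvPolynomial (Fin (n + 1)) ℂ)) (by simp)
    rw [← gradDot_C_mul, h2, gradDot_sub, gradDot_C_mul, gradDot_C_mul, gradDot_mul, gradDot_mul]
    simp only [gegenHom, MvPolynomial.algebraMap_eq, gradDot_C_mul, gradDot_one, hx, hρ]
    simp only [map_add, map_mul, map_ofNat, map_zero, map_one, Nat.cast_zero, Nat.cast_one]
    ring
  | more m h1 h2 =>
    have hm : ((m + 1 : ℕ) : ℂ) + 2 ≠ 0 := by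
      exact_mod_cast (by positivity : ((m + 1 : ℕ) : ℝ) + 2 ≠ 0)
    have e1 := gegenHom_succ_succ a x ρ (m + 1)
    have e0 := gegenHom_succ_succ a x ρ m
    apply mul_left_cancel₀ (a := (C (((m + 1 : ℕ) : ℂ) + 2) : MvPolynomial (Fin (n + 1)) ℂ))
      (by rwa [Ne, C_eq_zero])
    rw [← gradDot_C_mul, e1, gradDot_sub, gradDot_C_mul, gradDot_C_mul, gradDot_mul, gradDot_mul,
      h2, h1, hx, hρ]
    simp only [map_add, map_mul, map_ofNat, map_natCast, map_one, Nat.cast_add, Nat.cast_one,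
      Nat.cast_ofNat] at e0 ⊢
    -- What remains after both induction hypotheses is a multiple of the recurrence at `m`.
    linear_combination -((m : MvPolynomial (Fin (n + 1)) ℂ) + 1 + 2 * C (a : ℂ)) * e0

/-- If `x` is a linear form of unit length, `ρ` the sum of squares of `d` coordinates, and `h` a
harmonic polynomial of degree `κ` in these coordinates that is constant along `x`, then
`C_m^a(x) h`, homogenized by `ρ` with `a = d/2 - 1 + κ`, is harmonic. The assumptions are what
the proof needs of `x`, `ρ` and `h`. -/
theorem gegenHom_mul_harmonic (a : ℝ) (d κ : ℕ) (ha : a = (d : ℝ) / 2 - 1 + κ)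
    {x ρ h : MvPolynomial (Fin (n + 1)) ℂ} (hxΔ : polyLaplacian n x = 0)
    (hx : gradDot x x = 1) (hρ : gradDot x ρ = 2 * x) (hρΔ : polyLaplacian n ρ = C (2 * (d : ℂ)))
    (hh : gradDot x h = 0) (hhΔ : polyLaplacian n h = 0)
    (hE : ∀ m, gradDot ρ (gegenHom a x ρ m * h) = C (2 * ((m : ℂ) + κ)) * (gegenHom a x ρ m * h))
    (m : ℕ) : polyLaplacian n (gegenHom a x ρ m * h) = 0 := by
  induction m using Nat.twoStepInduction with
  | zero => simp [gegenHom, hhΔ]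
  | one =>
    rw [gegenHom, MvPolynomial.algebraMap_eq, mul_assoc, polyLaplacian_C_mul, polyLaplacian_mul,
      hxΔ, hh, hhΔ]
    simp
  | more m h1 h2 =>
    have hm : (m : ℂ) + 2 ≠ 0 := by exact_mod_cast (by positivity : (m : ℝ) + 2 ≠ 0)
    apply mul_left_cancel₀ (a := (C ((m : ℂ) + 2) : MvPolynomial (Fin (n + 1)) ℂ))
      (by rwa [Ne, C_eq_zero])
    -- Expand the Laplacian of the recurrence by the product rule. Only the cross terms
    -- `2 ∇x · ∇(C_{m+1} h)`, `2 ∇ρ · ∇(C_m h)` and `Δρ C_m h` remain; all are multiples of `C_m h`,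
    -- and they cancel for this value of `a`.
    rw [← polyLaplacian_C_mul, ← mul_assoc, gegenHom_succ_succ a x ρ m, sub_mul, map_sub,
      mul_assoc, polyLaplacian_C_mul, mul_assoc x, polyLaplacian_mul x, hxΔ, h2,
      gradDot_mul, hh, gradDot_gegenHom a hx hρ, mul_assoc (C ((m : ℂ) + 2 * a)),
      polyLaplacian_C_mul, mul_assoc ρ, polyLaplacian_mul ρ, h1, hE, hρΔ]
    have hac : (C (a : ℂ) : MvPolynomial (Fin (n + 1)) ℂ) = C ((d : ℂ) / 2) - 1 +
        (κ : MvPolynomial (Fin (n + 1)) ℂ) := by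
      rw [ha]; push_cast; simp
    have hd : (2 : MvPolynomial (Fin (n + 1)) ℂ) * C ((d : ℂ) / 2) =
        (d : MvPolynomial (Fin (n + 1)) ℂ) := by
      rw [show (2 : MvPolynomial (Fin (n + 1)) ℂ) = C 2 from (map_ofNat C 2).symm, ← C_mul]
      rw [mul_div_cancel₀ _ (two_ne_zero)]; simp
    simp only [map_add, map_mul, map_ofNat, map_natCast, map_one] at hd ⊢
    rw [hac]
    linear_combination (2 * ((m : MvPolynomial (Fin (n + 1)) ℂ) + 2 * (C ((d : ℂ) / 2) - 1 + κ)) *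
      gegenHom a x ρ m * h) * hd

end PolyCalculus

/-! ### Homogeneity and harmonicity of zonal polynomials -/

section PolyInstances

open MvPolynomial

variable {n : ℕ}

theorem gegenHom_isHomogeneous (a : ℝ) {x ρ : MvPolynomial (Fin (n + 1)) ℂ}
    (hx : x.IsHomogeneous 1) (hρ : ρ.IsHomogeneous 2) (m : ℕ) :
    (gegenHom a x ρ m).IsHomogeneous m := by
  induction m using Nat.twoStepInduction with
  | zero => exact isHomogeneous_one _ _
  | one =>
    have e := (isHomogeneous_C (Fin (n + 1)) (2 * a : ℂ)).mul hx
    rwa [zero_add] at e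
  | more m h1 h2 =>
    have e1 := (isHomogeneous_C (Fin (n + 1)) (2 * (m + 1 + a) : ℂ)).mul (hx.mul h2)
    have e2 := (isHomogeneous_C (Fin (n + 1)) (m + 2 * a : ℂ)).mul (hρ.mul h1)
    rw [show 0 + (1 + (m + 1)) = m + 2 by ring] at e1
    rw [show 0 + (2 + m) = m + 2 by ring] at e2
    have e3 := (isHomogeneous_C (Fin (n + 1)) (1 / (m + 2) : ℂ)).mul (e1.sub e2)
    rw [zero_add] at e3
    exact e3

theorem pderiv_gegenHom (a : ℝ) {x ρ : MvPolynomial (Fin (n + 1)) ℂ} {i : Fin (n + 1)}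
    (hx : pderiv i x = 0) (hρ : pderiv i ρ = 0) (m : ℕ) : pderiv i (gegenHom a x ρ m) = 0 := by
  induction m using Nat.twoStepInduction with
  | zero => simp [gegenHom]
  | one => simp only [gegenHom, MvPolynomial.algebraMap_eq, pderiv_C_mul, hx, mul_zero]
  | more m h1 h2 =>
    simp only [gegenHom, MvPolynomial.algebraMap_eq, pderiv_C, map_sub, pderiv_mul,
      h1, h2, hx, hρ, zero_mul, mul_zero, add_zero, sub_zero]

/-- The polynomial `∑_{i ≥ v} X_i ^ 2`. -/
noncomputable def tailSq (n v : ℕ) : MvPolynomial (Fin (n + 1)) ℂ :=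
  ∑ i, if v ≤ i.val then X i ^ 2 else 0

theorem tailSq_isHomogeneous (v : ℕ) : (tailSq n v).IsHomogeneous 2 := by
  refine IsHomogeneous.sum _ _ _ fun i _ => ?_
  split_ifs
  · exact isHomogeneous_X_pow i 2
  · exact isHomogeneous_zero _ _ _

theorem pderiv_tailSq (v : ℕ) (i : Fin (n + 1)) :
    pderiv i (tailSq n v) = if v ≤ i.val then 2 * X i else 0 := by
  unfold tailSq
  rw [map_sum, Finset.sum_eq_single i]
  · split_ifs
    · simp [Derivation.leibniz_pow]
    · simp
  · intro k _ hk
    split_ifs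
    · simp [Derivation.leibniz_pow, pderiv_X_of_ne hk]
    · simp
  · simp

theorem polyLaplacian_tailSq (v : ℕ) :
    polyLaplacian n (tailSq n v) = C (2 * ((n + 1 - v : ℕ) : ℂ)) := by
  have h : ∀ i : Fin (n + 1), pderiv i (pderiv i (tailSq n v)) =
      (fun k : ℕ => if v ≤ k then (2 : MvPolynomial (Fin (n + 1)) ℂ) else 0) i.val := by
    intro i
    rw [pderiv_tailSq]
    split_ifs with h
    · rw [show (2 : MvPolynomial (Fin (n + 1)) ℂ) = C 2 from (map_ofNat C 2).symm, pderiv_C_mul]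
      simp [h]
    · simp [h]
  rw [polyLaplacian_apply, Finset.sum_congr rfl fun i _ => h i, Fin.sum_univ_eq_sum_range
      (fun k : ℕ => if v ≤ k then (2 : MvPolynomial (Fin (n + 1)) ℂ) else 0),
    ← Finset.sum_filter, Finset.sum_const]
  have : (Finset.filter (fun k => v ≤ k) (Finset.range (n + 1))) = Finset.Ico v (n + 1) := by
    ext k; simp; omega
  rw [this, Nat.card_Ico, nsmul_eq_mul, mul_comm, C_mul, map_ofNat, map_natCast]

/-- Euler's identity for a homogeneous polynomial in the coordinates with index `≥ v`. -/
theorem gradDot_tailSq (v : ℕ) {P : MvPolynomial (Fin (n + 1)) ℂ} {m : ℕ}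
    (hP : P.IsHomogeneous m) (hv : ∀ i : Fin (n + 1), i.val < v → pderiv i P = 0) :
    gradDot (tailSq n v) P = C (2 * (m : ℂ)) * P := by
  have h := hP.sum_X_mul_pderiv
  have h2 : gradDot (tailSq n v) P = 2 * ∑ i, X i * pderiv i P := by
    unfold gradDot
    rw [Finset.mul_sum]
    refine Finset.sum_congr rfl fun i _ => ?_
    rw [pderiv_tailSq]
    split_ifs with hi
    · ring
    · rw [hv i (by omega)]; simp
  rw [h2, h, C_mul, map_ofNat, map_natCast, nsmul_eq_mul, mul_assoc]

/-- The linear form `x ↦ x · y`. -/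
noncomputable def linForm (y : EuclideanSpace ℝ (Fin (n + 1))) : MvPolynomial (Fin (n + 1)) ℂ :=
  ∑ i, C ((y i : ℝ) : ℂ) * X i

theorem linForm_isHomogeneous (y : EuclideanSpace ℝ (Fin (n + 1))) :
    (linForm y).IsHomogeneous 1 :=
  IsHomogeneous.sum _ _ _ fun i _ => by simpa using (isHomogeneous_C _ _).mul (isHomogeneous_X _ i)

theorem pderiv_linForm (y : EuclideanSpace ℝ (Fin (n + 1))) (i : Fin (n + 1)) :
    pderiv i (linForm y) = C ((y i : ℝ) : ℂ) := by
  unfold linForm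
  rw [map_sum, Finset.sum_eq_single i]
  · rw [pderiv_C_mul]; simp
  · intro k _ hk
    rw [pderiv_C_mul, pderiv_X_of_ne hk, mul_zero]
  · simp

theorem eval_linForm (x y : EuclideanSpace ℝ (Fin (n + 1))) :
    eval (fun i => ((x i : ℝ) : ℂ)) (linForm y) = ((inner ℝ x y : ℝ) : ℂ) := by
  simp [linForm, PiLp.inner_apply]

theorem sum_sq_sphere (y : Sph n) : ∑ i, (y.1 i) ^ 2 = 1 := by
  have h := y.2
  rw [mem_sphere_zero_iff_norm, EuclideanSpace.norm_eq, Real.sqrt_eq_one] at h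
  simpa using h

/-- The zonal harmonic polynomial with axis `y`, a solid version of `x ↦ C_l^λ(x · y)`. -/
noncomputable def zonalPoly (l : ℕ) (y : Sph n) : MvPolynomial (Fin (n + 1)) ℂ :=
  gegenHom (lam n) (linForm y.1) (tailSq n 0) l

theorem zonalPoly_isHomogeneous (l : ℕ) (y : Sph n) : (zonalPoly l y).IsHomogeneous l :=
  gegenHom_isHomogeneous _ (linForm_isHomogeneous _) (tailSq_isHomogeneous _) l

theorem zonalPoly_harmonic (l : ℕ) (y : Sph n) : polyLaplacian n (zonalPoly l y) = 0 := by
  have hy : gradDot (linForm y.1) (linForm y.1) = 1 := by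
    have h : (∑ i, ((y.1 i : ℝ) : ℂ) ^ 2) = 1 := by exact_mod_cast sum_sq_sphere y
    simp only [gradDot, pderiv_linForm]
    rw [← C_1, ← h, map_sum]
    exact Finset.sum_congr rfl fun i _ => by rw [pow_two, C_mul]
  have key := gegenHom_mul_harmonic (lam n) (n + 1) 0 (x := linForm y.1) (ρ := tailSq n 0) (h := 1)
    (by unfold lam; push_cast; ring)
    (by rw [polyLaplacian_apply]; simp [pderiv_linForm]) hy
    (by
      rw [gradDot_comm, gradDot_tailSq 0 (linForm_isHomogeneous y.1) (by simp), Nat.cast_one,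
        mul_one, map_ofNat])
    (by rw [polyLaplacian_tailSq 0]; simp) (gradDot_one _)
    (by rw [polyLaplacian_apply]; simp)
    (fun m => by
      rw [mul_one, gradDot_tailSq 0 (gegenHom_isHomogeneous _ (linForm_isHomogeneous _)
        (tailSq_isHomogeneous _) m) (by simp)]
      simp) l
  rwa [mul_one] at key

theorem eval_tailSq_sphere (x : Sph n) : eval (fun i => ((x.1 i : ℝ) : ℂ)) (tailSq n 0) = 1 := by
  have h : (∑ i, ((x.1 i : ℝ) : ℂ) ^ 2) = 1 := by exact_mod_cast sum_sq_sphere x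
  simpa [tailSq] using h

theorem eval_gegenHom (a : ℝ) (z : Fin (n + 1) → ℂ) (x ρ : MvPolynomial (Fin (n + 1)) ℂ) (m : ℕ) :
    eval z (gegenHom a x ρ m) = gegenHom a (eval z x) (eval z ρ) m := by
  have := gegenHom_map (aeval z : MvPolynomial (Fin (n + 1)) ℂ →ₐ[ℂ] ℂ) a x ρ m
  exact this

theorem eval_zonalPoly (l : ℕ) (x y : Sph n) :
    eval (fun i => ((x.1 i : ℝ) : ℂ)) (zonalPoly l y) =
      ((gegenbauer (lam n) l (inner ℝ x.1 y.1) : ℝ) : ℂ) := by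
  rw [zonalPoly, eval_gegenHom, eval_linForm, eval_tailSq_sphere]
  have := gegenHom_ofReal (lam n) 1 (inner ℝ x.1 y.1) l
  simpa using this

/-- A harmonic polynomial in the coordinates `> v`, times a suitable homogenized Gegenbauer
polynomial with axis the coordinate `v`, is a harmonic polynomial in the coordinates `≥ v`. -/
theorem harmonic_extend {v m κ : ℕ} (hv : v < n + 1) {h : MvPolynomial (Fin (n + 1)) ℂ}
    (hh : h.IsHomogeneous κ) (hΔ : polyLaplacian n h = 0)
    (hd : ∀ i : Fin (n + 1), i.val < v + 1 → pderiv i h = 0) :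
    (gegenHom (((n : ℝ) - ((v : ℝ) + 1)) / 2 + (κ : ℝ)) (X ⟨v, hv⟩) (tailSq n v) m *
        h).IsHomogeneous (m + κ) ∧
      polyLaplacian n (gegenHom (((n : ℝ) - ((v : ℝ) + 1)) / 2 + (κ : ℝ)) (X ⟨v, hv⟩)
        (tailSq n v) m * h) = 0 ∧
      ∀ i : Fin (n + 1), i.val < v → pderiv i (gegenHom (((n : ℝ) - ((v : ℝ) + 1)) / 2 + (κ : ℝ))
        (X ⟨v, hv⟩) (tailSq n v) m * h) = 0 := by
  have h1 : ∀ m, (gegenHom (((n : ℝ) - ((v : ℝ) + 1)) / 2 + (κ : ℝ)) (X ⟨v, hv⟩) (tailSq n v) m *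
        h).IsHomogeneous (m + κ) := fun m =>
    (gegenHom_isHomogeneous _ (isHomogeneous_X _ _) (tailSq_isHomogeneous _) m).mul hh
  have h3 : ∀ m, ∀ i : Fin (n + 1), i.val < v → pderiv i (gegenHom (((n : ℝ) - ((v : ℝ) + 1)) / 2 +
      (κ : ℝ)) (X ⟨v, hv⟩) (tailSq n v) m * h) = 0 := by
    intro m i hi
    have hx : pderiv i (X ⟨v, hv⟩ : MvPolynomial (Fin (n + 1)) ℂ) = 0 :=
      pderiv_X_of_ne (by rintro rfl; simp at hi)
    have hρ : pderiv i (tailSq n v) = 0 := by rw [pderiv_tailSq, if_neg (by omega)]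
    rw [Derivation.leibniz, pderiv_gegenHom _ hx hρ, hd i (by omega)]
    simp
  have hX : ∀ P : MvPolynomial (Fin (n + 1)) ℂ, gradDot (X ⟨v, hv⟩) P = pderiv ⟨v, hv⟩ P := by
    intro P
    unfold gradDot
    rw [Finset.sum_eq_single ⟨v, hv⟩]
    · simp
    · intro k _ hk
      rw [pderiv_X_of_ne (Ne.symm hk), zero_mul]
    · simp
  refine ⟨h1 m, ?_, h3 m⟩
  refine gegenHom_mul_harmonic _ (n + 1 - v) κ ?_ ?_ ?_ ?_ ?_ ?_ hΔ ?_ m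
  · rw [Nat.cast_sub (by omega)]; push_cast; ring
  · rw [polyLaplacian_apply]
    refine Finset.sum_eq_zero fun i _ => ?_
    by_cases hi : i = ⟨v, hv⟩
    · subst hi; simp
    · rw [pderiv_X_of_ne (Ne.symm hi)]; simp
  · rw [hX]; simp
  · rw [hX, pderiv_tailSq]; simp
  · exact polyLaplacian_tailSq v
  · rw [hX]; exact hd _ (by simp)
  · intro m
    rw [gradDot_tailSq v (h1 m) (h3 m)]
    push_cast
    rfl

end PolyInstances

/-! ### Integrals of monomials over the sphere -/

section SphereMonomials

/-- The moment `∫ x ^ a exp (-x ^ 2) dx` of the Gaussian weight on the line. -/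
noncomputable def gaussMoment (a : ℕ) : ℝ := if Even a then Real.Gamma (((a : ℝ) + 1) / 2) else 0

theorem integral_Ioi_pow_mul_exp (a : ℕ) :
    ∫ r in Set.Ioi (0 : ℝ), r ^ a * Real.exp (-r ^ 2) = Real.Gamma (((a : ℝ) + 1) / 2) / 2 := by
  have h := integral_rpow_mul_exp_neg_rpow (p := 2) (q := a) (by norm_num)
    (by have : (0 : ℝ) ≤ a := Nat.cast_nonneg a
        linarith)
  simp only [Real.rpow_natCast, Real.rpow_two] at h
  rw [h]; ring

theorem integral_pow_mul_exp (a : ℕ) :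
    ∫ x : ℝ, x ^ a * Real.exp (-x ^ 2) = gaussMoment a := by
  unfold gaussMoment
  split_ifs with ha
  · have h : ∀ x : ℝ, x ^ a * Real.exp (-x ^ 2) = |x| ^ a * Real.exp (-|x| ^ 2) := fun x => by
      rw [ha.pow_abs, sq_abs]
    rw [integral_congr_ae (Filter.Eventually.of_forall h)]
    rw [integral_comp_abs (f := fun r => r ^ a * Real.exp (-r ^ 2)), integral_Ioi_pow_mul_exp]
    ring
  · have h := integral_neg_eq_self (μ := (volume : Measure ℝ)) (fun x : ℝ => x ^ a * Real.exp (-x ^ 2))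
    have h2 : ∀ x : ℝ, (-x) ^ a * Real.exp (-(-x) ^ 2) = -(x ^ a * Real.exp (-x ^ 2)) := fun x => by
      rw [(Nat.not_even_iff_odd.1 ha).neg_pow, neg_sq]; ring
    simp_rw [h2] at h
    rw [integral_neg] at h
    linarith

variable {n : ℕ}

theorem integral_gauss_monomial (a : Fin (n + 1) → ℕ) :
    ∫ x : EuclideanSpace ℝ (Fin (n + 1)), (∏ i, x i ^ a i) * Real.exp (-‖x‖ ^ 2) =
      ∏ i, gaussMoment (a i) := by
  have h1 := (EuclideanSpace.volume_preserving_symm_measurableEquiv_toLp (Fin (n + 1))).integral_comp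
    (MeasurableEquiv.measurableEmbedding _)
    (fun z : Fin (n + 1) → ℝ => ∏ i, (z i ^ a i * Real.exp (-(z i) ^ 2)))
  rw [integral_fintype_prod_volume_eq_prod (fun i (x : ℝ) => x ^ a i * Real.exp (-x ^ 2))] at h1
  simp_rw [integral_pow_mul_exp] at h1
  rw [← h1]
  refine integral_congr_ae (Filter.Eventually.of_forall fun x => ?_)
  simp only
  rw [Finset.prod_mul_distrib, ← Real.exp_sum, EuclideanSpace.norm_sq_eq]
  simp [Finset.sum_neg_distrib]

/-- Polar coordinates for a homogeneous function times the Gaussian weight. -/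
theorem integral_gauss_polar (d : ℕ) (F : EuclideanSpace ℝ (Fin (n + 1)) → ℝ)
    (hF : ∀ (r : ℝ) x, F (r • x) = r ^ d * F x) :
    ∫ x, F x * Real.exp (-‖x‖ ^ 2) =
      (∫ s : Sph n, F s.1 ∂(sigma n)) * (Real.Gamma (((d + n : ℕ) + 1 : ℝ) / 2) / 2) := by
  let E := EuclideanSpace ℝ (Fin (n + 1))
  have hfin : Module.finrank ℝ E - 1 = n := by simp [E]
  calc ∫ x, F x * Real.exp (-‖x‖ ^ 2)
      = ∫ x : ({(0)}ᶜ : Set E), F x.1 * Real.exp (-‖x.1‖ ^ 2) ∂((volume : Measure E).comap (↑)) := by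
        rw [integral_subtype_comap (measurableSet_singleton _).compl
          fun x : E => F x * Real.exp (-‖x‖ ^ 2), restrict_compl_singleton]
    _ = ∫ p : Sph n × Set.Ioi (0 : ℝ), F p.1.1 * (p.2.1 ^ d * Real.exp (-p.2.1 ^ 2))
          ∂((volume : Measure E).toSphere.prod (.volumeIoiPow (Module.finrank ℝ E - 1))) := by
        rw [← ((volume : Measure E).measurePreserving_homeomorphUnitSphereProd).integral_comp
          (Homeomorph.measurableEmbedding _)]
        refine integral_congr_ae (Filter.Eventually.of_forall fun x => ?_)
        have hx : ‖x.1‖ ≠ 0 := norm_ne_zero_iff.2 x.2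
        simp only [homeomorphUnitSphereProd_apply_fst_coe, homeomorphUnitSphereProd_apply_snd_coe]
        rw [hF, inv_pow]
        field_simp
    _ = (∫ s : Sph n, F s.1 ∂(sigma n)) *
          ∫ r : Set.Ioi (0 : ℝ), (r.1 ^ d * Real.exp (-r.1 ^ 2)) ∂(.volumeIoiPow n) := by
        rw [hfin]
        exact integral_prod_mul (μ := (volume : Measure E).toSphere) (ν := .volumeIoiPow n)
          (fun s : Sph n => F s.1) (fun r : Set.Ioi (0 : ℝ) => r.1 ^ d * Real.exp (-r.1 ^ 2))
    _ = _ := by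
        -- the radial part is a Gaussian moment on the half-line
        congr 1
        simp only [Measure.volumeIoiPow, ENNReal.ofReal]
        rw [integral_withDensity_eq_integral_smul,
          integral_subtype_comap measurableSet_Ioi
            fun r : ℝ => Real.toNNReal (r ^ n) • (r ^ d * Real.exp (-r ^ 2)),
          ← integral_Ioi_pow_mul_exp]
        · refine setIntegral_congr_fun measurableSet_Ioi fun r hr => ?_
          rw [NNReal.smul_def, Real.coe_toNNReal _ (pow_nonneg hr.out.le _), pow_add, smul_eq_mul]
          ring
        · exact (measurable_subtype_coe.pow_const _).real_toNNReal

/-- The integral of a monomial over the sphere. -/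
theorem integral_sphere_monomial (a : Fin (n + 1) → ℕ) :
    (∫ s : Sph n, ∏ i, s.1 i ^ a i ∂(sigma n)) * Real.Gamma (((∑ i, a i + n : ℕ) + 1 : ℝ) / 2) =
      2 * ∏ i, gaussMoment (a i) := by
  have h := integral_gauss_polar (∑ i, a i)
    (fun x : EuclideanSpace ℝ (Fin (n + 1)) => ∏ i, x i ^ a i) (fun r x => by
      simp [mul_pow, Finset.prod_mul_distrib, Finset.prod_pow_eq_pow_sum])
  rw [integral_gauss_monomial] at h
  rw [h]; ring

end SphereMonomials

/-! ### Gaussian integration by parts for harmonic polynomials -/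

section Reproducing

open MvPolynomial

variable {n : ℕ}

theorem restrictToSphere_apply (P : MvPolynomial (Fin (n + 1)) ℂ) (x : Sph n) :
    restrictToSphere n P x = eval (fun i => ((x.1 i : ℝ) : ℂ)) P := rfl

theorem restrictToSphere_mul (P Q : MvPolynomial (Fin (n + 1)) ℂ) (x : Sph n) :
    restrictToSphere n (P * Q) x = restrictToSphere n P x * restrictToSphere n Q x := by
  simp [restrictToSphere_apply]

theorem continuous_restrictToSphere (P : MvPolynomial (Fin (n + 1)) ℂ) :
    Continuous (restrictToSphere n P) := by
  change Continuous fun x : Sph n => eval (fun i => ((x.1 i : ℝ) : ℂ)) P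
  exact (MvPolynomial.continuous_eval P).comp (by fun_prop)

instance : IsFiniteMeasure (sigma n) := by unfold sigma; infer_instance

theorem integrable_of_continuous {f : Sph n → ℂ} (hf : Continuous f) :
    Integrable f (sigma n) :=
  hf.integrable_of_hasCompactSupport (HasCompactSupport.of_compactSpace f)

/-- Integration of a polynomial over the sphere. -/
noncomputable def sphereInt (n : ℕ) : MvPolynomial (Fin (n + 1)) ℂ →ₗ[ℂ] ℂ where
  toFun P := ∫ x, restrictToSphere n P x ∂(sigma n)
  map_add' P Q := by
    simp only [map_add, Pi.add_apply]
    exact integral_add (integrable_of_continuous (continuous_restrictToSphere P))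
      (integrable_of_continuous (continuous_restrictToSphere Q))
  map_smul' c P := by
    simp only [map_smul, Pi.smul_apply, RingHom.id_apply]
    exact integral_smul c _

theorem sphereInt_apply (P : MvPolynomial (Fin (n + 1)) ℂ) :
    sphereInt n P = ∫ x, restrictToSphere n P x ∂(sigma n) := rfl

/-- The integral of a polynomial against the Gaussian weight `exp (-|x| ^ 2)`, given by its values
on monomials. -/
noncomputable def gaussInt (n : ℕ) : MvPolynomial (Fin (n + 1)) ℂ →ₗ[ℂ] ℂ :=
  (basisMonomials (Fin (n + 1)) ℂ).constr ℂ fun a => ((∏ i, gaussMoment (a i) : ℝ) : ℂ)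

theorem gaussInt_monomial (a : Fin (n + 1) →₀ ℕ) (c : ℂ) :
    gaussInt n (monomial a c) = c * ((∏ i, gaussMoment (a i) : ℝ) : ℂ) := by
  have h : (monomial a c : MvPolynomial (Fin (n + 1)) ℂ) =
      c • basisMonomials (Fin (n + 1)) ℂ a := by
    simp [smul_monomial]
  rw [h, map_smul, gaussInt, Module.Basis.constr_basis, smul_eq_mul]

theorem sphereInt_monomial (a : Fin (n + 1) →₀ ℕ) (c : ℂ) :
    sphereInt n (monomial a c) = c * ((∫ s : Sph n, ∏ i, s.1 i ^ a i ∂(sigma n) : ℝ) : ℂ) := by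
  rw [sphereInt_apply, ← integral_complex_ofReal, ← integral_const_mul]
  refine integral_congr_ae (Filter.Eventually.of_forall fun x => ?_)
  simp [restrictToSphere_apply, eval_monomial, Finsupp.prod_fintype]

theorem gamma_half_ne_zero (d : ℕ) : Real.Gamma (((d + n : ℕ) + 1 : ℝ) / 2) ≠ 0 :=
  (Real.Gamma_pos_of_pos (by positivity)).ne'

/-- On homogeneous polynomials the sphere integral and the Gaussian integral are proportional. -/
theorem sphereInt_eq_gaussInt {d : ℕ} {P : MvPolynomial (Fin (n + 1)) ℂ} (hP : P.IsHomogeneous d) :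
    sphereInt n P * (Real.Gamma (((d + n : ℕ) + 1 : ℝ) / 2) : ℂ) = 2 * gaussInt n P := by
  rw [P.as_sum, map_sum, map_sum, Finset.sum_mul, Finset.mul_sum]
  refine Finset.sum_congr rfl fun a ha => ?_
  have hd : ∑ i, a i = d := by
    have := hP (mem_support_iff.1 ha)
    rwa [show Finsupp.weight (1 : Fin (n + 1) → ℕ) a = Finsupp.degree a from
      (DFunLike.congr_fun Finsupp.degree_eq_weight_one a).symm, Finsupp.degree_eq_sum] at this
  have h := integral_sphere_monomial (n := n) a
  rw [hd] at h
  rw [sphereInt_monomial, gaussInt_monomial, mul_assoc, ← Complex.ofReal_mul, h]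
  push_cast
  ring

/-- The recursion of the moments. For `a = 0` the factor `a / 2` vanishes, whatever `a - 1` is. -/
theorem gaussMoment_succ (a : ℕ) : gaussMoment (a + 1) = (a : ℝ) / 2 * gaussMoment (a - 1) := by
  rcases a with _ | a
  · simp [gaussMoment]
  · have h : Even (a + 1 + 1) ↔ Even a := by simp [Nat.even_add_one]
    unfold gaussMoment
    simp only [Nat.add_sub_cancel, h]
    split_ifs
    · have h2 := Real.Gamma_add_one (s := ((a : ℝ) + 1) / 2) (by positivity)
      push_cast
      rw [← h2]
      congr 1
      ring
    · simp

/-- Integration by parts for the Gaussian weight. -/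
theorem gaussInt_X_mul (i : Fin (n + 1)) (P : MvPolynomial (Fin (n + 1)) ℂ) :
    gaussInt n (X i * P) = 1 / 2 * gaussInt n (pderiv i P) := by
  induction P using MvPolynomial.induction_on' with
  | add P Q hP hQ => rw [mul_add, map_add, map_add, map_add, hP, hQ, mul_add]
  | monomial a c =>
    rw [X, monomial_mul, pderiv_monomial, gaussInt_monomial, gaussInt_monomial,
      ← Finset.mul_prod_erase _ _ (Finset.mem_univ i), ← Finset.mul_prod_erase _ _ (Finset.mem_univ i)]
    have e : ∏ k ∈ Finset.univ.erase i, gaussMoment ((Finsupp.single i 1 + a : Fin (n + 1) →₀ ℕ) k) =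
        ∏ k ∈ Finset.univ.erase i, gaussMoment ((a - Finsupp.single i 1 : Fin (n + 1) →₀ ℕ) k) := by
      refine Finset.prod_congr rfl fun k hk => ?_
      have hk' : i ≠ k := (Finset.ne_of_mem_erase hk).symm
      simp [Finsupp.single_eq_of_ne', hk']
    rw [e]
    simp only [Finsupp.coe_add, Pi.add_apply, Finsupp.single_eq_same, Finsupp.coe_tsub, Pi.sub_apply,
      add_comm 1 (a i), gaussMoment_succ]
    push_cast
    ring

/-- Partial derivatives commute: their commutator is a derivation that kills the variables. -/
theorem pderiv_comm (i k : Fin (n + 1)) (P : MvPolynomial (Fin (n + 1)) ℂ) :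
    pderiv i (pderiv k P) = pderiv k (pderiv i P) := by
  let D : Fin (n + 1) → Derivation ℂ (MvPolynomial (Fin (n + 1)) ℂ) (MvPolynomial (Fin (n + 1)) ℂ) :=
    fun m => pderiv m
  have h : ⁅D i, D k⁆ = 0 := by
    refine MvPolynomial.derivation_ext fun m => ?_
    rw [Derivation.commutator_apply]
    simp only [D, pderiv_X, Pi.single_apply]
    split_ifs <;> simp
  have h2 := congrArg (fun D => D P) h
  simp only [D, Derivation.commutator_apply, Derivation.zero_apply] at h2
  exact sub_eq_zero.1 h2

theorem gradDot_linForm (y : EuclideanSpace ℝ (Fin (n + 1))) (P : MvPolynomial (Fin (n + 1)) ℂ) :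
    gradDot (linForm y) P = ∑ i, C ((y i : ℝ) : ℂ) * pderiv i P := by
  simp only [gradDot, pderiv_linForm]

theorem gradDot_linForm_isHomogeneous (y : EuclideanSpace ℝ (Fin (n + 1))) {l : ℕ}
    {P : MvPolynomial (Fin (n + 1)) ℂ} (hP : P.IsHomogeneous l) :
    (gradDot (linForm y) P).IsHomogeneous (l - 1) := by
  rw [gradDot_linForm]
  refine IsHomogeneous.sum _ _ _ fun i _ => ?_
  simpa using (isHomogeneous_C (Fin (n + 1)) ((y i : ℝ) : ℂ)).mul (hP.pderiv (i := i))

theorem gradDot_linForm_harmonic (y : EuclideanSpace ℝ (Fin (n + 1)))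
    {P : MvPolynomial (Fin (n + 1)) ℂ} (hP : polyLaplacian n P = 0) :
    polyLaplacian n (gradDot (linForm y) P) = 0 := by
  rw [polyLaplacian_apply] at hP
  simp only [gradDot_linForm, map_sum, polyLaplacian_C_mul]
  refine Finset.sum_eq_zero fun i _ => ?_
  have h : polyLaplacian n (pderiv i P) = pderiv i (∑ k, pderiv k (pderiv k P)) := by
    rw [polyLaplacian_apply, map_sum]
    refine Finset.sum_congr rfl fun k _ => ?_
    rw [pderiv_comm k i, pderiv_comm k i]
  rw [h, hP, map_zero, mul_zero]

theorem gaussInt_C_mul (c : ℂ) (P : MvPolynomial (Fin (n + 1)) ℂ) :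
    gaussInt n (C c * P) = c * gaussInt n P := by
  rw [← smul_eq_C_mul, map_smul, smul_eq_mul]

theorem gaussInt_linForm_mul (y : EuclideanSpace ℝ (Fin (n + 1)))
    (P : MvPolynomial (Fin (n + 1)) ℂ) :
    gaussInt n (linForm y * P) = 1 / 2 * gaussInt n (gradDot (linForm y) P) := by
  rw [gradDot_linForm, linForm, Finset.sum_mul, map_sum, map_sum, Finset.mul_sum]
  refine Finset.sum_congr rfl fun i _ => ?_
  rw [mul_assoc, gaussInt_C_mul, gaussInt_C_mul, gaussInt_X_mul]
  ring

/-- Green's identity for the Gaussian weight, with one factor homogeneous. -/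
theorem gaussInt_mul_harmonic {l : ℕ} {Q : MvPolynomial (Fin (n + 1)) ℂ} (hQ : Q.IsHomogeneous l)
    (hΔ : polyLaplacian n Q = 0) (P : MvPolynomial (Fin (n + 1)) ℂ) :
    (l : ℂ) * gaussInt n (Q * P) = 1 / 2 * gaussInt n (gradDot Q P) := by
  have h1 : C (l : ℂ) * (Q * P) = ∑ i, X i * (pderiv i Q * P) := by
    have := hQ.sum_X_mul_pderiv
    simp only [← mul_assoc, ← Finset.sum_mul]
    rw [this]; simp
  rw [← gaussInt_C_mul, h1, map_sum]
  simp only [gaussInt_X_mul]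
  rw [← Finset.mul_sum, ← map_sum]
  congr 2
  simp only [pderiv_mul]
  rw [Finset.sum_add_distrib, ← Finset.sum_mul, ← polyLaplacian_apply, hΔ, zero_mul, zero_add]
  rfl

/-- Orthogonality in different degrees: in Green's identity the roles of the two factors can be
exchanged. -/
theorem gaussInt_harmonic_orthogonal {l m : ℕ} (hlm : l ≠ m) {Q P : MvPolynomial (Fin (n + 1)) ℂ}
    (hQ : Q.IsHomogeneous l) (hQΔ : polyLaplacian n Q = 0) (hP : P.IsHomogeneous m)
    (hPΔ : polyLaplacian n P = 0) : gaussInt n (Q * P) = 0 := by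
  have h1 := gaussInt_mul_harmonic hQ hQΔ P
  have h2 := gaussInt_mul_harmonic hP hPΔ Q
  rw [gradDot_comm, mul_comm P Q, ← h1] at h2
  have h3 : (m : ℂ) - l ≠ 0 := sub_ne_zero.2 (by exact_mod_cast hlm.symm)
  have h4 : ((m : ℂ) - l) * gaussInt n (Q * P) = 0 := by linear_combination h2
  exact (mul_eq_zero.1 h4).resolve_left h3

theorem gradDot_linForm_pow (y : EuclideanSpace ℝ (Fin (n + 1))) (m : ℕ) :
    gradDot (linForm y) (linForm y ^ (m + 1)) =
      C ((m + 1 : ℂ) * ∑ i, ((y i : ℝ) : ℂ) ^ 2) * linForm y ^ m := by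
  rw [gradDot_linForm]
  simp only [pderiv_pow, pderiv_linForm]
  rw [C_mul, map_sum, mul_assoc, Finset.sum_mul, Finset.mul_sum]
  refine Finset.sum_congr rfl fun i _ => ?_
  simp
  ring

/-- Integration by parts in the direction of `y`. -/
theorem gaussInt_mul_linForm_pow_succ (y : EuclideanSpace ℝ (Fin (n + 1))) (m : ℕ)
    (Q : MvPolynomial (Fin (n + 1)) ℂ) :
    gaussInt n (Q * linForm y ^ (m + 2)) =
      1 / 2 * (gaussInt n (gradDot (linForm y) Q * linForm y ^ (m + 1)) +
        ((m + 1 : ℂ) * ∑ i, ((y i : ℝ) : ℂ) ^ 2) * gaussInt n (Q * linForm y ^ m)) := by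
  rw [show Q * linForm y ^ (m + 2) = linForm y * (Q * linForm y ^ (m + 1)) by ring,
    gaussInt_linForm_mul, gradDot_mul, gradDot_linForm_pow, map_add, ← gaussInt_C_mul]
  rw [show Q * (C ((m + 1 : ℂ) * ∑ i, ((y i : ℝ) : ℂ) ^ 2) * linForm y ^ m) =
    C ((m + 1 : ℂ) * ∑ i, ((y i : ℝ) : ℂ) ^ 2) * (Q * linForm y ^ m) by ring, add_comm,
    mul_comm (linForm y ^ (m + 1))]

theorem gaussInt_harmonic {l : ℕ} (hl : 0 < l) {Q : MvPolynomial (Fin (n + 1)) ℂ}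
    (hQ : Q.IsHomogeneous l) (hΔ : polyLaplacian n Q = 0) : gaussInt n Q = 0 := by
  have h := gaussInt_harmonic_orthogonal hl.ne' hQ hΔ (isHomogeneous_one (Fin (n + 1)) ℂ)
    (by rw [polyLaplacian_apply]; simp)
  rwa [mul_one] at h

theorem gaussInt_mul_linForm (y : EuclideanSpace ℝ (Fin (n + 1)))
    (Q : MvPolynomial (Fin (n + 1)) ℂ) :
    gaussInt n (Q * linForm y ^ 1) = 1 / 2 * gaussInt n (gradDot (linForm y) Q) := by
  rw [pow_one, mul_comm, gaussInt_linForm_mul]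

/-- A harmonic homogeneous polynomial of degree `l` is orthogonal to all lower powers of a linear
form. -/
theorem gaussInt_mul_linForm_pow_lt (y : EuclideanSpace ℝ (Fin (n + 1))) (m : ℕ) :
    ∀ {l : ℕ} (_ : m < l) {Q : MvPolynomial (Fin (n + 1)) ℂ} (_ : Q.IsHomogeneous l)
      (_ : polyLaplacian n Q = 0), gaussInt n (Q * linForm y ^ m) = 0 := by
  induction m using Nat.twoStepInduction with
  | zero =>
    intro l hl Q hQ hΔ
    rw [pow_zero, mul_one]
    exact gaussInt_harmonic hl hQ hΔ
  | one =>
    intro l hl Q hQ hΔ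
    rw [gaussInt_mul_linForm, gaussInt_harmonic (by omega) (gradDot_linForm_isHomogeneous y hQ)
      (gradDot_linForm_harmonic y hΔ), mul_zero]
  | more m h1 h2 =>
    intro l hl Q hQ hΔ
    rw [gaussInt_mul_linForm_pow_succ, h2 (by omega) (gradDot_linForm_isHomogeneous y hQ)
      (gradDot_linForm_harmonic y hΔ), h1 (by omega) hQ hΔ]
    ring

theorem eval_gradDot_linForm (y : EuclideanSpace ℝ (Fin (n + 1))) {l : ℕ}
    {Q : MvPolynomial (Fin (n + 1)) ℂ} (hQ : Q.IsHomogeneous l) :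
    eval (fun i => ((y i : ℝ) : ℂ)) (gradDot (linForm y) Q) =
      l * eval (fun i => ((y i : ℝ) : ℂ)) Q := by
  have h := congrArg (eval (fun i => ((y i : ℝ) : ℂ))) hQ.sum_X_mul_pderiv
  rw [gradDot_linForm]
  simpa using h

/-- Integration against the `l`-th power of a linear form evaluates a harmonic homogeneous
polynomial of degree `l`. -/
theorem gaussInt_mul_linForm_pow_self (y : EuclideanSpace ℝ (Fin (n + 1))) (l : ℕ) :
    ∀ {Q : MvPolynomial (Fin (n + 1)) ℂ} (_ : Q.IsHomogeneous l) (_ : polyLaplacian n Q = 0),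
      gaussInt n (Q * linForm y ^ l) =
        (l ! : ℂ) / 2 ^ l * eval (fun i => ((y i : ℝ) : ℂ)) Q * gaussInt n 1 := by
  induction l with
  | zero =>
    intro Q hQ _
    rw [← totalDegree_zero_iff_isHomogeneous, totalDegree_eq_zero_iff_eq_C] at hQ
    rw [hQ, gaussInt_C_mul]
    simp
  | succ l ih =>
    intro Q hQ hΔ
    have hQ' := gradDot_linForm_isHomogeneous y hQ
    rw [Nat.add_sub_cancel] at hQ'
    have h := ih hQ' (gradDot_linForm_harmonic y hΔ)
    rw [eval_gradDot_linForm y hQ] at h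
    have key : gaussInt n (Q * linForm y ^ (l + 1)) =
        1 / 2 * gaussInt n (gradDot (linForm y) Q * linForm y ^ l) := by
      rcases l with _ | l
      · rw [gaussInt_mul_linForm, pow_zero, mul_one]
      · rw [gaussInt_mul_linForm_pow_succ, gaussInt_mul_linForm_pow_lt y l (by omega) hQ hΔ]
        ring
    rw [key, h, Nat.factorial_succ]
    push_cast
    ring

end Reproducing

/-! ### Reproducing kernels of the spaces of spherical harmonics -/

section Kernel

open MvPolynomial

variable {n : ℕ}

theorem sphereArea_pos (n : ℕ) : 0 < sphereArea n := by
  have h : 0 < lam n + 1 := by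
    have : (0 : ℝ) ≤ n := Nat.cast_nonneg n
    unfold lam; linarith
  have := Real.Gamma_pos_of_pos h
  unfold sphereArea
  positivity

theorem lam_pos (hn : 2 ≤ n) : 0 < lam n := by
  have : (2 : ℝ) ≤ n := by exact_mod_cast hn
  unfold lam; linarith

theorem sphereInt_one : sphereInt n 1 = sphereArea n := by
  rw [sphereInt_apply, ← sigma_real_univ]
  simp [restrictToSphere_apply]

theorem sphereInt_congr {P Q : MvPolynomial (Fin (n + 1)) ℂ}
    (h : restrictToSphere n P = restrictToSphere n Q) : sphereInt n P = sphereInt n Q := by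
  rw [sphereInt_apply, sphereInt_apply, h]

theorem sphereInt_eq_zero_of_gaussInt {d : ℕ} {P : MvPolynomial (Fin (n + 1)) ℂ}
    (hP : P.IsHomogeneous d) (h : gaussInt n P = 0) : sphereInt n P = 0 := by
  have h1 := sphereInt_eq_gaussInt hP
  rw [h, mul_zero] at h1
  exact (mul_eq_zero.1 h1).resolve_right (by exact_mod_cast gamma_half_ne_zero d)

theorem sphereInt_harmonic_orthogonal {l m : ℕ} (hlm : l ≠ m)
    {Q P : MvPolynomial (Fin (n + 1)) ℂ}
    (hQ : Q.IsHomogeneous l) (hQΔ : polyLaplacian n Q = 0) (hP : P.IsHomogeneous m)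
    (hPΔ : polyLaplacian n P = 0) : sphereInt n (Q * P) = 0 :=
  sphereInt_eq_zero_of_gaussInt (hQ.mul hP) (gaussInt_harmonic_orthogonal hlm hQ hQΔ hP hPΔ)

theorem linForm_pow_isHomogeneous (y : EuclideanSpace ℝ (Fin (n + 1))) (m : ℕ) :
    (linForm y ^ m).IsHomogeneous m := by
  simpa using (linForm_isHomogeneous y).pow m

/-- The functional equation of the Gamma function, iterated. -/
theorem gamma_add_nat (s : ℝ) (hs : 0 < s) (l : ℕ) :
    Real.Gamma (s + l) = (∏ i ∈ Finset.range l, (s + i)) * Real.Gamma s := by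
  induction l with
  | zero => simp
  | succ l ih =>
    rw [Finset.prod_range_succ, Nat.cast_succ, ← add_assoc, Real.Gamma_add_one (by positivity), ih]
    ring

theorem prod_shift_ratio (a : ℝ) (l : ℕ) :
    (a + l) * ∏ i ∈ Finset.range l, (a + i) = a * ∏ i ∈ Finset.range l, (a + 1 + i) := by
  induction l with
  | zero => simp
  | succ l ih =>
    rw [Finset.prod_range_succ, Finset.prod_range_succ]
    push_cast
    linear_combination (a + 1 + l) * ih

/-- The evaluation property of the `l`-th power of a linear form, transferred from the Gaussian
weight to the sphere. -/
theorem sphereInt_mul_linForm_pow_self (y : Sph n) {l : ℕ} {Q : MvPolynomial (Fin (n + 1)) ℂ}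
    (hQ : Q.IsHomogeneous l) (hΔ : polyLaplacian n Q = 0) :
    sphereInt n (Q * linForm y.1 ^ l) *
      ((2 ^ l * ∏ i ∈ Finset.range l, (lam n + 1 + i) : ℝ) : ℂ) =
      (l ! : ℂ) * restrictToSphere n Q y * sphereArea n := by
  have h1 := sphereInt_eq_gaussInt (hQ.mul (linForm_pow_isHomogeneous y.1 l))
  have h0 := sphereInt_eq_gaussInt (n := n) (isHomogeneous_one (Fin (n + 1)) ℂ)
  rw [sphereInt_one] at h0
  rw [gaussInt_mul_linForm_pow_self y.1 l hQ hΔ] at h1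
  have hpos : 0 < lam n + 1 := by
    have : (0 : ℝ) ≤ n := Nat.cast_nonneg n
    unfold lam; linarith
  have e1 : (((l + l + n : ℕ) : ℝ) + 1) / 2 = lam n + 1 + l := by
    unfold lam; push_cast; ring
  have e0 : (((0 + n : ℕ) : ℝ) + 1) / 2 = lam n + 1 := by
    unfold lam; push_cast; ring
  rw [e1, gamma_add_nat _ hpos] at h1
  rw [e0] at h0
  have hG : (Real.Gamma (lam n + 1) : ℂ) ≠ 0 := by
    exact_mod_cast (Real.Gamma_pos_of_pos hpos).ne'
  apply mul_right_cancel₀ hG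
  have h2 : (2 : ℂ) ^ l ≠ 0 := pow_ne_zero _ two_ne_zero
  rw [restrictToSphere_apply]
  push_cast at h1 ⊢
  field_simp at h1
  linear_combination h1 - (l ! : ℂ) * eval (fun i => ((y.1 i : ℝ) : ℂ)) Q * h0

/-- On the sphere the zonal polynomial is a polynomial in the single linear form `x · y`, as
`|x| ^ 2 = 1` there. -/
theorem restrictToSphere_zonalPoly (l : ℕ) (y : Sph n) :
    restrictToSphere n (zonalPoly l y) = restrictToSphere n
      (Polynomial.aeval (linForm y.1) (gegenHom (lam n) (Polynomial.X : Polynomial ℂ) 1 l)) := by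
  funext x
  rw [restrictToSphere_apply, restrictToSphere_apply, gegenHom_map, Polynomial.aeval_X, map_one,
    zonalPoly, eval_gegenHom, eval_gegenHom, eval_tailSq_sphere, map_one]

/-- Up to normalization the Gegenbauer polynomial `C_l^λ(x · y)` is the reproducing kernel of the
spherical harmonics of degree `l`: these are orthogonal to all lower powers of `x · y`, so that only
the leading coefficient counts. -/
theorem sphereInt_mul_zonalPoly (hn : 2 ≤ n) (y : Sph n) {l : ℕ}
    {Q : MvPolynomial (Fin (n + 1)) ℂ} (hQ : Q.IsHomogeneous l) (hΔ : polyLaplacian n Q = 0) :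
    ((((l : ℝ) + lam n) / lam n : ℝ) : ℂ) * sphereInt n (Q * zonalPoly l y) =
      restrictToSphere n Q y * sphereArea n := by
  have h1 : sphereInt n (Q * zonalPoly l y) = sphereInt n (Q * Polynomial.aeval (linForm y.1)
      (gegenHom (lam n) (Polynomial.X : Polynomial ℂ) 1 l)) := by
    refine sphereInt_congr (funext fun x => ?_)
    rw [restrictToSphere_mul, restrictToSphere_mul, restrictToSphere_zonalPoly]
  have hlt : gegenHom (lam n) (Polynomial.X : Polynomial ℂ) 1 l =
      ∑ i ∈ Finset.range (l + 1), Polynomial.C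
        ((gegenHom (lam n) (Polynomial.X : Polynomial ℂ) 1 l).coeff i) * Polynomial.X ^ i :=
    Polynomial.as_sum_range_C_mul_X_pow' _ (Nat.lt_succ_of_le (gegenHom_natDegree _ _))
  rw [h1, hlt, map_sum, Finset.mul_sum, map_sum, Finset.sum_range_succ, Finset.sum_eq_zero]
  -- the leading term
  · have h2 := sphereInt_mul_linForm_pow_self y hQ hΔ
    have hpos := lam_pos hn
    have hl := prod_shift_ratio (lam n) l
    rw [gegenHom_coeff]
    simp only [map_mul, map_pow, Polynomial.aeval_X, Polynomial.aeval_C,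
      MvPolynomial.algebraMap_eq, zero_add]
    rw [show Q * (C (∏ i ∈ Finset.range l, 2 * ((lam n : ℂ) + i) / (i + 1)) * linForm y.1 ^ l) =
      (∏ i ∈ Finset.range l, 2 * ((lam n : ℂ) + i) / (i + 1)) • (Q * linForm y.1 ^ l) by
        rw [smul_eq_C_mul]; ring, map_smul, smul_eq_mul]
    have hfac : (∏ i ∈ Finset.range l, ((i : ℂ) + 1)) = l ! := by
      rw [← Finset.prod_range_add_one_eq_factorial]; push_cast; rfl
    rw [Finset.prod_div_distrib, hfac, Finset.prod_mul_distrib, Finset.prod_const,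
      Finset.card_range]
    have hlc : (((lam n : ℝ) : ℂ) + l) * ∏ i ∈ Finset.range l, (((lam n : ℝ) : ℂ) + i) =
        (lam n : ℂ) * ∏ i ∈ Finset.range l, ((lam n : ℂ) + 1 + i) := by exact_mod_cast hl
    have hl0 : (lam n : ℂ) ≠ 0 := by exact_mod_cast hpos.ne'
    have hf0 : (l ! : ℂ) ≠ 0 := by exact_mod_cast Nat.factorial_ne_zero l
    push_cast at h2 ⊢
    field_simp
    linear_combination (2 ^ l * sphereInt n (Q * linForm y.1 ^ l)) * hlc + (lam n : ℂ) * h2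
  -- the lower powers of `x · y`
  · intro i hi
    have hi' := Finset.mem_range.1 hi
    rw [map_mul (Polynomial.aeval (linForm y.1)), map_pow, Polynomial.aeval_X, Polynomial.aeval_C,
      MvPolynomial.algebraMap_eq,
      show ∀ c : ℂ, Q * (C c * linForm y.1 ^ i) = c • (Q * linForm y.1 ^ i) from fun c => by
        rw [smul_eq_C_mul]; ring, map_smul,
      sphereInt_eq_zero_of_gaussInt (hQ.mul (linForm_pow_isHomogeneous y.1 i))
        (gaussInt_mul_linForm_pow_lt y.1 i hi' hQ hΔ), smul_zero]

/-- The polynomial `∑_{l ∈ s} (l + λ) / λ C_l^λ(x · y)` in `x`. -/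
noncomputable def kernelPoly (s : Finset ℕ) (y : Sph n) : MvPolynomial (Fin (n + 1)) ℂ :=
  ∑ l ∈ s, ((((l : ℝ) + lam n) / lam n : ℝ) : ℂ) • zonalPoly l y

theorem restrictToSphere_kernelPoly (s : Finset ℕ) (y x : Sph n) :
    restrictToSphere n (kernelPoly s y) x = ((∑ l ∈ s, ((l : ℝ) + lam n) / lam n *
      gegenbauer (lam n) l (inner ℝ x.1 y.1) : ℝ) : ℂ) := by
  have h : ∀ l, restrictToSphere n (zonalPoly l y) x =
      ((gegenbauer (lam n) l (inner ℝ x.1 y.1) : ℝ) : ℂ) := fun l => eval_zonalPoly l x y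
  rw [kernelPoly, map_sum, Finset.sum_apply]
  push_cast
  refine Finset.sum_congr rfl fun l _ => ?_
  rw [map_smul, Pi.smul_apply, h, smul_eq_mul]

/-- The harmonic homogeneous polynomials of degree `l`. -/
noncomputable def harmonicPoly (n l : ℕ) : Submodule ℂ (MvPolynomial (Fin (n + 1)) ℂ) :=
  homogeneousSubmodule (Fin (n + 1)) ℂ l ⊓ LinearMap.ker (polyLaplacian n)

theorem mem_harmonicPoly {l : ℕ} {P : MvPolynomial (Fin (n + 1)) ℂ} :
    P ∈ harmonicPoly n l ↔ P.IsHomogeneous l ∧ polyLaplacian n P = 0 := by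
  simp [harmonicPoly]

theorem sphereInt_mul_kernelPoly (hn : 2 ≤ n) (s : Finset ℕ) (y : Sph n) {m : ℕ}
    {Q : MvPolynomial (Fin (n + 1)) ℂ} (hQ : Q ∈ harmonicPoly n m) :
    sphereInt n (Q * kernelPoly s y) =
      if m ∈ s then restrictToSphere n Q y * sphereArea n else 0 := by
  obtain ⟨h1, h2⟩ := mem_harmonicPoly.1 hQ
  rw [kernelPoly, Finset.mul_sum, map_sum, ← Finset.sum_ite_eq s m
    (fun _ => restrictToSphere n Q y * sphereArea n)]
  refine Finset.sum_congr rfl fun l _ => ?_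
  rw [mul_smul_comm, map_smul, smul_eq_mul]
  split_ifs with h
  · subst h
    exact sphereInt_mul_zonalPoly hn y h1 h2
  · rw [sphereInt_harmonic_orthogonal h h1 h2 (zonalPoly_isHomogeneous l y) (zonalPoly_harmonic l y),
      mul_zero]

/-- The sum of the spaces of harmonic homogeneous polynomials with degrees in `s`. -/
noncomputable def harmonicSum (n : ℕ) (s : Finset ℕ) :
    Submodule ℂ (MvPolynomial (Fin (n + 1)) ℂ) :=
  ⨆ l ∈ s, harmonicPoly n l

theorem kernelPoly_mem (s : Finset ℕ) (y : Sph n) : kernelPoly s y ∈ harmonicSum n s := by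
  refine Submodule.sum_mem _ fun l hl => Submodule.smul_mem _ _ ?_
  exact (le_iSup₂_of_le l hl le_rfl : harmonicPoly n l ≤ harmonicSum n s)
    (mem_harmonicPoly.2 ⟨zonalPoly_isHomogeneous l y, zonalPoly_harmonic l y⟩)

/-- `kernelPoly s y` reproduces values at `y`. -/
theorem sphereInt_mul_kernelPoly_of_mem (hn : 2 ≤ n) {s t : Finset ℕ} (hst : s ⊆ t) (y : Sph n)
    {Q : MvPolynomial (Fin (n + 1)) ℂ} (hQ : Q ∈ harmonicSum n s) :
    sphereInt n (Q * kernelPoly t y) = restrictToSphere n Q y * sphereArea n := by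
  have key : harmonicSum n s ≤ LinearMap.eqLocus
      (sphereInt n ∘ₗ LinearMap.mulRight ℂ (kernelPoly t y))
      ((sphereArea n : ℂ) • (LinearMap.proj y ∘ₗ restrictToSphere n)) := by
    refine iSup₂_le fun l hl Q hQ => ?_
    have := sphereInt_mul_kernelPoly hn t y hQ
    rw [if_pos (hst hl)] at this
    simpa [mul_comm] using this
  simpa [mul_comm] using key hQ

theorem sphereInt_mul_kernelPoly_of_disjoint (hn : 2 ≤ n) {s t : Finset ℕ} (hst : Disjoint s t)
    (y : Sph n) {Q : MvPolynomial (Fin (n + 1)) ℂ} (hQ : Q ∈ harmonicSum n s) :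
    sphereInt n (Q * kernelPoly t y) = 0 := by
  have key : harmonicSum n s ≤ LinearMap.ker
      (sphereInt n ∘ₗ LinearMap.mulRight ℂ (kernelPoly t y)) := by
    refine iSup₂_le fun l hl Q hQ => ?_
    have := sphereInt_mul_kernelPoly hn t y hQ
    rw [if_neg (Finset.disjoint_left.1 hst hl)] at this
    simpa using this
  simpa using key hQ

theorem waveletSpace_eq_map (n j : ℕ) : waveletSpace n j =
    (harmonicSum n (Finset.Ico (2 ^ (j - 1)) (2 ^ j))).map (restrictToSphere n) := by
  simp only [waveletSpace, harmonicSum, Submodule.map_iSup]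
  rfl

theorem harmonicSum_totalDegree {s : Finset ℕ} {d : ℕ} (hs : ∀ l ∈ s, l ≤ d)
    {Q : MvPolynomial (Fin (n + 1)) ℂ} (hQ : Q ∈ harmonicSum n s) : Q.totalDegree ≤ d := by
  have key : harmonicSum n s ≤ restrictTotalDegree (Fin (n + 1)) ℂ d := by
    refine iSup₂_le fun l hl Q hQ => ?_
    rw [mem_restrictTotalDegree]
    exact (mem_harmonicPoly.1 hQ).1.totalDegree_le.trans (hs l hl)
  exact (mem_restrictTotalDegree _ _ _).1 (key hQ)

end Kernel

/-! ### Trigonometric integrals -/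

section TrigIntegrals

open Real intervalIntegral

/-- A recursion in the frequency, by integrating the derivative of
`sin θ ^ (α + 1) cos ((2 κ + 1) θ)`. -/
theorem integral_sin_pow_mul_cos_step (α κ : ℕ) :
    ((α : ℝ) / 2 + κ + 1) * ∫ θ in 0..π, sin θ ^ α * cos (2 * ((κ + 1 : ℕ) : ℝ) * θ) =
      -((α : ℝ) / 2 - κ) * ∫ θ in 0..π, sin θ ^ α * cos (2 * (κ : ℝ) * θ) := by
  have hd : ∀ θ ∈ Set.uIcc 0 π, HasDerivAt (fun θ => sin θ ^ (α + 1) * cos ((2 * κ + 1) * θ))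
      (((α : ℝ) / 2 + κ + 1) * (sin θ ^ α * cos (2 * ((κ + 1 : ℕ) : ℝ) * θ)) +
        ((α : ℝ) / 2 - κ) * (sin θ ^ α * cos (2 * (κ : ℝ) * θ))) θ := by
    intro θ _
    have h1 := (hasDerivAt_sin θ).pow (α + 1)
    have h2 := (((hasDerivAt_id θ).const_mul (2 * κ + 1 : ℝ))).cos
    refine (h1.mul h2).congr_deriv ?_
    have e1 : (2 * ((κ + 1 : ℕ) : ℝ) * θ) = (2 * κ + 1) * θ + θ := by push_cast; ring
    have e2 : (2 * (κ : ℝ) * θ) = (2 * κ + 1) * θ - θ := by ring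
    rw [e1, e2, cos_add, cos_sub]
    simp only [id, Nat.add_sub_cancel, Pi.pow_apply]
    push_cast
    ring
  have h := integral_eq_sub_of_hasDerivAt hd (Continuous.intervalIntegrable (by fun_prop) _ _)
  rw [intervalIntegral.integral_add (Continuous.intervalIntegrable (by fun_prop) _ _)
    (Continuous.intervalIntegrable (by fun_prop) _ _), intervalIntegral.integral_const_mul,
    intervalIntegral.integral_const_mul] at h
  simp at h
  push_cast
  linarith

/-- The closed form of the cosine moments of the weight `sin ^ α`. The factor with a pole of the
Gamma function vanishes, since `Real.Gamma` is `0` there. -/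
noncomputable def cosMoment (α κ : ℕ) : ℝ :=
  π * α ! * (-1) ^ κ / (2 ^ α * (Gamma ((α : ℝ) / 2 - κ + 1) * Gamma ((α : ℝ) / 2 + κ + 1)))

theorem cosMoment_succ (α κ : ℕ) :
    ((α : ℝ) / 2 + κ + 1) * cosMoment α (κ + 1) = -((α : ℝ) / 2 - κ) * cosMoment α κ := by
  unfold cosMoment
  have h0 : (α : ℝ) / 2 + κ + 1 ≠ 0 := by positivity
  have h1 : Gamma ((α : ℝ) / 2 + (κ + 1 : ℕ) + 1) =
      ((α : ℝ) / 2 + κ + 1) * Gamma ((α : ℝ) / 2 + κ + 1) := by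
    rw [← Gamma_add_one h0]; push_cast; ring_nf
  have e : (α : ℝ) / 2 - (κ + 1 : ℕ) + 1 = (α : ℝ) / 2 - κ := by push_cast; ring
  rw [h1, e]
  have h2 : Gamma ((α : ℝ) / 2 + κ + 1) ≠ 0 := (Gamma_pos_of_pos (by positivity)).ne'
  -- At a pole of a Gamma factor both sides are `0`.
  by_cases hz : (α : ℝ) / 2 - κ = 0
  · rw [hz, Gamma_zero]; simp
  · rw [Gamma_add_one hz]
    by_cases hG : Gamma ((α : ℝ) / 2 - κ) = 0
    · simp [hG]
    · generalize (α : ℝ) / 2 - κ = s at *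
      field_simp
      ring

theorem integral_sin_pow_closed (α : ℕ) : ∫ θ in 0..π, sin θ ^ α = cosMoment α 0 := by
  induction α using Nat.twoStepInduction with
  | zero => simp [cosMoment]
  | one =>
    have h : Gamma (1 / 2 + 1) = √π / 2 := by
      rw [Gamma_add_one (by norm_num), Gamma_one_half_eq]; ring
    have hp : √π * √π = π := mul_self_sqrt pi_pos.le
    have hp0 : √π ≠ 0 := (sqrt_pos.2 pi_pos).ne'
    simp only [pow_one, integral_sin, cos_zero, cos_pi, cosMoment]
    norm_num
    norm_num at h
    rw [h]
    field_simp
    nlinarith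
  | more α h1 _ =>
    rw [integral_sin_pow, h1]
    unfold cosMoment
    have hα : (α : ℝ) / 2 + 1 ≠ 0 := by positivity
    have h2 : Gamma ((α : ℝ) / 2 + 1) ≠ 0 := (Gamma_pos_of_pos (by positivity)).ne'
    have e : ((α + 2 : ℕ) : ℝ) / 2 = (α : ℝ) / 2 + 1 := by push_cast; ring
    have hα2 : (α : ℝ) + 2 ≠ 0 := by positivity
    simp only [e, Nat.cast_zero, sub_zero, add_zero, Gamma_add_one hα, sin_zero, sin_pi]
    rw [Nat.factorial_succ, Nat.factorial_succ]
    push_cast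
    have e3 : (α : ℝ) / 2 + 1 = (α + 2) / 2 := by ring
    simp only [e3] at *
    simp
    field_simp
    ring

theorem integral_sin_pow_mul_cos (α κ : ℕ) :
    ∫ θ in 0..π, sin θ ^ α * cos (2 * (κ : ℝ) * θ) = cosMoment α κ := by
  induction κ with
  | zero => simpa using integral_sin_pow_closed α
  | succ κ ih =>
    have h := integral_sin_pow_mul_cos_step α κ
    rw [ih, ← cosMoment_succ] at h
    exact mul_left_cancel₀ (by positivity) h

/-- A recursion for the Beta integral, by integrating the derivative of
`cos θ ^ (p + 1) sin θ ^ (q + 1)`. -/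
theorem integral_cos_sin_pow_step (p q : ℕ) :
    ((p : ℝ) + q + 2) * ∫ θ in 0..π, cos θ ^ (p + 2) * sin θ ^ q =
      ((p : ℝ) + 1) * ∫ θ in 0..π, cos θ ^ p * sin θ ^ q := by
  have hd : ∀ θ ∈ Set.uIcc 0 π, HasDerivAt (fun θ => cos θ ^ (p + 1) * sin θ ^ (q + 1))
      (((p : ℝ) + q + 2) * (cos θ ^ (p + 2) * sin θ ^ q) -
        ((p : ℝ) + 1) * (cos θ ^ p * sin θ ^ q)) θ := by
    intro θ _
    refine (((hasDerivAt_cos θ).pow (p + 1)).mul ((hasDerivAt_sin θ).pow (q + 1))).congr_deriv ?_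
    have hs := sin_sq_add_cos_sq θ
    simp only [Nat.add_sub_cancel, Pi.pow_apply]
    push_cast
    linear_combination (-((p : ℝ) + 1) * cos θ ^ p * sin θ ^ q) * hs
  have h := integral_eq_sub_of_hasDerivAt hd (Continuous.intervalIntegrable (by fun_prop) _ _)
  rw [intervalIntegral.integral_sub (Continuous.intervalIntegrable (by fun_prop) _ _)
    (Continuous.intervalIntegrable (by fun_prop) _ _), intervalIntegral.integral_const_mul,
    intervalIntegral.integral_const_mul] at h
  simp at h
  linarith

theorem integral_sin_pow_gamma (q : ℕ) :
    (∫ θ in 0..π, sin θ ^ q) * Gamma (((q + 1 : ℕ) + 1 : ℝ) / 2) =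
      √π * Gamma (((q : ℝ) + 1) / 2) := by
  induction q using Nat.twoStepInduction with
  | zero =>
    have h : Gamma 2⁻¹ = √π := by rw [← one_div, Gamma_one_half_eq]
    simp [h, mul_self_sqrt pi_pos.le]
  | one =>
    have h : Gamma (1 / 2 + 1) = √π / 2 := by
      rw [Gamma_add_one (by norm_num), Gamma_one_half_eq]; ring
    norm_num at h
    simp only [pow_one, integral_sin, cos_zero, cos_pi]
    norm_num
    rw [h]; ring
  | more q h1 _ =>
    rw [integral_sin_pow]
    have e1 : (((q + 2 + 1 : ℕ) : ℝ) + 1) / 2 = (((q + 1 : ℕ) : ℝ) + 1) / 2 + 1 := by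
      push_cast; ring
    have e2 : (((q + 2 : ℕ) : ℝ) + 1) / 2 = ((q : ℝ) + 1) / 2 + 1 := by push_cast; ring
    rw [e1, e2, Gamma_add_one (by positivity), Gamma_add_one (by positivity)]
    have hq : (q : ℝ) + 2 ≠ 0 := by positivity
    push_cast at h1 ⊢
    simp only [sin_zero, sin_pi]
    simp
    field_simp
    linear_combination ((q : ℝ) + 2) * h1

/-- The Beta integral in trigonometric form. -/
theorem integral_cos_sin_pow {p : ℕ} (hp : Even p) (q : ℕ) :
    (∫ θ in 0..π, cos θ ^ p * sin θ ^ q) * Gamma (((p + q + 1 : ℕ) + 1 : ℝ) / 2) =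
      Gamma (((p : ℝ) + 1) / 2) * Gamma (((q : ℝ) + 1) / 2) := by
  obtain ⟨m, rfl⟩ := hp.exists_two_nsmul
  rw [smul_eq_mul]
  induction m with
  | zero =>
    have := integral_sin_pow_gamma q
    have h : Gamma 2⁻¹ = √π := by rw [← one_div, Gamma_one_half_eq]
    simpa [h] using this
  | succ m ih =>
    have h := integral_cos_sin_pow_step (2 * m) q
    have ih' := ih (even_two_mul m)
    have e1 : (((2 * (m + 1) + q + 1 : ℕ) : ℝ) + 1) / 2 =
        (((2 * m + q + 1 : ℕ) : ℝ) + 1) / 2 + 1 := by push_cast; ring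
    have e2 : (((2 * (m + 1) : ℕ) : ℝ) + 1) / 2 = (((2 * m : ℕ) : ℝ) + 1) / 2 + 1 := by
      push_cast; ring
    rw [e1, e2, Gamma_add_one (by positivity), Gamma_add_one (by positivity)]
    rw [show 2 * (m + 1) = 2 * m + 2 by ring]
    set G := Gamma ((((2 * m + q + 1 : ℕ) : ℝ) + 1) / 2)
    push_cast at h ih' ⊢
    linear_combination (G / 2) * h + (2 * (m : ℝ) + 1) / 2 * ih'

end TrigIntegrals

/-! ### Quadrature in one angle -/

section Quadrature

open Real intervalIntegral

theorem sum_range_cos_eq_ite (M : ℕ) (hM : 0 < M) (k : ℤ) :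
    ∑ u ∈ Finset.range M, cos (2 * (k : ℝ) * ((u : ℝ) * π / M)) = if (M : ℤ) ∣ k then (M : ℝ) else 0 := by
  have hM' : (M : ℂ) ≠ 0 := by exact_mod_cast hM.ne'
  set ζ : ℂ := Complex.exp (2 * π * Complex.I * (k / M)) with hζ
  have h1 : ∀ u : ℕ, cos (2 * (k : ℝ) * ((u : ℝ) * π / M)) = (ζ ^ u).re := by
    intro u
    rw [hζ, ← Complex.exp_nat_mul, show (u : ℂ) * (2 * π * Complex.I * (k / M)) =
      ((2 * (k : ℝ) * ((u : ℝ) * π / M) : ℝ) : ℂ) * Complex.I by push_cast; ring,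
      Complex.exp_ofReal_mul_I_re]
  have hζM : ζ ^ M = 1 := by
    rw [hζ, ← Complex.exp_nat_mul, Complex.exp_eq_one_iff]
    exact ⟨k, by field_simp⟩
  simp_rw [h1]
  rw [← Complex.re_sum]
  split_ifs with h
  · obtain ⟨d, rfl⟩ := h
    have : ζ = 1 := by
      rw [hζ, Complex.exp_eq_one_iff]
      exact ⟨d, by push_cast; field_simp⟩
    simp [this]
  · have hne : ζ ≠ 1 := by
      intro h1
      rw [hζ, Complex.exp_eq_one_iff] at h1
      obtain ⟨d, hd⟩ := h1
      apply h
      refine ⟨d, ?_⟩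
      have hI : (2 * (π : ℂ) * Complex.I) ≠ 0 := Complex.two_pi_I_ne_zero
      rw [mul_comm (d : ℂ)] at hd
      have h2 := mul_left_cancel₀ hI hd
      rw [div_eq_iff hM'] at h2
      have h3 : k = d * M := by exact_mod_cast h2
      rw [h3, mul_comm]
    rw [geom_sum_eq hne, hζM]
    simp

/-- The trapezoidal sum of a function with equal values at the end points. -/
theorem sum_quadEps (M : ℕ) (hM : 0 < M) (g : ℕ → ℝ) (hg : g M = g 0) :
    ∑ u ∈ Finset.range (M + 1), quadEps M u * g u = ∑ u ∈ Finset.range M, g u := by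
  obtain ⟨m, rfl⟩ : ∃ m, M = m + 1 := ⟨M - 1, by omega⟩
  rw [Finset.sum_range_succ, Finset.sum_range_succ', Finset.sum_range_succ', hg]
  have : ∀ u ∈ Finset.range m, quadEps (m + 1) (u + 1) * g (u + 1) = g (u + 1) := by
    intro u hu
    have := Finset.mem_range.1 hu
    rw [quadEps, if_neg (by omega), one_mul]
  rw [Finset.sum_congr rfl this]
  simp [quadEps]
  ring

theorem sum_quadEps_cos (M : ℕ) (hM : 0 < M) (k : ℤ) :
    ∑ u ∈ Finset.range (M + 1), quadEps M u * cos (2 * (k : ℝ) * ((u : ℝ) * π / M)) =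
      if (M : ℤ) ∣ k then (M : ℝ) else 0 := by
  rw [sum_quadEps M hM (fun u => cos (2 * (k : ℝ) * ((u : ℝ) * π / M))), sum_range_cos_eq_ite M hM]
  have hM' : (M : ℝ) ≠ 0 := by exact_mod_cast hM.ne'
  rw [mul_div_cancel_left₀ _ hM', show 2 * (k : ℝ) * π = k * (2 * π) by ring, cos_int_mul_two_pi]
  simp

/-- Discrete orthogonality of the cosines on the trapezoidal grid. -/
theorem sum_quadEps_cos_mul_cos (M : ℕ) (hM : 0 < M) {m κ : ℕ} (hm : 2 * m ≤ M) (hκ : 2 * κ ≤ M) :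
    quadEps M (2 * m) * ∑ u ∈ Finset.range (M + 1), quadEps M u *
      (cos (2 * (m : ℝ) * ((u : ℝ) * π / M)) * cos (2 * (κ : ℝ) * ((u : ℝ) * π / M))) =
      if m = κ then (M : ℝ) / 2 else 0 := by
  have h : ∀ u : ℕ, quadEps M u *
      (cos (2 * (m : ℝ) * ((u : ℝ) * π / M)) * cos (2 * (κ : ℝ) * ((u : ℝ) * π / M))) =
      1 / 2 * (quadEps M u * cos (2 * (((m : ℤ) + κ : ℤ) : ℝ) * ((u : ℝ) * π / M))) +
      1 / 2 * (quadEps M u * cos (2 * (((m : ℤ) - κ : ℤ) : ℝ) * ((u : ℝ) * π / M))) := by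
    intro u
    push_cast
    rw [show 2 * ((m : ℝ) + κ) * ((u : ℝ) * π / M) = 2 * (m : ℝ) * ((u : ℝ) * π / M) +
      2 * (κ : ℝ) * ((u : ℝ) * π / M) by ring, show 2 * ((m : ℝ) - κ) * ((u : ℝ) * π / M) =
      2 * (m : ℝ) * ((u : ℝ) * π / M) - 2 * (κ : ℝ) * ((u : ℝ) * π / M) by ring, cos_add, cos_sub]
    ring
  rw [Finset.sum_congr rfl fun u _ => h u, Finset.sum_add_distrib, ← Finset.mul_sum,
    ← Finset.mul_sum, sum_quadEps_cos M hM, sum_quadEps_cos M hM]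
  split_ifs with h1 h2 h3 h3 h4 h5 h5
  · subst h3
    obtain ⟨d, hd⟩ := h1
    have h0 : 2 * m = 0 ∨ 2 * m = M := by
      have h5 : (d : ℤ) ≤ 1 := by
        by_contra hcon
        have : (M : ℤ) * 2 ≤ M * d := mul_le_mul_of_nonneg_left (by omega) (by omega)
        omega
      have h6 : 0 ≤ d := by
        by_contra hcon
        have : (M : ℤ) * d ≤ M * (-1) := mul_le_mul_of_nonneg_left (by omega) (by omega)
        omega
      interval_cases d <;> omega
    rw [quadEps, if_pos h0]; ring
  · exfalso
    have := Int.eq_zero_of_abs_lt_dvd h2 (by rw [abs_lt]; constructor <;> omega)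
    omega
  · subst h3; simp at h2
  · exfalso
    have : (m : ℤ) + κ < M := by omega
    have := Int.eq_zero_of_abs_lt_dvd h1 (by rw [abs_lt]; constructor <;> omega)
    omega
  · subst h5
    have h0 : ¬ (2 * m = 0 ∨ 2 * m = M) := by
      rintro (h0 | h0)
      · exact h1 ⟨0, by omega⟩
      · exact h1 ⟨1, by omega⟩
    rw [quadEps, if_neg h0]; ring
  · exfalso
    have := Int.eq_zero_of_abs_lt_dvd h4 (by rw [abs_lt]; constructor <;> omega)
    omega
  · subst h5; simp at h4
  · ring

/-- The quadrature weights are the discrete cosine transform of the cosine moments of `sin ^ α`. -/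
theorem quadWeight_eq (α M u : ℕ) (hα : 0 < α) :
    quadWeight α M u = quadEps M u * ∑ m ∈ Finset.range (M / 2 + 1),
      2 / (M : ℝ) * cosMoment α m * (quadEps M (2 * m) * cos (2 * (m : ℝ) * ((u : ℝ) * π / M))) := by
  obtain ⟨b, rfl⟩ : ∃ b, α = b + 1 := ⟨α - 1, by omega⟩
  unfold quadWeight cosMoment
  rw [Finset.mul_sum]
  congr 1
  refine Finset.sum_congr rfl fun m _ => ?_
  rw [show 2 * (m : ℝ) * (u : ℝ) * π / (M : ℝ) = 2 * (m : ℝ) * ((u : ℝ) * π / M) by ring,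
    Nat.add_sub_cancel, pow_succ, div_mul_div_comm, div_mul_div_comm, div_mul_eq_mul_div,
    show ∀ G : ℝ, (M : ℝ) * (2 ^ b * 2 * G) = 2 * (2 ^ b * M * G) from fun G => by ring,
    ← mul_div_mul_left _ (2 ^ b * (M : ℝ) * _) (two_ne_zero' ℝ)]
  congr 1
  ring

/-- The span of the even cosines `cos (2 κ θ)` with `κ ≤ K`. -/
noncomputable def cosSpan (K : ℕ) : Submodule ℝ (ℝ → ℝ) :=
  Submodule.span ℝ {f | ∃ κ ≤ K, f = fun θ => cos (2 * (κ : ℝ) * θ)}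

theorem cosSpan_mono {K L : ℕ} (h : K ≤ L) : cosSpan K ≤ cosSpan L :=
  Submodule.span_mono fun _ ⟨κ, hκ, hf⟩ => ⟨κ, hκ.trans h, hf⟩

theorem cosSpan_cos_two_mul {K : ℕ} {f : ℝ → ℝ} (hf : f ∈ cosSpan K) :
    (fun θ => cos (2 * θ)) * f ∈ cosSpan (K + 1) := by
  induction hf using Submodule.span_induction with
  | mem f hf =>
    obtain ⟨κ, hκ, rfl⟩ := hf
    rcases κ with _ | κ
    · refine Submodule.subset_span ⟨1, by omega, ?_⟩
      funext θ; simp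
    · have h1 : (fun θ => cos (2 * ((κ + 2 : ℕ) : ℝ) * θ)) ∈ cosSpan (K + 1) :=
        Submodule.subset_span ⟨κ + 2, by omega, rfl⟩
      have h2 : (fun θ => cos (2 * (κ : ℝ) * θ)) ∈ cosSpan (K + 1) :=
        Submodule.subset_span ⟨κ, by omega, rfl⟩
      have e : (fun θ : ℝ => cos (2 * θ)) * (fun θ => cos (2 * ((κ + 1 : ℕ) : ℝ) * θ)) =
          (1 / 2 : ℝ) • ((fun θ => cos (2 * ((κ + 2 : ℕ) : ℝ) * θ)) +
            fun θ => cos (2 * (κ : ℝ) * θ)) := by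
        funext θ
        simp only [Pi.mul_apply, Pi.smul_apply, Pi.add_apply, smul_eq_mul]
        rw [show 2 * ((κ + 2 : ℕ) : ℝ) * θ = 2 * ((κ + 1 : ℕ) : ℝ) * θ + 2 * θ by push_cast; ring,
          show 2 * (κ : ℝ) * θ = 2 * ((κ + 1 : ℕ) : ℝ) * θ - 2 * θ by push_cast; ring,
          cos_add, cos_sub]
        ring
      rw [e]
      exact Submodule.smul_mem _ _ (Submodule.add_mem _ h1 h2)
  | zero => rw [mul_zero]; exact Submodule.zero_mem _
  | add f g _ _ h1 h2 => rw [mul_add]; exact Submodule.add_mem _ h1 h2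
  | smul c f _ h => rw [mul_smul_comm]; exact Submodule.smul_mem _ _ h

/-- An even power of `cos` times an even power of `sin` is a polynomial in `cos (2 θ)`. -/
theorem cos_sin_pow_mem_cosSpan (p q : ℕ) :
    (fun θ => cos θ ^ (2 * p) * sin θ ^ (2 * q)) ∈ cosSpan (p + q) := by
  induction p with
  | zero =>
    induction q with
    | zero =>
      refine Submodule.subset_span ⟨0, le_rfl, ?_⟩
      funext θ; simp
    | succ q ih =>
      have e : (fun θ => cos θ ^ (2 * 0) * sin θ ^ (2 * (q + 1))) =
          (1 / 2 : ℝ) • ((fun θ => cos θ ^ (2 * 0) * sin θ ^ (2 * q)) -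
            (fun θ => cos (2 * θ)) * (fun θ => cos θ ^ (2 * 0) * sin θ ^ (2 * q))) := by
        funext θ
        simp only [Pi.mul_apply, Pi.smul_apply, Pi.sub_apply, smul_eq_mul, cos_two_mul]
        have := sin_sq_add_cos_sq θ
        linear_combination (sin θ ^ (2 * q)) * this
      rw [e]
      exact Submodule.smul_mem _ _ (Submodule.sub_mem _ (cosSpan_mono (by omega) ih)
        (cosSpan_cos_two_mul ih))
  | succ p ih =>
    have e : (fun θ => cos θ ^ (2 * (p + 1)) * sin θ ^ (2 * q)) =
        (1 / 2 : ℝ) • ((fun θ => cos θ ^ (2 * p) * sin θ ^ (2 * q)) +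
          (fun θ => cos (2 * θ)) * (fun θ => cos θ ^ (2 * p) * sin θ ^ (2 * q))) := by
      funext θ
      simp only [Pi.mul_apply, Pi.smul_apply, Pi.add_apply, smul_eq_mul, cos_two_mul]
      ring
    rw [e]
    exact Submodule.smul_mem _ _ (Submodule.add_mem _ (cosSpan_mono (by omega) ih)
      (by rw [show p + 1 + q = p + q + 1 by ring]; exact cosSpan_cos_two_mul ih))

theorem continuous_of_mem_cosSpan {K : ℕ} {f : ℝ → ℝ} (hf : f ∈ cosSpan K) : Continuous f := by
  induction hf using Submodule.span_induction with
  | mem f hf =>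
    obtain ⟨κ, _, rfl⟩ := hf
    fun_prop
  | zero => exact continuous_const
  | add f g _ _ h1 h2 => exact h1.add h2
  | smul c f _ h => exact h.const_smul c

/-- A quadrature formula that is exact for the cosines is exact on their span. -/
theorem quadrature_exact_of_cos {K N : ℕ} (w x : ℕ → ℝ) {ρ : ℝ → ℝ} (hρ : Continuous ρ)
    (h : ∀ κ ≤ K, ∑ u ∈ Finset.range N, w u * cos (2 * (κ : ℝ) * x u) =
      ∫ θ in 0..π, ρ θ * cos (2 * (κ : ℝ) * θ)) {f : ℝ → ℝ} (hf : f ∈ cosSpan K) :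
    ∑ u ∈ Finset.range N, w u * f (x u) = ∫ θ in 0..π, ρ θ * f θ := by
  induction hf using Submodule.span_induction with
  | mem f hf =>
    obtain ⟨κ, hκ, rfl⟩ := hf
    exact h κ hκ
  | zero => simp
  | add f g hf hg h1 h2 =>
    have hf' := continuous_of_mem_cosSpan hf
    have hg' := continuous_of_mem_cosSpan hg
    simp only [Pi.add_apply, mul_add, Finset.sum_add_distrib, h1, h2]
    rw [intervalIntegral.integral_add (Continuous.intervalIntegrable (by fun_prop) _ _)
      (Continuous.intervalIntegrable (by fun_prop) _ _)]
  | smul c f _ h1 =>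
    simp only [Pi.smul_apply, smul_eq_mul, mul_left_comm _ c, ← Finset.mul_sum, h1,
      intervalIntegral.integral_const_mul]

/-- The quadrature formula is exact for `cos (2 κ θ)` up to `2 κ = M`: at that frequency the factor
`ε_{2μ}` makes up for aliasing. -/
theorem quadWeight_cos (α M : ℕ) (hα : 0 < α) (hM : 0 < M) {κ : ℕ} (hκ : 2 * κ ≤ M) :
    ∑ u ∈ Finset.range (M + 1), quadWeight α M u * cos (2 * (κ : ℝ) * ((u : ℝ) * π / M)) =
      ∫ θ in 0..π, sin θ ^ α * cos (2 * (κ : ℝ) * θ) := by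
  rw [integral_sin_pow_mul_cos]
  have h : ∀ u, quadWeight α M u * cos (2 * (κ : ℝ) * ((u : ℝ) * π / M)) =
      ∑ m ∈ Finset.range (M / 2 + 1), 2 / (M : ℝ) * cosMoment α m * (quadEps M (2 * m) *
        (quadEps M u * (cos (2 * (m : ℝ) * ((u : ℝ) * π / M)) *
          cos (2 * (κ : ℝ) * ((u : ℝ) * π / M))))) := by
    intro u
    rw [quadWeight_eq α M u hα, mul_assoc, Finset.sum_mul, Finset.mul_sum]
    exact Finset.sum_congr rfl fun m _ => by ring
  rw [Finset.sum_congr rfl fun u _ => h u, Finset.sum_comm]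
  have h2 : ∀ m ∈ Finset.range (M / 2 + 1), ∑ u ∈ Finset.range (M + 1),
      2 / (M : ℝ) * cosMoment α m * (quadEps M (2 * m) *
        (quadEps M u * (cos (2 * (m : ℝ) * ((u : ℝ) * π / M)) *
          cos (2 * (κ : ℝ) * ((u : ℝ) * π / M))))) = if m = κ then cosMoment α κ else 0 := by
    intro m hm
    have hm' := Finset.mem_range.1 hm
    rw [← Finset.mul_sum, ← Finset.mul_sum, sum_quadEps_cos_mul_cos M hM (by omega) hκ]
    have hM' : (M : ℝ) ≠ 0 := by exact_mod_cast hM.ne'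
    split_ifs with h
    · subst h; field_simp
    · simp
  rw [Finset.sum_congr rfl h2, Finset.sum_ite_eq' , if_pos (Finset.mem_range.2 (by omega))]

/-- Exactness for monomials in `cos` and `sin` that are even in both, against the weight `sin ^ α`. -/
theorem quadWeight_exact (α M : ℕ) (hα : 0 < α) (hM : 0 < M) {p q : ℕ} (hp : Even p) (hq : Even q)
    (hpq : p + q ≤ M) :
    ∑ u ∈ Finset.range (M + 1), quadWeight α M u *
      (cos ((u : ℝ) * π / M) ^ p * sin ((u : ℝ) * π / M) ^ q) =
      ∫ θ in 0..π, cos θ ^ p * sin θ ^ (q + α) := by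
  obtain ⟨a, rfl⟩ := hp.exists_two_nsmul
  obtain ⟨b, rfl⟩ := hq.exists_two_nsmul
  simp only [smul_eq_mul] at *
  have h := quadrature_exact_of_cos (K := a + b) (N := M + 1) (quadWeight α M)
    (fun u => (u : ℝ) * π / M) (ρ := fun θ => sin θ ^ α) (by fun_prop)
    (fun κ hκ => quadWeight_cos α M hα hM (by omega)) (cos_sin_pow_mem_cosSpan a b)
  rw [h]
  exact intervalIntegral.integral_congr fun θ _ => by ring

theorem quadEps_reflect (M u : ℕ) (hu : u ≤ M) : quadEps M (M - u) = quadEps M u := by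
  unfold quadEps
  congr 1
  simp only [eq_iff_iff]
  omega

theorem quadWeight_reflect (α M u : ℕ) (hM : 0 < M) (hu : u ≤ M) :
    quadWeight α M (M - u) = quadWeight α M u := by
  have hM' : (M : ℝ) ≠ 0 := by exact_mod_cast hM.ne'
  unfold quadWeight
  rw [quadEps_reflect M u hu]
  congr 2
  refine Finset.sum_congr rfl fun m _ => ?_
  rw [Nat.cast_sub hu, show 2 * (m : ℝ) * ((M : ℝ) - u) * π / M =
    (m : ℝ) * (2 * π) - 2 * (m : ℝ) * u * π / M by field_simp, cos_nat_mul_two_pi_sub]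

/-- Odd powers of `cos` are killed by the symmetry `u ↦ M - u` of nodes and weights. -/
theorem quadWeight_odd (α M : ℕ) (hM : 0 < M) {p : ℕ} (hp : Odd p) (q : ℕ) :
    ∑ u ∈ Finset.range (M + 1), quadWeight α M u *
      (cos ((u : ℝ) * π / M) ^ p * sin ((u : ℝ) * π / M) ^ q) = 0 := by
  have hM' : (M : ℝ) ≠ 0 := by exact_mod_cast hM.ne'
  have h := Finset.sum_range_reflect (fun u : ℕ => quadWeight α M u *
      (cos ((u : ℝ) * π / M) ^ p * sin ((u : ℝ) * π / M) ^ q)) (M + 1)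
  have h2 : ∀ u ∈ Finset.range (M + 1), quadWeight α M (M + 1 - 1 - u) *
      (cos (((M + 1 - 1 - u : ℕ) : ℝ) * π / M) ^ p * sin (((M + 1 - 1 - u : ℕ) : ℝ) * π / M) ^ q) =
      -(quadWeight α M u * (cos ((u : ℝ) * π / M) ^ p * sin ((u : ℝ) * π / M) ^ q)) := by
    intro u hu
    have hu' : u ≤ M := by have := Finset.mem_range.1 hu; omega
    rw [Nat.add_sub_cancel, quadWeight_reflect α M u hM hu', Nat.cast_sub hu',
      show ((M : ℝ) - u) * π / M = π - u * π / M by field_simp, cos_pi_sub, sin_pi_sub, hp.neg_pow]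
    ring
  rw [Finset.sum_congr rfl h2, Finset.sum_neg_distrib] at h
  linarith

/-- The equidistant rule on the full circle, for monomials that are even in both coordinates.
Such a monomial has period `π`, so that `M` nodes in `[0, π)` suffice. -/
theorem azimuth_exact (M : ℕ) (hM : 0 < M) {p q : ℕ} (hp : Even p) (hq : Even q)
    (hpq : p + q ≤ M) :
    π / M * ∑ t ∈ Finset.range (2 * M), cos ((t : ℝ) * π / M) ^ p * sin ((t : ℝ) * π / M) ^ q =
      2 * ∫ θ in 0..π, cos θ ^ p * sin θ ^ q := by
  have hM' : (M : ℝ) ≠ 0 := by exact_mod_cast hM.ne'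
  obtain ⟨a, rfl⟩ := hp.exists_two_nsmul
  obtain ⟨b, rfl⟩ := hq.exists_two_nsmul
  simp only [smul_eq_mul] at *
  have h := quadrature_exact_of_cos (K := a + b) (N := M) (fun _ => π / M)
    (fun u => (u : ℝ) * π / M) (ρ := fun θ => 1) (by fun_prop)
    (fun κ hκ => by
      have h1 := integral_sin_pow_mul_cos 0 κ
      have h2 := sum_range_cos_eq_ite M hM κ
      simp only [pow_zero] at h1
      rw [h1, ← Finset.mul_sum]
      push_cast at h2
      rw [h2]
      rcases κ with _ | κ
      · simp [cosMoment]; field_simp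
      · rw [if_neg]
        · have h3 : Gamma (-(κ : ℝ)) = 0 := Gamma_neg_nat_eq_zero κ
          have e : (((0 : ℕ) : ℝ) / 2 - ((κ + 1 : ℕ) : ℝ) + 1) = -(κ : ℝ) := by push_cast; ring
          rw [cosMoment, e, h3]
          simp
        · intro hd
          have := Int.le_of_dvd (by omega) hd
          omega) (cos_sin_pow_mem_cosSpan a b)
  simp only [one_mul] at h
  rw [← h, two_mul M, Finset.sum_range_add, ← Finset.mul_sum]
  have h2 : ∀ t ∈ Finset.range M, cos (((M + t : ℕ) : ℝ) * π / M) ^ (2 * a) *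
      sin (((M + t : ℕ) : ℝ) * π / M) ^ (2 * b) =
      cos ((t : ℝ) * π / M) ^ (2 * a) * sin ((t : ℝ) * π / M) ^ (2 * b) := by
    intro t _
    rw [show ((M + t : ℕ) : ℝ) * π / M = t * π / M + π by push_cast; field_simp; ring, cos_add_pi,
      sin_add_pi, (even_two_mul a).neg_pow, (even_two_mul b).neg_pow]
  rw [Finset.sum_congr rfl h2]
  ring

/-- Odd powers of `sin` are killed by the symmetry `t ↦ 2 M - t`. -/
theorem azimuth_odd_right (M : ℕ) (hM : 0 < M) (p : ℕ) {q : ℕ} (hq : Odd q) :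
    ∑ t ∈ Finset.range (2 * M), cos ((t : ℝ) * π / M) ^ p * sin ((t : ℝ) * π / M) ^ q = 0 := by
  have hM' : (M : ℝ) ≠ 0 := by exact_mod_cast hM.ne'
  set g : ℕ → ℝ := fun t => cos ((t : ℝ) * π / M) ^ p * sin ((t : ℝ) * π / M) ^ q with hg
  have hend : g (2 * M) = 0 := by
    have e : ((2 * M : ℕ) : ℝ) * π / M = 2 * π := by push_cast; field_simp
    simp only [hg, e, sin_two_pi, zero_pow hq.pos.ne', mul_zero]
  have h := Finset.sum_range_reflect g (2 * M + 1)
  have h2 : ∀ t ∈ Finset.range (2 * M + 1), g (2 * M + 1 - 1 - t) = -g t := by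
    intro t ht
    have ht' : t ≤ 2 * M := by have := Finset.mem_range.1 ht; omega
    simp only [hg]
    rw [Nat.add_sub_cancel, Nat.cast_sub ht', show (((2 * M : ℕ) : ℝ) - t) * π / M =
      2 * π - t * π / M by push_cast; field_simp, cos_two_pi_sub, sin_two_pi_sub, hq.neg_pow]
    ring
  rw [Finset.sum_congr rfl h2, Finset.sum_neg_distrib, Finset.sum_range_succ, hend] at h
  linarith

/-- Odd functions under the antipodal map `t ↦ t + M` have sum `0`. -/
theorem azimuth_odd_left (M : ℕ) (hM : 0 < M) {p q : ℕ} (hp : Odd p) (hq : Even q) :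
    ∑ t ∈ Finset.range (2 * M), cos ((t : ℝ) * π / M) ^ p * sin ((t : ℝ) * π / M) ^ q = 0 := by
  have hM' : (M : ℝ) ≠ 0 := by exact_mod_cast hM.ne'
  rw [two_mul M, Finset.sum_range_add, ← Finset.sum_add_distrib]
  refine Finset.sum_eq_zero fun t _ => ?_
  rw [show ((M + t : ℕ) : ℝ) * π / M = t * π / M + π by push_cast; field_simp; ring, cos_add_pi,
      sin_add_pi, hp.neg_pow, hq.neg_pow]
  ring

end Quadrature

/-! ### Positivity of the weights for small exponents -/

section Positivity

open Real

theorem cosMoment_one (m : ℕ) : cosMoment 1 m = 2 / (1 - 4 * (m : ℝ) ^ 2) := by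
  induction m with
  | zero => rw [← integral_sin_pow_closed]; simp; norm_num
  | succ m ih =>
    have h := cosMoment_succ 1 m
    rw [ih] at h
    have h1 : (1 - 4 * (m : ℝ) ^ 2) ≠ 0 := by
      have : (1 : ℤ) - 4 * (m : ℤ) ^ 2 ≠ 0 := by omega
      exact_mod_cast this
    have h2 : (2 * (m : ℝ) + 1) ≠ 0 := by positivity
    have h3 : (2 * (m : ℝ) + 3) ≠ 0 := by positivity
    have h4 : (1 - 4 * ((m + 1 : ℕ) : ℝ) ^ 2) = -((2 * m + 1) * (2 * m + 3)) := by push_cast; ring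
    rw [h4]
    have h5 : (1 - 2 * (m : ℝ)) ≠ 0 := by
      intro h0; apply h1; linear_combination (1 + 2 * (m : ℝ)) * h0
    have h6 : (1 - 4 * (m : ℝ) ^ 2) = (1 - 2 * m) * (2 * m + 1) := by ring
    have h7 : -(((1 : ℕ) : ℝ) / 2 - m) * (2 / (1 - 4 * (m : ℝ) ^ 2)) = -1 / (2 * m + 1) := by
      rw [h6]; push_cast; field_simp
    rw [h7] at h
    apply mul_left_cancel₀ (a := ((1 : ℕ) : ℝ) / 2 + m + 1) (by positivity)
    rw [h]
    push_cast
    field_simp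
    ring

/-- For `α = 1` the moments with `m ≥ 1` are negative, and the sum is bounded below by the telescoping
series `1 - ∑ 2 / ((2 m - 1) (2 m + 1))`. -/
theorem sum_cosMoment_one (e : ℕ → ℝ) (h0 : e 0 = 1 / 2) (he : ∀ m, e m ≤ 1) (K : ℕ) :
    1 / (2 * (K : ℝ) + 1) ≤ ∑ m ∈ Finset.range (K + 1), cosMoment 1 m * e m := by
  induction K with
  | zero => simp [cosMoment_one, h0]
  | succ K ih =>
    rw [Finset.sum_range_succ, cosMoment_one]
    have h4 : (1 - 4 * ((K + 1 : ℕ) : ℝ) ^ 2) = -((2 * K + 1) * (2 * K + 3)) := by push_cast; ring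
    have h5 : 2 / ((2 * (K : ℝ) + 1) * (2 * K + 3)) * e (K + 1) ≤
        2 / ((2 * (K : ℝ) + 1) * (2 * K + 3)) :=
      mul_le_of_le_one_right (by positivity) (he _)
    have h6 : 1 / (2 * ((K + 1 : ℕ) : ℝ) + 1) =
        1 / (2 * (K : ℝ) + 1) - 2 / ((2 * (K : ℝ) + 1) * (2 * K + 3)) := by
      push_cast; field_simp; ring
    rw [h4, h6, div_neg, neg_mul]
    linarith

theorem cosMoment_two (m : ℕ) : cosMoment 2 (m + 2) = 0 := by
  induction m with
  | zero =>
    have h := cosMoment_succ 2 1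
    norm_num at h
    exact h
  | succ m ih =>
    have h := cosMoment_succ 2 (m + 2)
    rw [ih, mul_zero] at h
    exact (mul_eq_zero.1 h).resolve_left (by positivity)

/-- For `α = 2` only the first two moments are not zero, since `sin ^ 2 θ = (1 - cos (2 θ)) / 2`. -/
theorem sum_cosMoment_two (e : ℕ → ℝ) (h0 : e 0 = 1 / 2) (he : ∀ m, e m ≤ 1) (K : ℕ) :
    0 ≤ ∑ m ∈ Finset.range (K + 1), cosMoment 2 m * e m := by
  have hc : 0 ≤ cosMoment 2 0 := by
    rw [← integral_sin_pow_closed]; exact (integral_sin_pow_pos 2).le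
  have hc1 : cosMoment 2 1 = -(cosMoment 2 0 / 2) := by
    have h := cosMoment_succ 2 0
    norm_num at h
    linarith
  rcases K with _ | K
  · simp [h0]; exact hc
  · rw [Finset.sum_range_succ', Finset.sum_range_succ', Finset.sum_eq_zero fun m _ => by
      rw [cosMoment_two, zero_mul], hc1, h0]
    nlinarith [he 1]

/-- For the weight functions `sin` and `sin ^ 2` the quadrature weights are nonnegative. -/
theorem quadWeight_nonneg {α : ℕ} (hα : α = 1 ∨ α = 2) (M u : ℕ) : 0 ≤ quadWeight α M u := by
  have hε : ∀ k, 0 ≤ quadEps M k ∧ quadEps M k ≤ 1 := fun k => by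
    unfold quadEps; split_ifs <;> norm_num
  rw [quadWeight_eq α M u (by omega)]
  simp only [mul_assoc]
  rw [← Finset.mul_sum]
  have h0 : quadEps M (2 * 0) * cos (2 * (((0 : ℕ) : ℝ) * ((u : ℝ) * π / M))) = 1 / 2 := by
    simp [quadEps]
  have he : ∀ m : ℕ, quadEps M (2 * m) * cos (2 * ((m : ℝ) * ((u : ℝ) * π / M))) ≤ 1 := fun m => by
    nlinarith [cos_le_one (2 * ((m : ℝ) * ((u : ℝ) * π / M))), (hε (2 * m)).1, (hε (2 * m)).2]
  refine mul_nonneg (hε u).1 (mul_nonneg (by positivity) ?_)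
  rcases hα with rfl | rfl
  · exact le_trans (by positivity) (sum_cosMoment_one
      (fun m => quadEps M (2 * m) * cos (2 * ((m : ℝ) * ((u : ℝ) * π / M)))) h0 he _)
  · exact sum_cosMoment_two
      (fun m => quadEps M (2 * m) * cos (2 * ((m : ℝ) * ((u : ℝ) * π / M)))) h0 he _

theorem gridWeight_nonneg {n : ℕ} (hn : n ≤ 3) (j : ℕ) (p : GridIndex n j) :
    0 ≤ gridWeight n j p :=
  Finset.prod_nonneg fun v _ => quadWeight_nonneg (by omega) _ _

end Positivity

/-! ### Quadrature on the sphere -/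

section GridQuadrature

open Real

/-- A monomial in spherical coordinates. -/
theorem prod_sphericalCoord_pow (N : ℕ) (th : Fin N → ℝ) (ph : ℝ) (b : ℕ → ℕ) :
    ∏ i, sphericalCoord (N + 1) th ph i ^ b i.val =
      (∏ v : Fin N, cos (th v) ^ b v.val * sin (th v) ^ ∑ i ∈ Finset.Ico (v.val + 1) (N + 2), b i) *
        (cos ph ^ b N * sin ph ^ b (N + 1)) := by
  have h1 : ∏ i : Fin (N + 2), (∏ v : Fin N, if v.val < i.val then sin (th v) else 1) ^ b i.val =
      ∏ v : Fin N, sin (th v) ^ ∑ i ∈ Finset.Ico (v.val + 1) (N + 2), b i := by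
    simp only [← Finset.prod_pow]
    rw [Finset.prod_comm]
    refine Finset.prod_congr rfl fun v _ => ?_
    have h2 : ∀ i : Fin (N + 2), (if v.val < i.val then sin (th v) else 1) ^ b i.val =
        (fun k : ℕ => if v.val < k then sin (th v) ^ b k else 1) i.val := fun i => by
      simp only
      split_ifs <;> simp
    rw [Finset.prod_congr rfl fun i _ => h2 i,
      Fin.prod_univ_eq_prod_range (fun k : ℕ => if v.val < k then sin (th v) ^ b k else 1),
      ← Finset.prod_filter, Finset.prod_pow_eq_pow_sum]
    congr 2
    ext k; simp; omega
  have h2 : ∏ i : Fin (N + 2), (if h : i.val < N then cos (th ⟨i.val, h⟩)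
     else if i.val = N then cos ph else sin ph) ^ b i.val =
      (∏ v : Fin N, cos (th v) ^ b v.val) * (cos ph ^ b N * sin ph ^ b (N + 1)) := by
    rw [Fin.prod_univ_castSucc, Fin.prod_univ_castSucc]
    simp [mul_assoc]
  have h3 : ∏ i, sphericalCoord (N + 1) th ph i ^ b i.val =
      (∏ i : Fin (N + 2), (∏ v : Fin N, if v.val < i.val then sin (th v) else 1) ^ b i.val) *
      ∏ i : Fin (N + 2), (if h : i.val < N then cos (th ⟨i.val, h⟩)
        else if i.val = N then cos ph else sin ph) ^ b i.val := by
    rw [← Finset.prod_mul_distrib]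
    refine Finset.prod_congr rfl fun i _ => ?_
    rw [← mul_pow]
    rfl
  rw [h3, h1, h2, Finset.prod_mul_distrib]
  ring

/-- The sum over the grid factors into sums over the single angles. -/
theorem sum_grid_monomial (N J : ℕ) (hN : 2 ≤ N + 1) (b : ℕ → ℕ) :
    ∑ p : GridIndex (N + 1) J, gridWeight (N + 1) J p *
        ∏ i, (gridPoint (N + 1) hN J p).1 i ^ b i.val =
      (∏ v ∈ Finset.range N, ∑ u ∈ Finset.range (2 ^ J + 1), quadWeight (N - v) (2 ^ J) u *
        (cos ((u : ℝ) * π / (2 ^ J : ℕ)) ^ b v *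
          sin ((u : ℝ) * π / (2 ^ J : ℕ)) ^ ∑ i ∈ Finset.Ico (v + 1) (N + 2), b i)) *
      ∑ t ∈ Finset.range (2 * 2 ^ J),
        cos ((t : ℝ) * π / (2 ^ J : ℕ)) ^ b N * sin ((t : ℝ) * π / (2 ^ J : ℕ)) ^ b (N + 1) := by
  have h1 : ∀ p : GridIndex (N + 1) J, gridWeight (N + 1) J p *
      ∏ i, (gridPoint (N + 1) hN J p).1 i ^ b i.val =
      (∏ v : Fin N, quadWeight (N - v.val) (2 ^ J) (p.1 v).val *
        (cos (((p.1 v).val : ℝ) * π / (2 ^ J : ℕ)) ^ b v.val *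
          sin (((p.1 v).val : ℝ) * π / (2 ^ J : ℕ)) ^
            ∑ i ∈ Finset.Ico (v.val + 1) (N + 2), b i)) *
      (cos ((p.2.val : ℝ) * π / (2 ^ J : ℕ)) ^ b N *
        sin ((p.2.val : ℝ) * π / (2 ^ J : ℕ)) ^ b (N + 1)) := by
    intro p
    have e := prod_sphericalCoord_pow N (fun v => ((p.1 v).val : ℝ) * π / 2 ^ J)
      ((p.2.val : ℝ) * π / 2 ^ J) b
    have e2 : ∏ i, (gridPoint (N + 1) hN J p).1 i ^ b i.val = ∏ i, sphericalCoord (N + 1)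
      (fun v => ((p.1 v).val : ℝ) * π / 2 ^ J) ((p.2.val : ℝ) * π / 2 ^ J) i ^ b i.val := rfl
    have e3 : gridWeight (N + 1) J p =
        ∏ v : Fin N, quadWeight (N - v.val) (2 ^ J) (p.1 v).val := by
      unfold gridWeight
      refine Finset.prod_congr rfl fun v _ => ?_
      rw [Nat.add_sub_add_right]
    rw [e2.trans e, e3, Finset.prod_mul_distrib (f := fun v : Fin N =>
      quadWeight (N - v.val) (2 ^ J) (p.1 v).val)]
    push_cast
    ring
  rw [Finset.sum_congr rfl fun p _ => h1 p, Fintype.sum_prod_type]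
  simp only [← Finset.mul_sum]
  rw [← Finset.sum_mul]
  congr 1
  · rw [← Fin.prod_univ_eq_prod_range (fun v => ∑ u ∈ Finset.range (2 ^ J + 1),
      quadWeight (N - v) (2 ^ J) u * (cos ((u : ℝ) * π / (2 ^ J : ℕ)) ^ b v *
          sin ((u : ℝ) * π / (2 ^ J : ℕ)) ^ ∑ i ∈ Finset.Ico (v + 1) (N + 2), b i))]
    have h2 : ∀ v : Fin N, ∑ u ∈ Finset.range (2 ^ J + 1),
      quadWeight (N - v.val) (2 ^ J) u * (cos ((u : ℝ) * π / (2 ^ J : ℕ)) ^ b v.val *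
          sin ((u : ℝ) * π / (2 ^ J : ℕ)) ^ ∑ i ∈ Finset.Ico (v.val + 1) (N + 2), b i) =
      ∑ u : Fin (2 ^ J + 1),
      quadWeight (N - v.val) (2 ^ J) u.val * (cos ((u.val : ℝ) * π / (2 ^ J : ℕ)) ^ b v.val *
          sin ((u.val : ℝ) * π / (2 ^ J : ℕ)) ^ ∑ i ∈ Finset.Ico (v.val + 1) (N + 2), b i) :=
      fun v => (Fin.sum_univ_eq_sum_range (fun u => quadWeight (N - v.val) (2 ^ J) u *
        (cos ((u : ℝ) * π / (2 ^ J : ℕ)) ^ b v.val *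
          sin ((u : ℝ) * π / (2 ^ J : ℕ)) ^ ∑ i ∈ Finset.Ico (v.val + 1) (N + 2), b i)) _).symm
    rw [Finset.prod_congr rfl fun v _ => h2 v, Finset.prod_univ_sum, Fintype.piFinset_univ]
    rfl
  · rw [← Fin.sum_univ_eq_sum_range (fun t : ℕ => cos ((t : ℝ) * π / (2 ^ J : ℕ)) ^ b N *
      sin ((t : ℝ) * π / (2 ^ J : ℕ)) ^ b (N + 1)), pow_succ' 2 J]

/-- The quadrature formula is exact for monomials of degree at most `2 ^ J`. When all exponents
are even, the one-dimensional integrals are Beta integrals and their product telescopes. -/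
theorem sum_grid_monomial_eq_integral (N J : ℕ) (hN : 2 ≤ N + 1) (b : ℕ → ℕ)
    (hb : ∑ i ∈ Finset.range (N + 2), b i ≤ 2 ^ J) :
    π / (2 ^ J : ℕ) * ∑ p : GridIndex (N + 1) J, gridWeight (N + 1) J p *
        ∏ i, (gridPoint (N + 1) hN J p).1 i ^ b i.val =
      ∫ s : Sph (N + 1), ∏ i, s.1 i ^ b i.val ∂(sigma (N + 1)) := by
  have hM : 0 < 2 ^ J := by positivity
  have hS := integral_sphere_monomial (n := N + 1) (fun i => b i.val)
  rw [Fin.sum_univ_eq_sum_range b, Fin.prod_univ_eq_prod_range (fun i => gaussMoment (b i))] at hS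
  have hΓ : ∀ d : ℕ, Gamma (((d : ℝ) + 1) / 2) ≠ 0 := fun d =>
    (Gamma_pos_of_pos (by positivity)).ne'
  apply mul_right_cancel₀ (hΓ (∑ i ∈ Finset.range (N + 2), b i + (N + 1)))
  rw [hS, sum_grid_monomial]
  set V : ℕ → ℝ := fun v => ∑ u ∈ Finset.range (2 ^ J + 1), quadWeight (N - v) (2 ^ J) u *
        (cos ((u : ℝ) * π / (2 ^ J : ℕ)) ^ b v *
          sin ((u : ℝ) * π / (2 ^ J : ℕ)) ^ ∑ i ∈ Finset.Ico (v + 1) (N + 2), b i) with hV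
  set A : ℝ := ∑ t ∈ Finset.range (2 * 2 ^ J),
        cos ((t : ℝ) * π / (2 ^ J : ℕ)) ^ b N * sin ((t : ℝ) * π / (2 ^ J : ℕ)) ^ b (N + 1) with hA
  by_cases hev : ∀ i < N + 2, Even (b i)
  -- All exponents are even. `D v` is the power of the radius in the integral of the monomial in the
  -- coordinates with index `≥ v` in polar coordinates; the `v`-th Beta integral is
  -- `Γ((b v + 1) / 2) Γ((D (v + 1) + 1) / 2) / Γ((D v + 1) / 2)`.
  · set D : ℕ → ℕ := fun v => ∑ i ∈ Finset.Ico v (N + 2), b i + (N + 1 - v) with hD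
    have hsplit : ∀ v < N + 2, ∑ i ∈ Finset.Ico v (N + 2), b i =
        b v + ∑ i ∈ Finset.Ico (v + 1) (N + 2), b i := fun v hv =>
      Finset.sum_eq_sum_Ico_succ_bot hv b
    have hVv : ∀ v ∈ Finset.range N, V v * Gamma (((D v : ℝ) + 1) / 2) =
        Gamma (((b v : ℝ) + 1) / 2) * Gamma (((D (v + 1) : ℝ) + 1) / 2) := by
      intro v hv
      have hv' := Finset.mem_range.1 hv
      have hq : Even (∑ i ∈ Finset.Ico (v + 1) (N + 2), b i) :=
        Finset.even_sum _ fun i hi => hev i (Finset.mem_Ico.1 hi).2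
      have hle : b v + ∑ i ∈ Finset.Ico (v + 1) (N + 2), b i ≤ 2 ^ J := by
        rw [← hsplit v (by omega)]
        refine le_trans (Finset.sum_le_sum_of_subset fun i hi => ?_) hb
        exact Finset.mem_range.2 (Finset.mem_Ico.1 hi).2
      have h1 := quadWeight_exact (N - v) (2 ^ J) (by omega) hM (hev v (by omega)) hq hle
      have h2 := integral_cos_sin_pow (hev v (by omega))
        (∑ i ∈ Finset.Ico (v + 1) (N + 2), b i + (N - v))
      have e1 : b v + (∑ i ∈ Finset.Ico (v + 1) (N + 2), b i + (N - v)) + 1 = D v := by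
        simp only [hD]
        rw [hsplit v (by omega)]; omega
      have e2 : ∑ i ∈ Finset.Ico (v + 1) (N + 2), b i + (N - v) = D (v + 1) := by
        simp only [hD]; omega
      rw [← h1, e1, e2] at h2
      exact h2
    have hprod := Finset.prod_congr (rfl : Finset.range N = Finset.range N) hVv
    rw [Finset.prod_mul_distrib, Finset.prod_mul_distrib] at hprod
    have htel := (Finset.prod_range_succ (fun v => Gamma (((D v : ℝ) + 1) / 2)) N).symm.trans
      (Finset.prod_range_succ' (fun v => Gamma (((D v : ℝ) + 1) / 2)) N)
    have hAz := azimuth_exact (2 ^ J) hM (hev N (by omega)) (hev (N + 1) (by omega)) (by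
      refine le_trans ?_ hb
      rw [Finset.sum_range_succ, Finset.sum_range_succ]; omega)
    have hAz2 := integral_cos_sin_pow (hev N (by omega)) (b (N + 1))
    have e3 : b N + b (N + 1) + 1 = D N := by
      simp only [hD]
      rw [hsplit N (by omega), hsplit (N + 1) (by omega)]
      simp
    have e4 : ∑ i ∈ Finset.range (N + 2), b i + (N + 1) = D 0 := by
      simp only [hD]; rw [Finset.range_eq_Ico]; simp
    rw [e3] at hAz2
    rw [← hA] at hAz
    have hgm : ∏ i ∈ Finset.range (N + 2), gaussMoment (b i) =
        (∏ i ∈ Finset.range N, Gamma (((b i : ℝ) + 1) / 2)) *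
          Gamma (((b N : ℝ) + 1) / 2) * Gamma (((b (N + 1) : ℝ) + 1) / 2) := by
      rw [← Finset.prod_range_succ (fun i => Gamma (((b i : ℝ) + 1) / 2)),
        ← Finset.prod_range_succ (fun i => Gamma (((b i : ℝ) + 1) / 2))]
      refine Finset.prod_congr rfl fun i hi => ?_
      rw [gaussMoment, if_pos (hev i (Finset.mem_range.1 hi))]
    rw [hgm, e4]
    have hP : ∏ v ∈ Finset.range N, Gamma (((D v : ℝ) + 1) / 2) ≠ 0 :=
      Finset.prod_ne_zero_iff.2 fun v _ => hΓ _
    have htot : (∏ v ∈ Finset.range N, V v) * Gamma (((D 0 : ℝ) + 1) / 2) =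
        (∏ i ∈ Finset.range N, Gamma (((b i : ℝ) + 1) / 2)) * Gamma (((D N : ℝ) + 1) / 2) := by
      apply mul_left_cancel₀ hP
      linear_combination Gamma (((D 0 : ℝ) + 1) / 2) * hprod -
        (∏ i ∈ Finset.range N, Gamma (((b i : ℝ) + 1) / 2)) * htel
    linear_combination (π / (2 ^ J : ℕ) * A) * htot +
      (∏ i ∈ Finset.range N, Gamma (((b i : ℝ) + 1) / 2)) * Gamma (((D N : ℝ) + 1) / 2) * hAz +
      2 * (∏ i ∈ Finset.range N, Gamma (((b i : ℝ) + 1) / 2)) * hAz2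
  -- Some exponent is odd: both sides vanish.
  · push Not at hev
    obtain ⟨i, hi, hodd⟩ := hev
    have h0 : ∏ i ∈ Finset.range (N + 2), gaussMoment (b i) = 0 :=
      Finset.prod_eq_zero (Finset.mem_range.2 hi) (by rw [gaussMoment, if_neg hodd])
    have hodd' := Nat.not_even_iff_odd.1 hodd
    have hz : (∏ v ∈ Finset.range N, V v) * A = 0 := by
      by_cases hlast : Even (b (N + 1))
      · by_cases hi2 : i < N
        · rw [Finset.prod_eq_zero (Finset.mem_range.2 hi2) (quadWeight_odd _ _ hM hodd' _), zero_mul]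
        · have hiN : i = N := by
            by_contra hne
            have : i = N + 1 := by omega
            rw [this] at hodd
            exact hodd hlast
          rw [hiN] at hodd'
          rw [hA, azimuth_odd_left _ hM hodd' hlast, mul_zero]
      · rw [hA, azimuth_odd_right _ hM _ (Nat.not_even_iff_odd.1 hlast), mul_zero]
    rw [h0, hz]
    ring

open MvPolynomial in
/-- The quadrature formula of the grid is exact for polynomials of degree at most `2 ^ J`. -/
theorem sphereInt_eq_grid_sum {n : ℕ} (hn : 2 ≤ n) (J : ℕ) {P : MvPolynomial (Fin (n + 1)) ℂ}
    (hP : P.totalDegree ≤ 2 ^ J) :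
    sphereInt n P = ((π / (2 ^ J : ℕ) : ℝ) : ℂ) * ∑ p : GridIndex n J, (gridWeight n J p : ℂ) *
      restrictToSphere n P (gridPoint n hn J p) := by
  obtain ⟨N, rfl⟩ : ∃ N, n = N + 1 := ⟨n - 1, by omega⟩
  have hmon : ∀ a ∈ P.support, sphereInt (N + 1) (monomial a (P.coeff a)) =
      ((π / (2 ^ J : ℕ) : ℝ) : ℂ) * ∑ p : GridIndex (N + 1) J, (gridWeight (N + 1) J p : ℂ) *
        restrictToSphere (N + 1) (monomial a (P.coeff a)) (gridPoint (N + 1) hn J p) := by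
    intro a ha
    set b : ℕ → ℕ := fun i => if h : i < N + 2 then a ⟨i, h⟩ else 0 with hb
    have hab : ∀ i : Fin (N + 2), a i = b i.val := fun i => by simp [hb]
    have hsum : ∑ i ∈ Finset.range (N + 2), b i ≤ 2 ^ J := by
      rw [← Fin.sum_univ_eq_sum_range]
      refine le_trans ?_ ((le_totalDegree ha).trans hP)
      rw [Finsupp.sum_fintype _ _ (fun _ => rfl)]
      exact (Finset.sum_congr rfl fun i _ => (hab i).symm).le
    have h := sum_grid_monomial_eq_integral N J hn b hsum
    rw [sphereInt_monomial]
    simp only [hab, ← h]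
    push_cast
    rw [mul_left_comm, Finset.mul_sum]
    congr 1
    refine Finset.sum_congr rfl fun p _ => ?_
    rw [restrictToSphere_apply, eval_monomial, Finsupp.prod_fintype _ _ (fun _ => pow_zero _)]
    simp only [hab]
    ring
  conv_lhs => rw [P.as_sum, map_sum, Finset.sum_congr rfl hmon]
  rw [← Finset.mul_sum, Finset.sum_comm]
  congr 1
  refine Finset.sum_congr rfl fun p _ => ?_
  rw [← Finset.mul_sum, ← Finset.sum_apply, ← map_sum, ← P.as_sum]

end GridQuadrature

/-! ### Hyperspherical harmonics are harmonic polynomials -/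

section Hyperspherical

open MvPolynomial

variable {n : ℕ}

/-- The distance of a point to the subspace where the coordinates with index `≥ v` vanish. -/
noncomputable def tailNorm (v : ℕ) (x : Sph n) : ℝ :=
  Real.sqrt (∑ i : Fin (n + 1), if v ≤ i.val then x.1 i ^ 2 else 0)

theorem tailNorm_sq (v : ℕ) (x : Sph n) :
    tailNorm v x ^ 2 = ∑ i : Fin (n + 1), if v ≤ i.val then x.1 i ^ 2 else 0 :=
  Real.sq_sqrt (Finset.sum_nonneg fun i _ => by split_ifs <;> positivity)

theorem tailNorm_nonneg (v : ℕ) (x : Sph n) : 0 ≤ tailNorm v x := Real.sqrt_nonneg _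

theorem tailNorm_zero (x : Sph n) : tailNorm 0 x = 1 := by
  have h := sum_sq_sphere x
  simp [tailNorm, h]

theorem tailNorm_sq_succ (v : ℕ) (hv : v < n + 1) (x : Sph n) :
    tailNorm v x ^ 2 = x.1 ⟨v, hv⟩ ^ 2 + tailNorm (v + 1) x ^ 2 := by
  rw [tailNorm_sq, tailNorm_sq, ← Finset.add_sum_erase _ _ (Finset.mem_univ ⟨v, hv⟩),
    ← Finset.add_sum_erase _ _ (Finset.mem_univ ⟨v, hv⟩)]
  simp only [le_refl, if_true, Nat.not_succ_le_self, if_false, zero_add]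
  congr 1
  refine Finset.sum_congr rfl fun i hi => ?_
  have hne : i.val ≠ v := fun h => Finset.ne_of_mem_erase hi (Fin.ext h)
  congr 1
  simp only [eq_iff_iff]
  omega

theorem eval_tailSq (v : ℕ) (x : Sph n) :
    eval (fun i => ((x.1 i : ℝ) : ℂ)) (tailSq n v) = ((tailNorm v x ^ 2 : ℝ) : ℂ) := by
  rw [tailNorm_sq, tailSq, map_sum]
  push_cast
  refine Finset.sum_congr rfl fun i _ => ?_
  split_ifs <;> simp

/-- The spherical coordinates of a point, multiplied by the distance `tailNorm`. They hold also where
this distance is `0` and the angle is arbitrary, since all terms vanish there. -/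
theorem tailNorm_mul_cos_sin (v : Fin (n - 1)) (x : Sph n) :
    tailNorm v.val x * Real.cos (polarAngle n x v) = x.1 ⟨v.val, by omega⟩ ∧
      tailNorm v.val x * Real.sin (polarAngle n x v) = tailNorm (v.val + 1) x := by
  have hsq := tailNorm_sq_succ v.val (by omega) x
  have habs : |x.1 ⟨v.val, by omega⟩| ≤ tailNorm v.val x :=
    abs_le_of_sq_le_sq (by rw [hsq]; nlinarith [sq_nonneg (tailNorm (v.val + 1) x)])
      (tailNorm_nonneg _ _)
  have hcos : Real.cos (polarAngle n x v) = x.1 ⟨v.val, by omega⟩ / tailNorm v.val x := by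
    have h1 : |x.1 ⟨v.val, by omega⟩ / tailNorm v.val x| ≤ 1 := by
      rw [abs_div, abs_of_nonneg (tailNorm_nonneg _ _)]
      exact div_le_one_of_le₀ habs (tailNorm_nonneg _ _)
    exact Real.cos_arccos (abs_le.1 h1).1 (abs_le.1 h1).2
  have h1 : tailNorm v.val x * Real.cos (polarAngle n x v) = x.1 ⟨v.val, by omega⟩ := by
    rw [hcos]
    -- Where the angle is not determined, the coordinate itself is `0`.
    by_cases h0 : tailNorm v.val x = 0
    · rw [h0] at habs ⊢
      rw [zero_mul, abs_nonpos_iff.1 habs]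
    · field_simp
  refine ⟨h1, ?_⟩
  have hs : 0 ≤ Real.sin (polarAngle n x v) :=
    Real.sin_nonneg_of_nonneg_of_le_pi (Real.arccos_nonneg _) (Real.arccos_le_pi _)
  refine (pow_left_inj₀ (mul_nonneg (tailNorm_nonneg _ _) hs) (tailNorm_nonneg _ _)
    two_ne_zero).1 ?_
  have := Real.sin_sq_add_cos_sq (polarAngle n x v)
  rw [← h1] at hsq
  linear_combination hsq + tailNorm v.val x ^ 2 * this

/-- The polynomial `(X_a + c X_b) ^ m` with `c ^ 2 = -1` is harmonic. -/
theorem isotropic_pow_harmonic {a b : Fin (n + 1)} (hab : a ≠ b) {c : ℂ} (hc : c ^ 2 = -1) (m : ℕ) :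
    polyLaplacian n ((X a + C c * X b) ^ m) = 0 ∧
      gradDot (X a + C c * X b) ((X a + C c * X b) ^ m) = 0 := by
  set L : MvPolynomial (Fin (n + 1)) ℂ := X a + C c * X b with hL
  have hd : ∀ i, pderiv i L = C ((if i = a then 1 else 0) + c * (if i = b then 1 else 0)) := by
    intro i
    rw [hL, map_add, pderiv_C_mul]
    simp only [pderiv_X, Pi.single_apply, eq_comm (a := a), eq_comm (a := b)]
    split_ifs <;> simp
  have h1 : polyLaplacian n L = 0 := by
    rw [polyLaplacian_apply]
    refine Finset.sum_eq_zero fun i _ => ?_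
    rw [hd, pderiv_C]
  have h2 : gradDot L L = 0 := by
    unfold gradDot
    simp only [hd, ← C_mul]
    rw [← map_sum]
    have : ∑ i : Fin (n + 1), ((if i = a then 1 else 0) + c * (if i = b then 1 else 0)) *
        ((if i = a then 1 else 0) + c * (if i = b then 1 else 0)) = 0 := by
      rw [Finset.sum_congr rfl (g := fun i => (if i = a then (1 : ℂ) else 0) +
        (if i = b then c ^ 2 else 0)) fun i _ => by
          by_cases h1 : i = a
          · have h2 : i ≠ b := by rw [h1]; exact hab
            simp [h1, hab]
          · by_cases h2 : i = b
            · simp [h2, hab.symm]; ring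
            · simp [h1, h2]]
      rw [Finset.sum_add_distrib]
      simp [hc]
    rw [this, C_0]
  induction m with
  | zero =>
    rw [pow_zero]
    exact ⟨by rw [polyLaplacian_apply]; simp, gradDot_one _⟩
  | succ m ih =>
    rw [pow_succ']
    refine ⟨?_, ?_⟩
    · rw [polyLaplacian_mul, h1, ih.1, ih.2]; simp
    · rw [gradDot_mul, h2, ih.2]; simp

/-- The factor of the hyperspherical harmonic that belongs to the `v`-th polar angle. -/
noncomputable def polarFactor (l : ℕ) (k : Fin (n - 1) → ℤ) (x : Sph n) (v : ℕ) : ℝ :=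
  if h : v < n - 1 then
    gegenbauer (((n : ℝ) - ((v : ℝ) + 1)) / 2 + (absIndex l k (v + 1) : ℝ))
        (absIndex l k v - absIndex l k (v + 1)) (Real.cos (polarAngle n x ⟨v, h⟩)) *
      Real.sin (polarAngle n x ⟨v, h⟩) ^ absIndex l k (v + 1)
  else 1

theorem harmonicUnnormalized_eq (l : ℕ) (k : Fin (n - 1) → ℤ) (x : Sph n) :
    harmonicUnnormalized n l k x = ((∏ v ∈ Finset.range (n - 1), polarFactor l k x v : ℝ) : ℂ) *
      Complex.exp (Complex.I * (lastEntry k : ℂ) * (azimuth n x : ℂ)) := by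
  rw [← Fin.prod_univ_eq_prod_range (fun v => polarFactor l k x v)]
  have h : ∀ v : Fin (n - 1), polarFactor l k x v.val =
      gegenbauer (((n : ℝ) - ((v.val : ℝ) + 1)) / 2 + (absIndex l k (v.val + 1) : ℝ))
        (absIndex l k v.val - absIndex l k (v.val + 1)) (Real.cos (polarAngle n x v)) *
      Real.sin (polarAngle n x v) ^ absIndex l k (v.val + 1) := fun v => dif_pos v.isLt
  simp only [h]
  rfl

/-- The azimuthal factor: `(x_(n-1) ± i x_n) ^ |κ|` in polar coordinates of the plane. At the origin
of the plane both sides agree, whatever the argument is there. -/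
theorem azimuth_pow (hn : 2 ≤ n) (x : Sph n) (κ : ℤ) :
    (((x.1 ⟨n - 1, by omega⟩ : ℝ) : ℂ) + (if 0 ≤ κ then Complex.I else -Complex.I) *
      ((x.1 (Fin.last n) : ℝ) : ℂ)) ^ κ.natAbs = ((tailNorm (n - 1) x : ℝ) : ℂ) ^ κ.natAbs *
        Complex.exp (Complex.I * (κ : ℂ) * (azimuth n x : ℂ)) := by
  set z : ℂ := ⟨x.1 ⟨n - 1, by omega⟩, x.1 (Fin.last n)⟩ with hz
  have hz' : z = ((x.1 ⟨n - 1, by omega⟩ : ℝ) : ℂ) + ((x.1 (Fin.last n) : ℝ) : ℂ) * Complex.I :=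
    Complex.mk_eq_add_mul_I _ _
  have h2 : tailNorm (n - 1) x ^ 2 = x.1 ⟨n - 1, by omega⟩ ^ 2 + x.1 (Fin.last n) ^ 2 := by
    rw [tailNorm_sq_succ (n - 1) (by omega), tailNorm_sq_succ (n - 1 + 1) (by omega)]
    have e1 : (⟨n - 1 + 1, by omega⟩ : Fin (n + 1)) = Fin.last n := by
      apply Fin.ext; simp; omega
    have e2 : tailNorm (n - 1 + 1 + 1) x ^ 2 = 0 := by
      rw [tailNorm_sq]
      refine Finset.sum_eq_zero fun i _ => ?_
      rw [if_neg (by omega)]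
    rw [e1, e2, add_zero]
  have hnorm : ‖z‖ = tailNorm (n - 1) x := by
    refine (pow_left_inj₀ (norm_nonneg _) (tailNorm_nonneg _ _) two_ne_zero).1 ?_
    rw [h2, Complex.sq_norm, Complex.normSq_apply]
    simp only [hz]; ring
  have hpol : z = (tailNorm (n - 1) x : ℂ) * Complex.exp ((azimuth n x : ℂ) * Complex.I) := by
    rw [← hnorm]
    exact (Complex.norm_mul_exp_arg_mul_I z).symm
  split_ifs with hκ
  · obtain ⟨m, rfl⟩ := Int.eq_ofNat_of_zero_le hκ
    rw [mul_comm Complex.I, ← hz', hpol, mul_pow, ← Complex.exp_nat_mul, Int.natAbs_natCast]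
    congr 2
    push_cast
    ring
  · obtain ⟨m, rfl⟩ : ∃ m : ℕ, κ = -(m : ℤ) := ⟨κ.natAbs, by omega⟩
    have hconj : ((x.1 ⟨n - 1, by omega⟩ : ℝ) : ℂ) + -Complex.I * ((x.1 (Fin.last n) : ℝ) : ℂ) =
        (starRingEnd ℂ) z := by
      rw [hz']; simp; ring
    rw [hconj, hpol, map_mul, Complex.conj_ofReal, ← Complex.exp_conj, map_mul, Complex.conj_ofReal,
      Complex.conj_I, mul_pow, ← Complex.exp_nat_mul, Int.natAbs_neg, Int.natAbs_natCast]
    congr 2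
    push_cast
    ring

theorem natAbs_lastEntry (hn : 2 ≤ n) (l : ℕ) (k : Fin (n - 1) → ℤ) :
    (lastEntry k).natAbs = absIndex l k (n - 1) := by
  obtain ⟨N, rfl⟩ : ∃ N, n = N + 2 := ⟨n - 2, by omega⟩
  have h : N + 2 - 2 < N + 2 - 1 := by omega
  rw [lastEntry, dif_pos h]
  change (k ⟨N, h⟩).natAbs = absIndex l k (N + 1)
  rw [absIndex, dif_pos]

/-- Starting from `(X_(n-1) ± i X_n) ^ k_(n-1)`, the hyperspherical harmonic is built up by adding
one coordinate after the other; `n - 1 - s` is the least index of a coordinate used so far. -/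
theorem exists_harmonic_tail (hn : 2 ≤ n) {l : ℕ} {k : Fin (n - 1) → ℤ} (hk : IsHarmonicIndex l k)
    (s : ℕ) (hs : s ≤ n - 1) : ∃ H : MvPolynomial (Fin (n + 1)) ℂ,
      H.IsHomogeneous (absIndex l k (n - 1 - s)) ∧ polyLaplacian n H = 0 ∧
      (∀ i : Fin (n + 1), i.val < n - 1 - s → pderiv i H = 0) ∧
      ∀ x : Sph n, eval (fun i => ((x.1 i : ℝ) : ℂ)) H =
        ((tailNorm (n - 1 - s) x ^ absIndex l k (n - 1 - s) *
          ∏ v ∈ Finset.Ico (n - 1 - s) (n - 1), polarFactor l k x v : ℝ) : ℂ) *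
        Complex.exp (Complex.I * (lastEntry k : ℂ) * (azimuth n x : ℂ)) := by
  induction s with
  | zero =>
    rw [Nat.sub_zero]
    have hab : (⟨n - 1, by omega⟩ : Fin (n + 1)) ≠ Fin.last n := by
      intro h; have := congrArg Fin.val h; simp at this; omega
    set c : ℂ := if 0 ≤ lastEntry k then Complex.I else -Complex.I with hc
    have hc2 : c ^ 2 = -1 := by rw [hc]; split_ifs <;> simp
    have hL := (isotropic_pow_harmonic hab hc2 (absIndex l k (n - 1))).1
    refine ⟨_, ?_, hL, ?_, ?_⟩
    · have h1 : (X ⟨n - 1, by omega⟩ + C c * X (Fin.last n) :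
          MvPolynomial (Fin (n + 1)) ℂ).IsHomogeneous 1 := by
        refine (isHomogeneous_X _ _).add ?_
        simpa using (isHomogeneous_C (Fin (n + 1)) c).mul (isHomogeneous_X ℂ (Fin.last n))
      simpa using h1.pow (absIndex l k (n - 1))
    · intro i hi
      rw [pderiv_pow, map_add, pderiv_C_mul, pderiv_X_of_ne, pderiv_X_of_ne]
      · simp
      · rintro rfl; simp at hi; omega
      · rintro rfl; simp at hi
    · intro x
      have h := azimuth_pow hn x (lastEntry k)
      rw [natAbs_lastEntry hn l k] at h
      simp only [map_pow, map_add, map_mul, eval_X, eval_C, Finset.Ico_self,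
        Finset.prod_empty, mul_one]
      rw [h]
      push_cast
      rfl
  | succ s ih =>
    obtain ⟨H, h1, h2, h3, h4⟩ := ih (by omega)
    obtain ⟨v, hv⟩ : ∃ v, v = n - 1 - (s + 1) := ⟨_, rfl⟩
    have hv1 : n - 1 - s = v + 1 := by omega
    have hvn : v < n - 1 := by omega
    rw [hv1] at h1 h3 h4
    rw [← hv]
    have hext := harmonic_extend (m := absIndex l k v - absIndex l k (v + 1))
      (by omega : v < n + 1) h1 h2 h3
    have hle := hk.1 v hvn
    rw [Nat.sub_add_cancel hle] at hext
    refine ⟨_, hext.1, hext.2.1, hext.2.2, fun x => ?_⟩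
    obtain ⟨hcos, hsin⟩ := tailNorm_mul_cos_sin ⟨v, hvn⟩ x
    simp only at hcos hsin
    rw [map_mul, h4, eval_gegenHom, eval_X, eval_tailSq, ← hcos, gegenHom_ofReal, ← hsin,
      Finset.prod_eq_prod_Ico_succ_bot hvn]
    have hF : polarFactor l k x v =
      gegenbauer (((n : ℝ) - ((v : ℝ) + 1)) / 2 + (absIndex l k (v + 1) : ℝ))
        (absIndex l k v - absIndex l k (v + 1)) (Real.cos (polarAngle n x ⟨v, hvn⟩)) *
      Real.sin (polarAngle n x ⟨v, hvn⟩) ^ absIndex l k (v + 1) := dif_pos hvn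
    have hpow : tailNorm v x ^ absIndex l k v =
        tailNorm v x ^ (absIndex l k v - absIndex l k (v + 1)) *
          tailNorm v x ^ absIndex l k (v + 1) := by
      rw [← pow_add, Nat.sub_add_cancel hle]
    rw [hF, mul_pow, hpow]
    push_cast
    ring

/-- The hyperspherical harmonics are restrictions of harmonic homogeneous polynomials, also at the
points where the spherical coordinates degenerate. -/
theorem exists_harmonicY (hn : 2 ≤ n) {l : ℕ} {k : Fin (n - 1) → ℤ} (hk : IsHarmonicIndex l k) :
    ∃ H ∈ harmonicPoly n l, restrictToSphere n H = harmonicY n l k := by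
  obtain ⟨H, h1, h2, -, h4⟩ := exists_harmonic_tail hn hk (n - 1) le_rfl
  rw [Nat.sub_self] at h1 h4
  refine ⟨(1 / (l2norm n (harmonicUnnormalized n l k) : ℂ)) • H,
    Submodule.smul_mem _ _ (mem_harmonicPoly.2 ⟨h1, h2⟩), ?_⟩
  funext x
  have h : restrictToSphere n H x = harmonicUnnormalized n l k x := by
    rw [restrictToSphere_apply, h4, harmonicUnnormalized_eq, tailNorm_zero, one_pow, one_mul,
      Finset.range_eq_Ico]
  rw [map_smul, Pi.smul_apply, h, smul_eq_mul]
  rfl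

end Hyperspherical

/-! ### Scaling functions and wavelets -/

section Wavelets

variable {n : ℕ}

theorem l2inner_conj_symm (f g : Sph n → ℂ) :
    l2inner n f g = (starRingEnd ℂ) (l2inner n g f) := by
  unfold l2inner
  rw [map_mul, ← integral_conj]
  congr 1
  · simp
  · refine integral_congr_ae (Filter.Eventually.of_forall fun x => ?_)
    simp [mul_comm]

theorem l2inner_self (f : Sph n → ℂ) :
    l2inner n f f = ((1 / sphereArea n * ∫ x, ‖f x‖ ^ 2 ∂(sigma n) : ℝ) : ℂ) := by
  unfold l2inner
  push_cast
  rw [← integral_complex_ofReal]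
  congr 1
  refine integral_congr_ae (Filter.Eventually.of_forall fun x => ?_)
  simp only
  rw [Complex.conj_mul']
  push_cast
  rfl

theorem l2norm_sq (f : Sph n → ℂ) :
    l2norm n f ^ 2 = 1 / sphereArea n * ∫ x, ‖f x‖ ^ 2 ∂(sigma n) := by
  have h0 := sphereArea_pos n
  rw [l2norm, l2inner_self, Complex.ofReal_re, Real.sq_sqrt]
  exact mul_nonneg (by positivity) (integral_nonneg fun x => by positivity)

theorem l2inner_self_eq_l2norm_sq (f : Sph n → ℂ) : l2inner n f f = ((l2norm n f ^ 2 : ℝ) : ℂ) := by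
  rw [l2norm_sq, l2inner_self]

theorem l2norm_nonneg (f : Sph n → ℂ) : 0 ≤ l2norm n f := Real.sqrt_nonneg _

theorem l2inner_smul_left (c : ℂ) (f g : Sph n → ℂ) :
    l2inner n (c • f) g = (starRingEnd ℂ) c * l2inner n f g := by
  unfold l2inner
  rw [mul_left_comm, ← integral_const_mul ((starRingEnd ℂ) c) fun x => (starRingEnd ℂ) (f x) * g x]
  congr 1
  refine integral_congr_ae (Filter.Eventually.of_forall fun x => ?_)
  simp [mul_assoc]

theorem l2inner_smul_right (c : ℂ) (f g : Sph n → ℂ) :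
    l2inner n f (c • g) = c * l2inner n f g := by
  rw [l2inner_conj_symm, l2inner_smul_left, map_mul, Complex.conj_conj, ← l2inner_conj_symm]

theorem l2inner_sum_right {ι : Type*} (s : Finset ι) {f : Sph n → ℂ} (hf : Continuous f)
    (g : ι → Sph n → ℂ) (hg : ∀ i ∈ s, Continuous (g i)) :
    l2inner n f (∑ i ∈ s, g i) = ∑ i ∈ s, l2inner n f (g i) := by
  unfold l2inner
  rw [← Finset.mul_sum, ← integral_finsetSum]
  · simp [Finset.mul_sum]
  · intro i hi
    exact integrable_of_continuous ((Complex.continuous_conj.comp hf).mul (hg i hi))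

/-- The inequality `0 ≤ ‖f - g‖ ^ 2`, expanded. -/
theorem l2norm_sq_ge {f g : Sph n → ℂ} (hf : Continuous f) (hg : Continuous g) :
    2 * (l2inner n g f).re - l2norm n g ^ 2 ≤ l2norm n f ^ 2 := by
  have h0 := sphereArea_pos n
  have hint : ∀ {h : Sph n → ℝ}, Continuous h → Integrable h (sigma n) := fun hh =>
    hh.integrable_of_hasCompactSupport (HasCompactSupport.of_compactSpace _)
  have h1 : 0 ≤ ∫ x, ‖f x - g x‖ ^ 2 ∂(sigma n) := integral_nonneg fun x => by positivity
  have h2 : ∀ x, ‖f x - g x‖ ^ 2 =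
      ‖f x‖ ^ 2 - 2 * ((starRingEnd ℂ) (g x) * f x).re + ‖g x‖ ^ 2 := by
    intro x
    simp only [Complex.sq_norm, Complex.normSq_apply, Complex.sub_re, Complex.sub_im,
      Complex.mul_re, Complex.conj_re, Complex.conj_im]
    ring
  have hc : Continuous fun x => (starRingEnd ℂ) (g x) * f x :=
    (Complex.continuous_conj.comp hg).mul hf
  rw [integral_congr_ae (Filter.Eventually.of_forall h2), integral_add (hint (by fun_prop))
    (hint (by fun_prop)), integral_sub (hint (by fun_prop)) (hint (by fun_prop)),
    integral_const_mul] at h1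
  have h3 : (l2inner n g f).re =
      1 / sphereArea n * ∫ x, ((starRingEnd ℂ) (g x) * f x).re ∂(sigma n) := by
    have h4 : ∫ x, ((starRingEnd ℂ) (g x) * f x).re ∂(sigma n) =
        (∫ x, (starRingEnd ℂ) (g x) * f x ∂(sigma n)).re :=
      integral_re (integrable_of_continuous hc)
    rw [h4, l2inner, show (1 / (sphereArea n : ℂ)) = ((1 / sphereArea n : ℝ) : ℂ) by push_cast; rfl,
      Complex.re_ofReal_mul]
  rw [l2norm_sq, l2norm_sq, h3]
  have h5 := mul_nonneg (one_div_pos.2 h0).le h1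
  linarith

/-- The degrees in the wavelet space of level `j`. -/
abbrev waveletDegrees (j : ℕ) : Finset ℕ := Finset.Ico (2 ^ (j - 1)) (2 ^ j)

theorem psi_eq (n j : ℕ) (y : Sph n) : psi n j y =
    restrictToSphere n (((1 / Real.sqrt 2 ^ (n * j) : ℝ) : ℂ) • kernelPoly (waveletDegrees j) y) := by
  funext x
  rw [map_smul, Pi.smul_apply, restrictToSphere_kernelPoly, smul_eq_mul, ← Complex.ofReal_mul]
  rfl

theorem phi_eq (n j : ℕ) (y : Sph n) : phi n j y =
    restrictToSphere n (((1 / Real.sqrt 2 ^ (n * j) : ℝ) : ℂ) •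
      kernelPoly (Finset.range (2 ^ (j - 1))) y) := by
  funext x
  rw [map_smul, Pi.smul_apply, restrictToSphere_kernelPoly, smul_eq_mul, ← Complex.ofReal_mul]
  rfl

theorem psi_mem (n j : ℕ) (y : Sph n) : psi n j y ∈ waveletSpace n j := by
  rw [waveletSpace_eq_map, psi_eq]
  exact Submodule.mem_map_of_mem (Submodule.smul_mem _ _ (kernelPoly_mem _ y))

theorem continuous_psi (n j : ℕ) (y : Sph n) : Continuous (psi n j y) := by
  rw [psi_eq]; exact continuous_restrictToSphere _

theorem continuous_of_mem_waveletSpace {j : ℕ} {f : Sph n → ℂ} (hf : f ∈ waveletSpace n j) :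
    Continuous f := by
  rw [waveletSpace_eq_map] at hf
  obtain ⟨Q, -, rfl⟩ := hf
  exact continuous_restrictToSphere Q

theorem psi_comm (j : ℕ) (x y : Sph n) : psi n j y x = psi n j x y := by
  unfold psi
  rw [real_inner_comm]

theorem psi_self (j : ℕ) (y : Sph n) : psi n j y y = (psiKernel n j 1 : ℂ) := by
  have h : inner ℝ y.1 y.1 = (1 : ℝ) := by
    rw [real_inner_self_eq_norm_sq, mem_sphere_zero_iff_norm.1 y.2, one_pow]
  rw [psi, h]

/-- The kernel is real, so that conjugation does not affect it. -/
theorem l2inner_kernelPoly (s : Finset ℕ) (c : ℝ) (y : Sph n)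
    (Q : MvPolynomial (Fin (n + 1)) ℂ) :
    l2inner n (restrictToSphere n ((c : ℂ) • kernelPoly s y)) (restrictToSphere n Q) =
      1 / (sphereArea n : ℂ) * c * sphereInt n (Q * kernelPoly s y) := by
  rw [map_smul, l2inner_smul_left, Complex.conj_ofReal, l2inner, sphereInt_apply]
  rw [show ∫ x, (starRingEnd ℂ) (restrictToSphere n (kernelPoly s y) x) *
    restrictToSphere n Q x ∂(sigma n) =
    ∫ x, restrictToSphere n (Q * kernelPoly s y) x ∂(sigma n) from
      integral_congr_ae (Filter.Eventually.of_forall fun x => by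
        simp only
        rw [restrictToSphere_mul, restrictToSphere_kernelPoly, Complex.conj_ofReal, mul_comm])]
  ring

theorem l2inner_psi (hn : 2 ≤ n) (j : ℕ) (y : Sph n) {f : Sph n → ℂ}
    (hf : f ∈ waveletSpace n j) :
    l2inner n (psi n j y) f = ((1 / Real.sqrt 2 ^ (n * j) : ℝ) : ℂ) * f y := by
  rw [waveletSpace_eq_map] at hf
  obtain ⟨Q, hQ, rfl⟩ := hf
  have h0 : (sphereArea n : ℂ) ≠ 0 := by exact_mod_cast (sphereArea_pos n).ne'
  rw [psi_eq, l2inner_kernelPoly, sphereInt_mul_kernelPoly_of_mem hn subset_rfl y hQ]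
  field_simp

theorem l2inner_phi_psi (hn : 2 ≤ n) (j : ℕ) (x y : Sph n) :
    l2inner n (phi n j x) (psi n j y) = 0 := by
  have hd : Disjoint (waveletDegrees j) (Finset.range (2 ^ (j - 1))) := by
    rw [Finset.disjoint_left]
    intro l hl hl2
    have := (Finset.mem_Ico.1 hl).1
    have := Finset.mem_range.1 hl2
    omega
  rw [psi_eq, phi_eq, l2inner_kernelPoly, sphereInt_mul_kernelPoly_of_disjoint hn hd x
    (Submodule.smul_mem _ _ (kernelPoly_mem _ y)), mul_zero]

theorem l2norm_psi_sq (hn : 2 ≤ n) (j : ℕ) (y : Sph n) :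
    l2norm n (psi n j y) ^ 2 = 1 / Real.sqrt 2 ^ (n * j) * psiKernel n j 1 := by
  have h := l2inner_psi hn j y (psi_mem n j y)
  rw [l2inner_self_eq_l2norm_sq, psi_self, ← Complex.ofReal_mul] at h
  exact_mod_cast h

theorem sqrt_two_pow_mul_self (m : ℕ) : Real.sqrt 2 ^ m * Real.sqrt 2 ^ m = 2 ^ m := by
  rw [← mul_pow, Real.mul_self_sqrt (by norm_num)]

/-- The value of the wavelet kernel at `1`, as the difference of two telescoping sums. -/
theorem psiKernel_one (hn : 2 ≤ n) {j : ℕ} (hj : 1 ≤ j) :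
    1 / Real.sqrt 2 ^ (n * j) * psiKernel n j 1 =
      1 / (2 ^ (n * j) * (Nat.factorial n : ℝ)) *
          (((n + 2 ^ (j + 1) - 2 : ℕ) : ℝ) * (Nat.factorial (n + 2 ^ j - 2) : ℝ) /
              (Nat.factorial (2 ^ j - 1) : ℝ) -
            ((n + 2 ^ j - 2 : ℕ) : ℝ) * (Nat.factorial (n + 2 ^ (j - 1) - 2) : ℝ) /
              (Nat.factorial (2 ^ (j - 1) - 1) : ℝ)) := by
  obtain ⟨k, rfl⟩ : ∃ k, n = k + 2 := ⟨n - 2, by omega⟩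
  obtain ⟨i, rfl⟩ : ∃ i, j = i + 1 := ⟨j - 1, by omega⟩
  have hlam : lam (k + 2) = ((k : ℝ) + 1) / 2 := by unfold lam; push_cast; ring
  obtain ⟨M, hM⟩ : ∃ M, 2 ^ i = M + 1 := ⟨2 ^ i - 1, by have := Nat.one_le_two_pow (n := i); omega⟩
  have hM2 : 2 ^ (i + 1) = (2 * M + 1) + 1 := by rw [pow_succ, hM]; ring
  have hM3 : 2 ^ (i + 1 + 1) = 4 * M + 4 := by rw [pow_succ, hM2]; ring
  have h1 := sum_gegenbauer_at_one k (2 * M + 1)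
  have h2 := sum_gegenbauer_at_one k M
  rw [psiKernel, hlam, Nat.add_sub_cancel, Finset.sum_Ico_eq_sub _ (by
    exact Nat.pow_le_pow_right (by norm_num) (by omega)), hM3, hM2, hM, h1, h2,
    ← mul_assoc, div_mul_div_comm, sqrt_two_pow_mul_self]
  rw [show k + 2 + (4 * M + 4) - 2 = k + 4 * M + 4 by omega,
    show k + 2 + (2 * M + 1 + 1) - 2 = k + (2 * M + 1) + 1 by omega,
    show k + 2 + (M + 1) - 2 = k + M + 1 by omega, Nat.add_sub_cancel, Nat.add_sub_cancel]
  have e1 := Nat.factorial_ne_zero (k + 2)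
  have e2 := Nat.factorial_ne_zero M
  have e3 := Nat.factorial_ne_zero (2 * M + 1)
  push_cast
  field_simp
  ring

theorem psiKernel_one_pos (hn : 2 ≤ n) {j : ℕ} (hj : 1 ≤ j) : 0 < psiKernel n j 1 := by
  obtain ⟨k, rfl⟩ : ∃ k, n = k + 2 := ⟨n - 2, by omega⟩
  have hlam : lam (k + 2) = ((k : ℝ) + 1) / 2 := by unfold lam; push_cast; ring
  rw [psiKernel, hlam]
  refine mul_pos (by positivity) (Finset.sum_pos (fun l _ => ?_) ?_)
  · rw [gegenbauer_at_one]; positivity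
  · rw [Finset.nonempty_Ico]
    exact Nat.pow_lt_pow_right (by norm_num) (by omega)

/-- Among the functions in the wavelet space with value `1` at `y`, the normalized wavelet has the
least norm, since the value at `y` is the scalar product with the wavelet. -/
theorem isLeast_l2norm (hn : 2 ≤ n) {j : ℕ} (hj : 1 ≤ j) (y : Sph n) :
    IsLeast {r : ℝ | ∃ f ∈ waveletSpace n j, f y = 1 ∧ r = l2norm n f}
      (l2norm n (psi n j y) / psiKernel n j 1) := by
  have hP := psiKernel_one_pos hn hj
  have hP' : (psiKernel n j 1 : ℂ) ≠ 0 := by exact_mod_cast hP.ne'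
  set g : Sph n → ℂ := ((1 / psiKernel n j 1 : ℝ) : ℂ) • psi n j y with hg
  have hgW : g ∈ waveletSpace n j := Submodule.smul_mem _ _ (psi_mem n j y)
  have hgnorm : l2norm n g = l2norm n (psi n j y) / psiKernel n j 1 := by
    have h1 : ((l2norm n g ^ 2 : ℝ) : ℂ) =
        (((l2norm n (psi n j y) / psiKernel n j 1) ^ 2 : ℝ) : ℂ) := by
      rw [← l2inner_self_eq_l2norm_sq, hg, l2inner_smul_left, l2inner_smul_right,
        l2inner_self_eq_l2norm_sq, Complex.conj_ofReal]
      push_cast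
      ring
    exact (pow_left_inj₀ (l2norm_nonneg _) (div_nonneg (l2norm_nonneg _) hP.le) two_ne_zero).1
      (by exact_mod_cast h1)
  refine ⟨⟨g, hgW, ?_, hgnorm.symm⟩, ?_⟩
  · rw [hg, Pi.smul_apply, psi_self, smul_eq_mul]
    push_cast
    field_simp
  -- Here `⟨g, f⟩ = ‖g‖ ^ 2`, so that `0 ≤ ‖f - g‖ ^ 2 = ‖f‖ ^ 2 - ‖g‖ ^ 2`.
  · rintro r ⟨f, hf, hfy, rfl⟩
    have h1 := l2norm_sq_ge (continuous_of_mem_waveletSpace hf) (continuous_of_mem_waveletSpace hgW)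
    have h2 : l2inner n g f = ((1 / psiKernel n j 1 * (1 / Real.sqrt 2 ^ (n * j)) : ℝ) : ℂ) := by
      rw [hg, l2inner_smul_left, l2inner_psi hn j y hf, hfy, Complex.conj_ofReal]
      push_cast
      ring
    have h3 : l2norm n g ^ 2 = 1 / psiKernel n j 1 * (1 / Real.sqrt 2 ^ (n * j)) := by
      rw [hgnorm, div_pow, l2norm_psi_sq hn]
      field_simp
    rw [h2, Complex.ofReal_re, ← h3] at h1
    rw [← hgnorm]
    exact (pow_le_pow_iff_left₀ (l2norm_nonneg _) (l2norm_nonneg _) two_ne_zero).1 (by linarith)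

theorem zpow_sqrt_two (n j : ℕ) :
    Real.sqrt 2 ^ (((n : ℤ) - 2) * j - 2) = Real.sqrt 2 ^ (n * j) / (2 ^ (j + 1) : ℕ) := by
  have h0 : Real.sqrt 2 ≠ 0 := (Real.sqrt_pos.2 (by norm_num)).ne'
  rw [show ((n : ℤ) - 2) * j - 2 = ((n * j : ℕ) : ℤ) - ((2 * (j + 1) : ℕ) : ℤ) by push_cast; ring,
    zpow_sub₀ h0, zpow_natCast, zpow_natCast, pow_mul (Real.sqrt 2) 2, Real.sq_sqrt (by norm_num)]
  push_cast
  rfl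

/-- The sampling formula: the reproducing integral over the sphere is computed exactly by the
quadrature formula. -/
theorem sampling_formula (hn : 2 ≤ n) {j : ℕ} {f : Sph n → ℂ}
    (hf : f ∈ waveletSpace n j) :
    f = ((Real.sqrt 2 ^ (((n : ℤ) - 2) * j - 2) * Real.pi / sphereArea n : ℝ) : ℂ) •
          ∑ p : GridIndex n (j + 1),
            ((gridWeight n (j + 1) p : ℂ) * f (gridPoint n hn (j + 1) p)) •
              psi n j (gridPoint n hn (j + 1) p) := by
  have hf' := hf
  rw [waveletSpace_eq_map] at hf'
  obtain ⟨Q, hQ, rfl⟩ := hf'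
  funext y
  have h0 : (sphereArea n : ℂ) ≠ 0 := by exact_mod_cast (sphereArea_pos n).ne'
  have hs : (Real.sqrt 2 : ℂ) ≠ 0 := by
    exact_mod_cast (Real.sqrt_pos.2 (by norm_num : (0 : ℝ) < 2)).ne'
  have hdeg : ∀ l ∈ waveletDegrees j, l ≤ 2 ^ j := fun l hl => (Finset.mem_Ico.1 hl).2.le
  have h1 := sphereInt_mul_kernelPoly_of_mem hn subset_rfl y hQ
  -- The grid of level `j + 1` integrates the product of two functions of level `j` exactly.
  have h2 : (Q * kernelPoly (waveletDegrees j) y).totalDegree ≤ 2 ^ (j + 1) := by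
    refine (MvPolynomial.totalDegree_mul _ _).trans ?_
    have e1 := harmonicSum_totalDegree hdeg hQ
    have e2 := harmonicSum_totalDegree hdeg (kernelPoly_mem (waveletDegrees j) y)
    rw [pow_succ]
    omega
  rw [sphereInt_eq_grid_sum hn (j + 1) h2] at h1
  have h3 : ∀ x, restrictToSphere n (Q * kernelPoly (waveletDegrees j) y) x =
      restrictToSphere n Q x * ((Real.sqrt 2 : ℂ) ^ (n * j) * psi n j x y) := by
    intro x
    rw [restrictToSphere_mul, ← psi_comm, psi_eq, map_smul, Pi.smul_apply, smul_eq_mul]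
    push_cast
    field_simp
  simp only [h3] at h1
  rw [Pi.smul_apply, Finset.sum_apply, smul_eq_mul, zpow_sqrt_two]
  apply mul_right_cancel₀ h0
  rw [← h1]
  simp only [Pi.smul_apply, smul_eq_mul, Finset.mul_sum, Finset.sum_mul]
  refine Finset.sum_congr rfl fun p _ => ?_
  push_cast
  field_simp

theorem span_psi (hn : 2 ≤ n) (j : ℕ) :
    Submodule.span ℂ (Set.range fun p : GridIndex n (j + 1) =>
      psi n j (gridPoint n hn (j + 1) p)) = waveletSpace n j := by
  refine le_antisymm (Submodule.span_le.2 ?_) fun f hf => ?_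
  · rintro _ ⟨p, rfl⟩
    exact psi_mem n j _
  · rw [sampling_formula hn hf]
    refine Submodule.smul_mem _ _ (Submodule.sum_mem _ fun p _ => Submodule.smul_mem _ _ ?_)
    exact Submodule.subset_span ⟨p, rfl⟩

theorem l2inner_mem_psi (hn : 2 ≤ n) (j : ℕ) (y : Sph n) {f : Sph n → ℂ}
    (hf : f ∈ waveletSpace n j) :
    l2inner n f (psi n j y) = ((1 / Real.sqrt 2 ^ (n * j) : ℝ) : ℂ) * (starRingEnd ℂ) (f y) := by
  rw [l2inner_conj_symm, l2inner_psi hn j y hf, map_mul, Complex.conj_ofReal]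

/-- The sampling formula, inserted in the second argument of `⟨f, f⟩`. -/
theorem frame_identity (hn : 2 ≤ n) {j : ℕ} (hj : 1 ≤ j) {f : Sph n → ℂ}
    (hf : f ∈ waveletSpace n j) :
    2 ^ ((n - 1) * j - 1) * Real.pi / sphereArea n *
      ∑ p : GridIndex n (j + 1), gridWeight n (j + 1) p *
        ‖l2inner n f (psi n j (gridPoint n hn (j + 1) p))‖ ^ 2 = l2norm n f ^ 2 := by
  have hs : 0 < Real.sqrt 2 := Real.sqrt_pos.2 (by norm_num)
  have h1 : ((l2norm n f ^ 2 : ℝ) : ℂ) = l2inner n f f := (l2inner_self_eq_l2norm_sq f).symm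
  conv_rhs at h1 => arg 3; rw [sampling_formula hn hf]
  rw [l2inner_smul_right, l2inner_sum_right _ (continuous_of_mem_waveletSpace hf) _
    (fun p _ => (continuous_psi n j _).const_smul _)] at h1
  have h2 : ∀ p : GridIndex n (j + 1), l2inner n f
      (((gridWeight n (j + 1) p : ℂ) * f (gridPoint n hn (j + 1) p)) •
        psi n j (gridPoint n hn (j + 1) p)) = ((gridWeight n (j + 1) p *
          (1 / Real.sqrt 2 ^ (n * j) * ‖f (gridPoint n hn (j + 1) p)‖ ^ 2) : ℝ) : ℂ) := by
    intro p
    rw [l2inner_smul_right, l2inner_mem_psi hn j _ hf]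
    push_cast
    rw [← Complex.mul_conj']
    ring
  rw [Finset.sum_congr rfl fun p _ => h2 p] at h1
  have h3 : l2norm n f ^ 2 = Real.sqrt 2 ^ (((n : ℤ) - 2) * j - 2) * Real.pi / sphereArea n *
      ∑ p : GridIndex n (j + 1), gridWeight n (j + 1) p *
          (1 / Real.sqrt 2 ^ (n * j) * ‖f (gridPoint n hn (j + 1) p)‖ ^ 2) := by
    exact_mod_cast h1
  rw [h3, Finset.mul_sum, Finset.mul_sum]
  refine Finset.sum_congr rfl fun p _ => ?_
  rw [l2inner_mem_psi hn j _ hf, norm_mul, Complex.norm_real, RCLike.norm_conj, mul_pow,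
    Real.norm_of_nonneg (by positivity), zpow_sqrt_two]
  -- The exponent `(n - 1) j - 1` is not truncated, as `n ≥ 2` and `j ≥ 1`.
  have h4 : (2 : ℝ) ^ ((n - 1) * j - 1) * (2 ^ (j + 1) : ℕ) =
      Real.sqrt 2 ^ (n * j) * Real.sqrt 2 ^ (n * j) := by
    rw [sqrt_two_pow_mul_self]
    push_cast
    rw [← pow_add]
    congr 1
    obtain ⟨N, rfl⟩ : ∃ N, n = N + 1 := ⟨n - 1, by omega⟩
    have : 1 ≤ N * j := Nat.one_le_iff_ne_zero.2 (by
      rw [mul_ne_zero_iff]; constructor <;> omega)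
    rw [Nat.add_sub_cancel, add_mul, one_mul]
    omega
  have h5 : (2 : ℝ) ^ ((n - 1) * j - 1) =
      Real.sqrt 2 ^ (n * j) * Real.sqrt 2 ^ (n * j) / (2 ^ (j + 1) : ℕ) := by
    rw [← h4]; field_simp
  rw [h5]
  field_simp

theorem isTightFrame_psi (hn : 2 ≤ n) (hn3 : n ≤ 3) {j : ℕ} (hj : 1 ≤ j) :
    IsTightFrame n (waveletSpace n j) fun p : GridIndex n (j + 1) =>
      (Real.sqrt (gridWeight n (j + 1) p) : ℂ) • psi n j (gridPoint n hn (j + 1) p) := by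
  have h0 := sphereArea_pos n
  have hA : 0 < 2 ^ ((n - 1) * j - 1) * Real.pi / sphereArea n := by positivity
  refine ⟨fun p => Submodule.smul_mem _ _ (psi_mem n j _),
    (2 ^ ((n - 1) * j - 1) * Real.pi / sphereArea n)⁻¹, inv_pos.2 hA, fun f hf => ?_⟩
  rw [← frame_identity hn hj hf, inv_mul_cancel_left₀ hA.ne']
  refine Finset.sum_congr rfl fun p _ => ?_
  rw [l2inner_smul_right, norm_mul, mul_pow, Complex.norm_real,
    Real.norm_of_nonneg (Real.sqrt_nonneg _), Real.sq_sqrt (gridWeight_nonneg hn3 _ p)]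

/-- The Fourier coefficients of a kernel, by the reproducing property applied to `Y_l^k`. -/
theorem fourierCoefficient_kernelPoly (hn : 2 ≤ n) (s : Finset ℕ) (c : ℝ) (y : Sph n) {l : ℕ}
    {k : Fin (n - 1) → ℤ} (hk : IsHarmonicIndex l k) :
    fourierCoefficient n l k (restrictToSphere n ((c : ℂ) • kernelPoly s y)) =
      if l ∈ s then (c : ℂ) * (starRingEnd ℂ) (harmonicY n l k y) else 0 := by
  obtain ⟨H, hH, hHY⟩ := exists_harmonicY hn hk
  have h0 : (sphereArea n : ℂ) ≠ 0 := by exact_mod_cast (sphereArea_pos n).ne'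
  rw [fourierCoefficient, ← hHY, l2inner_conj_symm, l2inner_kernelPoly,
    sphereInt_mul_kernelPoly hn s y hH]
  split_ifs
  · rw [show 1 / (sphereArea n : ℂ) * c * (restrictToSphere n H y * sphereArea n) =
      c * restrictToSphere n H y by field_simp, map_mul, Complex.conj_ofReal]
  · simp

/-- The kernel contains no degree `0`, hence is orthogonal to the constants. -/
theorem integral_psi (hn : 2 ≤ n) (j : ℕ) (y : Sph n) : ∫ x, psi n j y x ∂(sigma n) = 0 := by
  have h1 : (1 : MvPolynomial (Fin (n + 1)) ℂ) ∈ harmonicPoly n 0 :=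
    mem_harmonicPoly.2 ⟨MvPolynomial.isHomogeneous_one _ _, by rw [polyLaplacian_apply]; simp⟩
  have h := sphereInt_mul_kernelPoly hn (waveletDegrees j) y h1
  rw [if_neg (by simp), one_mul] at h
  rw [psi_eq, ← sphereInt_apply, map_smul, h, smul_zero]

end Wavelets

end SphereWavelets

open SphereWavelets in
theorem mainTheorem2 (n : ℕ) (hn : 2 ≤ n) (j : ℕ) (hj : 1 ≤ j) :
    -- 1. the wavelets are real-valued
    (∀ (p : GridIndex n (j + 1)) (x : Sph n), (psi n j (gridPoint n hn (j + 1) p) x).im = 0) ∧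
    -- 2. reproducing property
    (∀ p : GridIndex n (j + 1), ∀ f ∈ waveletSpace n j,
      l2inner n (psi n j (gridPoint n hn (j + 1) p)) f =
        1 / (Real.sqrt 2 : ℂ) ^ (n * j) * f (gridPoint n hn (j + 1) p)) ∧
    -- 3. orthogonality to the scaling functions
    (∀ (q : GridIndex n j) (p : GridIndex n (j + 1)),
      l2inner n (phi n j (gridPoint n hn j q)) (psi n j (gridPoint n hn (j + 1) p)) = 0) ∧
    -- 4. norm
    (∀ p : GridIndex n (j + 1),
      l2norm n (psi n j (gridPoint n hn (j + 1) p)) ^ 2 =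
        1 / Real.sqrt 2 ^ (n * j) * psiKernel n j 1 ∧
      l2norm n (psi n j (gridPoint n hn (j + 1) p)) ^ 2 =
        1 / (2 ^ (n * j) * (Nat.factorial n : ℝ)) *
          (((n + 2 ^ (j + 1) - 2 : ℕ) : ℝ) * (Nat.factorial (n + 2 ^ j - 2) : ℝ) /
              (Nat.factorial (2 ^ j - 1) : ℝ) -
            ((n + 2 ^ j - 2 : ℕ) : ℝ) * (Nat.factorial (n + 2 ^ (j - 1) - 2) : ℝ) /
              (Nat.factorial (2 ^ (j - 1) - 1) : ℝ))) ∧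
    -- 5. localization
    (∀ p : GridIndex n (j + 1),
      IsLeast {r : ℝ | ∃ f ∈ waveletSpace n j, f (gridPoint n hn (j + 1) p) = 1 ∧
          r = l2norm n f}
        (l2norm n (psi n j (gridPoint n hn (j + 1) p)) /
          psiKernel n j (inner ℝ (gridPoint n hn (j + 1) p).1 (gridPoint n hn (j + 1) p).1))) ∧
    -- 6. span and sampling formula
    (Submodule.span ℂ (Set.range fun p : GridIndex n (j + 1) =>
        psi n j (gridPoint n hn (j + 1) p)) = waveletSpace n j ∧
      ∀ f ∈ waveletSpace n j,
        f = ((Real.sqrt 2 ^ (((n : ℤ) - 2) * j - 2) * Real.pi / sphereArea n : ℝ) : ℂ) •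
          ∑ p : GridIndex n (j + 1),
            ((gridWeight n (j + 1) p : ℂ) * f (gridPoint n hn (j + 1) p)) •
              psi n j (gridPoint n hn (j + 1) p)) ∧
    -- 7. tight frame
    ((∀ f ∈ waveletSpace n j,
        2 ^ ((n - 1) * j - 1) * Real.pi / sphereArea n *
          ∑ p : GridIndex n (j + 1), gridWeight n (j + 1) p *
            ‖l2inner n f (psi n j (gridPoint n hn (j + 1) p))‖ ^ 2 = l2norm n f ^ 2) ∧
      (n ≤ 3 → (∀ p : GridIndex n (j + 1), 0 ≤ gridWeight n (j + 1) p) ∧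
        IsTightFrame n (waveletSpace n j) fun p : GridIndex n (j + 1) =>
          (Real.sqrt (gridWeight n (j + 1) p) : ℂ) • psi n j (gridPoint n hn (j + 1) p))) ∧
    -- 8. Fourier coefficients and two-scale relation
    (∀ (p : GridIndex n (j + 1)) (l : ℕ) (k : Fin (n - 1) → ℤ), IsHarmonicIndex l k →
      ((l, k) ∈ indexSet n (j + 1) \ indexSet n j →
        fourierCoefficient n l k (psi n j (gridPoint n hn (j + 1) p)) =
            1 / (Real.sqrt 2 : ℂ) ^ (n * j) *
              (starRingEnd ℂ) (harmonicY n l k (gridPoint n hn (j + 1) p)) ∧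
        fourierCoefficient n l k (psi n j (gridPoint n hn (j + 1) p)) =
            (Real.sqrt 2 : ℂ) ^ n *
              fourierCoefficient n l k (phi n (j + 1) (gridPoint n hn (j + 1) p))) ∧
      ((l, k) ∉ indexSet n (j + 1) \ indexSet n j →
        fourierCoefficient n l k (psi n j (gridPoint n hn (j + 1) p)) = 0)) ∧
    -- 9. integral zero
    (∀ p : GridIndex n (j + 1),
      ∫ x, psi n j (gridPoint n hn (j + 1) p) x ∂(sigma n) = 0) := by
  have hcast : ((1 / Real.sqrt 2 ^ (n * j) : ℝ) : ℂ) = 1 / (Real.sqrt 2 : ℂ) ^ (n * j) := by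
    push_cast
    rfl
  refine ⟨fun p x => Complex.ofReal_im _, fun p f hf => ?_,
    fun q p => l2inner_phi_psi hn j _ _,
    fun p => ⟨l2norm_psi_sq hn j _, ?_⟩, fun p => ?_,
    ⟨span_psi hn j, fun f hf => sampling_formula hn hf⟩,
    ⟨fun f hf => frame_identity hn hj hf,
      fun hn3 => ⟨fun p => gridWeight_nonneg hn3 _ p, isTightFrame_psi hn hn3 hj⟩⟩,
    fun p l k hk => ?_, fun p => integral_psi hn j _⟩
  · rw [l2inner_psi hn j _ hf, hcast]
  · rw [l2norm_psi_sq hn j, psiKernel_one hn hj]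
  · rw [real_inner_self_eq_norm_sq, mem_sphere_zero_iff_norm.1 (gridPoint n hn (j + 1) p).2,
      one_pow]
    exact isLeast_l2norm hn hj _
  -- The indices in `I_(j+1) \ I_j` are those with `2 ^ (j - 1) ≤ l < 2 ^ j`.
  · have hmem : (l, k) ∈ indexSet n (j + 1) \ indexSet n j ↔ l ∈ waveletDegrees j := by
      simp only [indexSet, Set.mem_sdiff, Set.mem_ofPred_eq, hk, and_true, not_lt,
        Nat.add_sub_cancel, Finset.mem_Ico, waveletDegrees]
      exact and_comm
    rw [hmem, psi_eq, phi_eq, fourierCoefficient_kernelPoly hn _ _ _ hk,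
      fourierCoefficient_kernelPoly hn _ _ _ hk, hcast]
    refine ⟨fun hl => ?_, fun hl => if_neg hl⟩
    have hl2 : l ∈ Finset.range (2 ^ (j + 1 - 1)) :=
      Finset.mem_range.2 (Finset.mem_Ico.1 hl).2
    rw [if_pos hl, if_pos hl2]
    refine ⟨rfl, ?_⟩
    have hs : (Real.sqrt 2 : ℂ) ≠ 0 := by
      exact_mod_cast (Real.sqrt_pos.2 (by norm_num : (0 : ℝ) < 2)).ne'
    push_cast
    rw [mul_add, mul_one, pow_add]
    field_simp
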